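/- Let $\Bbbk$ be a field, let $\mathscr A$ and $\mathscr B$ be small dg categories over $\Bbbk$, and let $\phi$ be a dg $(\mathscr B,\mathscr A)$-bimodule, i.e. a dg functor $\mathscr A^{\mathrm{op}}\otimes_{\Bbbk}\mathscr B\to\mathscr C(\Bbbk)$, $(A,B)\mapsto\phi(A,B)$, with values in complexes over $\Bbbk$. Let $\mathscr C=\begin{pmatrix}\mathscr A&0\\ \phi&\mathscr B\end{pmatrix}$ be the directed dg category with $\mathrm{Ob}\,\mathscr C=\mathrm{Ob}\,\mathscr A\sqcup\mathrm{Ob}\,\mathscr B$ that contains $\mathscr A$ and $\mathscr B$ as full dg subcategories, with $\mathscr C(A,B)=\phi(A,B)$ and $\mathscr C(B,A)=0$ for $A\in\mathscr A$, $B\in\mathscr B$, and with composition given by the compositions of $\mathscr A$ and $\mathscr B$ and their actions on $\phi$. Let $a:\mathscr A\hookrightarrow\mathscr C$ and $b:\mathscr B\hookrightarrow\mathscr C$ be the inclusions and $a_*$, $b_*$ the restriction functors on right dg modules. A right dg module over a dg category is called perfect if it is a compact object of the derived category, that is, of the Verdier quotient of the homotopy category of right dg modules by the acyclic ones. Let $M$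 be a right dg $\mathscr C$-module. (1) $M$ is perfect if and only if the dg $\mathscr B$-module $b_*M$ and the dg $\mathscr A$-module $$\mathrm{cone}\bigl(b_*M\otimes^{\mathbf L}_{\mathscr B}\phi\to a_*M\bigr)$$ are perfect. Here the morphism is induced by the $\mathscr C$-action on $M$: $b_*M$ has an h-projective resolution, and for every h-projective resolution $\pi:P\to b_*M$ (a quasi-isomorphism with $P$ h-projective) the derived tensor product is represented by $P\otimes_{\mathscr B}\phi$, the morphism is the composition $P\otimes_{\mathscr B}\phi\xrightarrow{\pi\otimes\phi}b_*M\otimes_{\mathscr B}\phi\to a_*M$, $m\otimes x\mapsto m\cdot x$, and the equivalence holds for each choice of $\pi$. (2) In particular, if $\phi$ is right perfect, i.e. the dg $\mathscr A$-module $\phi(-,B)$ is perfect for every $B\in\mathscr B$, then $M$ is perfect if and only if both $a_*M$ and $b_*M$ are perfect. -/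

import Mathlib

open CategoryTheory CategoryTheory.Limits
open scoped TensorProduct

universe u w

namespace DG

/-! ### Dg categories, dg functors, right dg modules -/

/-- A small dg category over `k` (cohomological grading): hom-complexes `Hom X Y`, with
composition `comp h g f = g ∘ f` of homogeneous elements of degrees `i + j = n`, which is a
morphism of complexes, i.e. `d (g ∘ f) = d g ∘ f + (-1) ^ |g| g ∘ d f`. -/
structure DGCat (k : Type u) [Field k] where
  Obj : Type u
  Hom : Obj → Obj → ℤ → ModuleCat.{u} k
  d : ∀ (X Y : Obj) {m n : ℤ}, m + 1 = n → (Hom X Y m →ₗ[k] Hom X Y n)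
  d_d : ∀ (X Y : Obj) {l m n : ℤ} (h : l + 1 = m) (h' : m + 1 = n) (f : Hom X Y l),
    d X Y h' (d X Y h f) = 0
  one : ∀ X : Obj, Hom X X 0
  comp : ∀ {X Y Z : Obj} {i j n : ℤ}, i + j = n → (Hom Y Z i →ₗ[k] Hom X Y j →ₗ[k] Hom X Z n)
  one_comp : ∀ {X Y : Obj} {n : ℤ} (f : Hom X Y n), comp (zero_add n) (one Y) f = f
  comp_one : ∀ {X Y : Obj} {n : ℤ} (f : Hom X Y n), comp (add_zero n) f (one X) = f
  assoc : ∀ {X Y Z W : Obj} {i j l ij jl n : ℤ} (h₁ : i + j = ij) (h₂ : ij + l = n)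
    (h₃ : j + l = jl) (h₄ : i + jl = n) (f : Hom Z W i) (g : Hom Y Z j) (e : Hom X Y l),
    comp h₂ (comp h₁ f g) e = comp h₄ f (comp h₃ g e)
  d_comp : ∀ {X Y Z : Obj} {i i' j j' n n' : ℤ} (h : i + j = n) (hi : i + 1 = i')
    (hj : j + 1 = j') (hn : n + 1 = n') (g : Hom Y Z i) (f : Hom X Y j),
    d X Z hn (comp h g f) = comp (show i' + j = n' by omega) (d Y Z hi g) f
      + i.negOnePow • comp (show i + j' = n' by omega) g (d X Y hj f)

/-- A dg functor. -/
structure DGFunctor {k : Type u} [Field k] (A B : DGCat.{u} k) where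
  obj : A.Obj → B.Obj
  map : ∀ (X Y : A.Obj) (n : ℤ), A.Hom X Y n →ₗ[k] B.Hom (obj X) (obj Y) n
  map_d : ∀ {X Y : A.Obj} {m n : ℤ} (h : m + 1 = n) (f : A.Hom X Y m),
    map X Y n (A.d X Y h f) = B.d (obj X) (obj Y) h (map X Y m f)
  map_one : ∀ X : A.Obj, map X X 0 (A.one X) = B.one (obj X)
  map_comp : ∀ {X Y Z : A.Obj} {i j n : ℤ} (h : i + j = n) (g : A.Hom Y Z i) (f : A.Hom X Y j),
    map X Z n (A.comp h g f) = B.comp h (map Y Z i g) (map X Y j f)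

/-- A right dg `A`-module: complexes `obj X` with an action `act h m f = m · f ∈ obj X` for
`m ∈ obj Y` and `f ∈ A.Hom X Y`, satisfying `d (m · f) = d m · f + (-1) ^ |m| m · d f`.
The corresponding dg functor from the opposite of `A` to complexes sends `f` to
`m ↦ (-1) ^ (|f| |m|) m · f`. -/
structure DGMod {k : Type u} [Field k] (A : DGCat.{u} k) where
  obj : A.Obj → ℤ → ModuleCat.{u} k
  d : ∀ (X : A.Obj) {m n : ℤ}, m + 1 = n → (obj X m →ₗ[k] obj X n)
  d_d : ∀ (X : A.Obj) {l m n : ℤ} (h : l + 1 = m) (h' : m + 1 = n) (x : obj X l),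
    d X h' (d X h x) = 0
  act : ∀ {X Y : A.Obj} {i j n : ℤ}, i + j = n → (obj Y i →ₗ[k] A.Hom X Y j →ₗ[k] obj X n)
  act_one : ∀ {X : A.Obj} {n : ℤ} (x : obj X n), act (add_zero n) x (A.one X) = x
  act_act : ∀ {X Y Z : A.Obj} {i j l ij jl n : ℤ} (h₁ : i + j = ij) (h₂ : ij + l = n)
    (h₃ : j + l = jl) (h₄ : i + jl = n) (x : obj Z i) (g : A.Hom Y Z j) (f : A.Hom X Y l),
    act h₂ (act h₁ x g) f = act h₄ x (A.comp h₃ g f)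
  d_act : ∀ {X Y : A.Obj} {i i' j j' n n' : ℤ} (h : i + j = n) (hi : i + 1 = i')
    (hj : j + 1 = j') (hn : n + 1 = n') (x : obj Y i) (f : A.Hom X Y j),
    d X hn (act h x f) = act (show i' + j = n' by omega) (d Y hi x) f
      + i.negOnePow • act (show i + j' = n' by omega) x (A.d X Y hj f)

namespace DGMod

variable {k : Type u} [Field k] {A : DGCat.{u} k}

/-- A closed morphism of degree zero of dg modules. -/
@[ext]
structure Hom (M N : DGMod A) where
  app : ∀ (X : A.Obj) (n : ℤ), M.obj X n →ₗ[k] N.obj X n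
  app_d : ∀ {X : A.Obj} {m n : ℤ} (h : m + 1 = n) (x : M.obj X m),
    app X n (M.d X h x) = N.d X h (app X m x)
  app_act : ∀ {X Y : A.Obj} {i j n : ℤ} (h : i + j = n) (x : M.obj Y i) (f : A.Hom X Y j),
    app X n (M.act h x f) = N.act h (app Y i x) f

/-- The category whose morphisms are the closed morphisms of degree zero. -/
instance : Category.{u} (DGMod A) where
  Hom := Hom
  id M := ⟨fun _ _ => LinearMap.id, fun _ _ => rfl, fun _ _ _ => rfl⟩
  comp f g := ⟨fun X n => (g.app X n).comp (f.app X n),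
    fun h x => by simp [f.app_d, g.app_d], fun h x a => by simp [f.app_act, g.app_act]⟩

@[ext]
lemma hom_ext {M N : DGMod A} {f g : M ⟶ N} (h : ∀ X n x, f.app X n x = g.app X n x) : f = g :=
  Hom.ext (funext fun X => funext fun n => LinearMap.ext (h X n))

@[simp] lemma id_app (M : DGMod A) (X : A.Obj) (n : ℤ) (x : M.obj X n) :
    Hom.app (𝟙 M) X n x = x := rfl

@[simp] lemma comp_app {M N P : DGMod A} (f : M ⟶ N) (g : N ⟶ P) (X : A.Obj) (n : ℤ)
    (x : M.obj X n) : Hom.app (f ≫ g) X n x = g.app X n (f.app X n x) := rfl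

section Preadditive

variable {M N : DGMod A}

instance : Zero (M ⟶ N) := ⟨⟨fun _ _ => 0, by simp, by simp⟩⟩
instance : Add (M ⟶ N) := ⟨fun f g => ⟨fun X n => f.app X n + g.app X n,
  fun h x => by simp [f.app_d, g.app_d], fun h x a => by simp [f.app_act, g.app_act]⟩⟩
instance : Neg (M ⟶ N) := ⟨fun f => ⟨fun X n => - f.app X n,
  fun h x => by simp [f.app_d], fun h x a => by simp [f.app_act]⟩⟩

@[simp] lemma zero_app (X : A.Obj) (n : ℤ) (x : M.obj X n) :
    Hom.app (0 : M ⟶ N) X n x = 0 := rfl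
@[simp] lemma add_app (f g : M ⟶ N) (X : A.Obj) (n : ℤ) (x : M.obj X n) :
    Hom.app (f + g) X n x = f.app X n x + g.app X n x := rfl
@[simp] lemma neg_app (f : M ⟶ N) (X : A.Obj) (n : ℤ) (x : M.obj X n) :
    Hom.app (-f) X n x = - f.app X n x := rfl

instance : AddCommGroup (M ⟶ N) where
  add_assoc f g h := by ext; simp [add_assoc]
  zero_add f := by ext; simp
  add_zero f := by ext; simp
  nsmul := nsmulRec
  zsmul := zsmulRec
  neg_add_cancel f := by ext; simp
  add_comm f g := by ext; simp [add_comm]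

end Preadditive

instance : Preadditive (DGMod A) where
  add_comp _ _ _ f g h := by ext; simp
  comp_add _ _ _ f g h := by ext; simp

/-- All complexes `M X` are exact. -/
def Acyclic (M : DGMod A) : Prop :=
  ∀ (X : A.Obj) (l m n : ℤ) (h : l + 1 = m) (h' : m + 1 = n) (x : M.obj X m),
    M.d X h' x = 0 → ∃ y : M.obj X l, M.d X h y = x

/-- `f` induces isomorphisms on the cohomology of the complexes at every object:
the first clause is injectivity, the second one surjectivity on cohomology. -/
def IsQuasiIso {M N : DGMod A} (f : M ⟶ N) : Prop :=
  ∀ (X : A.Obj) (l m n : ℤ) (h : l + 1 = m) (h' : m + 1 = n),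
    (∀ x : M.obj X m, M.d X h' x = 0 → (∃ y : N.obj X l, N.d X h y = f.app X m x) →
      ∃ x' : M.obj X l, M.d X h x' = x) ∧
    (∀ y : N.obj X m, N.d X h' y = 0 →
      ∃ (x : M.obj X m) (z : N.obj X l), M.d X h' x = 0 ∧ y = f.app X m x + N.d X h z)

/-! ### The homotopy category -/

/-- A morphism of degree `-1` of dg modules whose differential is `f - g`. -/
structure Homotopy {M N : DGMod A} (f g : M ⟶ N) where
  s : ∀ (X : A.Obj) {m n : ℤ}, m + 1 = n → (M.obj X n →ₗ[k] N.obj X m)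
  s_act : ∀ {X Y : A.Obj} {i i' j n n' : ℤ} (h : i + j = n) (hi : i' + 1 = i) (hn : n' + 1 = n)
    (x : M.obj Y i) (a : A.Hom X Y j),
    s X hn (M.act h x a) = N.act (show i' + j = n' by omega) (s Y hi x) a
  comm : ∀ (X : A.Obj) {l m n : ℤ} (h : l + 1 = m) (h' : m + 1 = n) (x : M.obj X m),
    f.app X m x - g.app X m x = N.d X h (s X h x) + s X h' (M.d X h' x)

namespace Homotopy

variable {M N P : DGMod A}

def refl (f : M ⟶ N) : Homotopy f f := ⟨fun _ _ _ _ => 0, by simp, by simp⟩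

def symm {f g : M ⟶ N} (H : Homotopy f g) : Homotopy g f where
  s X _ _ h := - H.s X h
  s_act h hi hn x a := by simp [H.s_act h hi hn]
  comm X _ _ _ h h' x := by
    rw [← neg_sub, H.comm X h h']; simp; abel

def add {f g f' g' : M ⟶ N} (H : Homotopy f g) (H' : Homotopy f' g') :
    Homotopy (f + f') (g + g') where
  s X _ _ h := H.s X h + H'.s X h
  s_act h hi hn x a := by simp [H.s_act h hi hn, H'.s_act h hi hn]
  comm X _ _ _ h h' x := by
    have h₁ := H.comm X h h' x
    have h₂ := H'.comm X h h' x
    simp only [add_app, LinearMap.add_apply, map_add]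
    rw [add_sub_add_comm, h₁, h₂]; abel

def trans {f g e : M ⟶ N} (H : Homotopy f g) (H' : Homotopy g e) : Homotopy f e where
  s X _ _ h := H.s X h + H'.s X h
  s_act h hi hn x a := by simp [H.s_act h hi hn, H'.s_act h hi hn]
  comm X _ _ _ h h' x := by
    have h₁ := H.comm X h h' x
    have h₂ := H'.comm X h h' x
    simp only [LinearMap.add_apply, map_add]
    rw [← sub_add_sub_cancel _ (g.app X _ x), h₁, h₂]; abel

def compLeft (e : P ⟶ M) {f g : M ⟶ N} (H : Homotopy f g) : Homotopy (e ≫ f) (e ≫ g) where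
  s X _ n h := (H.s X h).comp (e.app X n)
  s_act h hi hn x a := by simp [e.app_act, H.s_act h hi hn]
  comm X _ _ _ h h' x := by simp [H.comm X h h', e.app_d]

def compRight {f g : M ⟶ N} (H : Homotopy f g) (e : N ⟶ P) : Homotopy (f ≫ e) (g ≫ e) where
  s X m _ h := (e.app X m).comp (H.s X h)
  s_act h hi hn x a := by simp [e.app_act, H.s_act h hi hn]
  comm X _ _ _ h h' x := by
    simp only [comp_app, ← map_sub, H.comm X h h', LinearMap.comp_apply, map_add, e.app_d]

end Homotopy

variable (A) in
/-- The relation of being homotopic. -/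
def homotopic : HomRel (DGMod A) := fun _ _ f g => Nonempty (Homotopy f g)

instance : Congruence (homotopic A) where
  equivalence :=
    { refl := fun f => ⟨Homotopy.refl f⟩
      symm := fun ⟨H⟩ => ⟨H.symm⟩
      trans := fun ⟨H⟩ ⟨H'⟩ => ⟨H.trans H'⟩ }
  comp_left := fun e _ _ ⟨H⟩ => ⟨H.compLeft e⟩
  comp_right := fun e ⟨H⟩ => ⟨H.compRight e⟩

end DGMod

section

variable {k : Type u} [Field k] (A : DGCat.{u} k)

/-- The homotopy category of dg `A`-modules: closed morphisms of degree zero up to homotopy. -/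
abbrev HoMod := CategoryTheory.Quotient (DGMod.homotopic A)

instance : Preadditive (HoMod A) :=
  Quotient.preadditive _ (by
    rintro _ _ _ _ _ _ ⟨h⟩ ⟨h'⟩
    exact ⟨h.add h'⟩)

/-- The projection to the homotopy category. -/
abbrev toHo : DGMod A ⥤ HoMod A := Quotient.functor _

instance : (toHo A).Additive where

end

namespace DGMod

variable {k : Type u} [Field k] {A : DGCat.{u} k}

lemma toHo_map_eq_iff {M N : DGMod A} (f g : M ⟶ N) :
    (toHo A).map f = (toHo A).map g ↔ Nonempty (Homotopy f g) :=
  Quotient.functor_map_eq_iff _ _ _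

/-! ### Cones -/

/-- The identification of components of equal degrees. -/
def cast (M : DGMod A) (X : A.Obj) {m n : ℤ} (h : m = n) : M.obj X m →ₗ[k] M.obj X n :=
  h ▸ LinearMap.id

@[simp] lemma cast_rfl (M : DGMod A) (X : A.Obj) {m : ℤ} (x : M.obj X m) :
    M.cast X rfl x = x := rfl

/-- The cone of a closed morphism of degree zero: `cone f = M[1] ⊕ N` as a graded module,
with differential `d (x, y) = (- d x, f x + d y)` and action `(x, y) · a = (x · a, y · a)`. -/
def cone {M N : DGMod A} (f : M ⟶ N) : DGMod A where
  obj X n := ModuleCat.of k (M.obj X (n + 1) × N.obj X n)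
  d X m n h :=
    LinearMap.prod (-(M.d X (show (m + 1) + 1 = n + 1 by omega)).comp (LinearMap.fst k _ _))
      (((N.cast X h).comp (f.app X (m + 1))).comp (LinearMap.fst k _ _)
        + (N.d X h).comp (LinearMap.snd k _ _))
  d_d X l m n h h' x := by
    subst h h'
    obtain ⟨x, y⟩ := x
    apply Prod.ext
    · simp [M.d_d]
    · simp [N.d_d, f.app_d]
  act {X Y i j n} h :=
    LinearMap.mk₂ k (fun x a => (M.act (show (i + 1) + j = n + 1 by omega) x.1 a, N.act h x.2 a))
      (fun _ _ _ => by simp) (fun _ _ _ => by simp) (fun _ _ _ => by simp) (fun _ _ _ => by simp)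
  act_one x := by
    obtain ⟨x, y⟩ := x
    apply Prod.ext
    · exact M.act_one x
    · exact N.act_one y
  act_act h₁ h₂ h₃ h₄ x g f := by
    obtain ⟨x, y⟩ := x
    apply Prod.ext
    · exact M.act_act _ _ h₃ _ x g f
    · exact N.act_act _ _ h₃ _ y g f
  d_act {X Y i i' j j' n n'} h hi hj hn x a := by
    subst hi hn
    obtain ⟨x, y⟩ := x
    apply Prod.ext
    · have := M.d_act (show (i + 1) + j = n + 1 by omega) rfl hj rfl x a
      simp [this, Int.negOnePow_succ]
      abel
    · have h₁ := N.d_act h rfl hj rfl y a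
      have h₂ := f.app_act (show (i + 1) + j = n + 1 by omega) x a
      simp [h₁, h₂]
      abel

/-- The inclusion of the target in the cone. -/
def coneInr {M N : DGMod A} (f : M ⟶ N) : N ⟶ cone f where
  app X n := LinearMap.inr k _ _
  app_d {X m n} h x := by
    subst h
    exact Prod.ext (show (0 : M.obj X (m + 1 + 1)) = - M.d X rfl 0 by simp)
      (show N.d X rfl x = f.app X (m + 1) 0 + N.d X rfl x by simp)
  app_act {X Y i j n} h x a :=
    Prod.ext (show (0 : M.obj X (n + 1)) = M.act (show (i + 1) + j = n + 1 by omega) 0 a by simp)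
      rfl

/-- The composition `M ⟶ N ⟶ cone f` is null-homotopic. -/
def coneHomotopy {M N : DGMod A} (f : M ⟶ N) : Homotopy (f ≫ coneInr f) 0 where
  s X m n h := (LinearMap.inl k _ _).comp (M.cast X h.symm)
  s_act {X Y i i' j n n'} h hi hn x a := by
    subst hi hn
    exact Prod.ext rfl (show (0 : N.obj X n') = N.act (show i' + j = n' by omega) 0 a by simp)
  comm X l m n h h' x := by
    subst h h'
    exact Prod.ext (show (0 : M.obj X (l + 1 + 1)) - 0 = - M.d X rfl x + M.d X rfl x by simp)
      (show f.app X (l + 1) x - 0 = (f.app X (l + 1) x + N.d X rfl 0) + 0 by simp)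

/-- A morphism out of the cone from a null-homotopy. -/
def coneDesc {M N P : DGMod A} (f : M ⟶ N) (g : N ⟶ P) (H : Homotopy (f ≫ g) 0) :
    cone f ⟶ P where
  app X n := (H.s X rfl).comp (LinearMap.fst k _ _) + (g.app X n).comp (LinearMap.snd k _ _)
  app_d {X m n} h x := by
    subst h
    obtain ⟨x, y⟩ := x
    have h₁ : g.app X _ (f.app X _ x) - 0 = P.d X rfl (H.s X rfl x) + H.s X rfl (M.d X rfl x) :=
      H.comm X rfl rfl x
    change H.s X rfl (-M.d X rfl x) + g.app X _ (f.app X _ x + N.d X rfl y) =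
      P.d X rfl (H.s X rfl x + g.app X _ y)
    rw [sub_zero] at h₁
    rw [map_neg, map_add, map_add, h₁, g.app_d]
    abel
  app_act {X Y i j n} h x a := by
    obtain ⟨x, y⟩ := x
    have h₁ := H.s_act (show (i + 1) + j = n + 1 by omega) rfl rfl x a
    change H.s X rfl (M.act _ x a) + g.app X n (N.act h y a) =
      P.act h (H.s Y rfl x + g.app Y i y) a
    rw [h₁, g.app_act, map_add, LinearMap.add_apply]

lemma coneInr_coneDesc {M N P : DGMod A} (f : M ⟶ N) (g : N ⟶ P) (H : Homotopy (f ≫ g) 0) :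
    coneInr f ≫ coneDesc f g H = g := by
  ext X n x
  change H.s X rfl 0 + g.app X n x = g.app X n x
  simp

/-- The direct sum of two dg modules. -/
def prod (M N : DGMod A) : DGMod A where
  obj X n := ModuleCat.of k (M.obj X n × N.obj X n)
  d X _ _ h := LinearMap.prodMap (M.d X h) (N.d X h)
  d_d X _ _ _ h h' x := Prod.ext (M.d_d X h h' x.1) (N.d_d X h h' x.2)
  act h := LinearMap.mk₂ k (fun x a => (M.act h x.1 a, N.act h x.2 a))
      (fun _ _ _ => by simp) (fun _ _ _ => by simp) (fun _ _ _ => by simp) (fun _ _ _ => by simp)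
  act_one x := Prod.ext (M.act_one x.1) (N.act_one x.2)
  act_act h₁ h₂ h₃ h₄ x g f :=
    Prod.ext (M.act_act h₁ h₂ h₃ h₄ x.1 g f) (N.act_act h₁ h₂ h₃ h₄ x.2 g f)
  d_act h hi hj hn x a :=
    Prod.ext (M.d_act h hi hj hn x.1 a) (N.d_act h hi hj hn x.2 a)

def prodInl (M N : DGMod A) : M ⟶ prod M N where
  app _ _ := LinearMap.inl k _ _
  app_d {X m n} h x := Prod.ext rfl (show (0 : N.obj X n) = N.d X h 0 by simp)
  app_act {X Y i j n} h x a := Prod.ext rfl (show (0 : N.obj X n) = N.act h 0 a by simp)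

def prodInr (M N : DGMod A) : N ⟶ prod M N where
  app _ _ := LinearMap.inr k _ _
  app_d {X m n} h x := Prod.ext (show (0 : M.obj X n) = M.d X h 0 by simp) rfl
  app_act {X Y i j n} h x a := Prod.ext (show (0 : M.obj X n) = M.act h 0 a by simp) rfl

/-! ### Quasi-isomorphisms and the derived category -/

/-- A morphism is a quasi-isomorphism if and only if its cone is acyclic. -/
lemma isQuasiIso_iff_acyclic_cone {M N : DGMod A} (f : M ⟶ N) :
    IsQuasiIso f ↔ (cone f).Acyclic := by
  constructor
  · rintro hf X l m n rfl rfl ⟨x, y⟩ hxy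
    have h₁ : M.d X rfl x = 0 := neg_eq_zero.1 (congrArg Prod.fst hxy)
    have h₂ : f.app X _ x + N.d X rfl y = 0 := congrArg Prod.snd hxy
    obtain ⟨x', hx'⟩ := (hf X (l + 1) (l + 1 + 1) _ rfl rfl).1 x h₁
      ⟨-y, by rw [map_neg]; exact (eq_neg_of_add_eq_zero_left h₂).symm⟩
    have h₃ : N.d X rfl (y + f.app X _ x') = 0 := by
      rw [map_add, ← f.app_d, hx']; exact (add_comm _ _).trans h₂
    obtain ⟨x'', z, hx'', hz⟩ := (hf X l (l + 1) (l + 1 + 1) rfl rfl).2 _ h₃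
    refine ⟨((x'' - x' : M.obj X (l + 1)), z), ?_⟩
    refine Prod.ext (show - M.d X rfl (x'' - x') = x by simp [hx'', hx'])
      (show f.app X _ (x'' - x') + N.d X rfl z = y from ?_)
    rw [map_sub, sub_add_eq_add_sub, ← hz, add_sub_cancel_right]
  · rintro hf X l m n rfl rfl
    constructor
    · rintro x hx ⟨y, hy⟩
      obtain ⟨⟨x', y'⟩, h⟩ := hf X (l - 1) l (l + 1) (by omega) rfl (x, -y)
        (Prod.ext (show - M.d X rfl x = 0 by simp [hx])
          (show f.app X _ x + N.d X rfl (-y) = 0 by simp [hy]))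
      have h₁ : - M.d X _ x' = x := congrArg Prod.fst h
      refine ⟨- M.cast X (by omega) x', ?_⟩
      rw [← h₁, map_neg]
      congr 1
      have aux : ∀ (p : ℤ) (e : p = l) (q : p + 1 = l + 1) (z : M.obj X p),
          M.d X rfl (M.cast X e z) = M.d X q z := by
        rintro p rfl _ z; rfl
      exact aux _ _ _ x'
    · intro y hy
      obtain ⟨⟨x', y'⟩, h⟩ := hf X l (l + 1) (l + 1 + 1) rfl rfl (0, y)
        (Prod.ext (show - M.d X rfl 0 = 0 by simp)
          (show f.app X _ 0 + N.d X rfl y = 0 by simp [hy]))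
      have h₁ : - M.d X _ x' = 0 := congrArg Prod.fst h
      have h₂ : f.app X _ x' + N.d X _ y' = y := congrArg Prod.snd h
      exact ⟨x', y', neg_eq_zero.1 h₁, h₂.symm⟩

lemma IsQuasiIso.id (M : DGMod A) : IsQuasiIso (𝟙 M) := by
  rintro X l m n rfl rfl
  exact ⟨fun x _ ⟨y, hy⟩ => ⟨y, hy⟩, fun y hy => ⟨y, 0, hy, by simp⟩⟩

lemma IsQuasiIso.comp {M N P : DGMod A} {f : M ⟶ N} {g : N ⟶ P}
    (hf : IsQuasiIso f) (hg : IsQuasiIso g) : IsQuasiIso (f ≫ g) := by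
  rintro X l m n rfl rfl
  refine ⟨fun x hx hy => ?_, fun y hy => ?_⟩
  · exact (hf X _ _ _ rfl rfl).1 x hx
      ((hg X _ _ _ rfl rfl).1 (f.app X _ x) (by rw [← f.app_d, hx, map_zero]) hy)
  · obtain ⟨y', z, hy', e⟩ := (hg X _ _ _ rfl rfl).2 y hy
    obtain ⟨x, z', hx, e'⟩ := (hf X _ _ _ rfl rfl).2 y' hy'
    refine ⟨x, g.app X _ z' + z, hx, ?_⟩
    rw [e, e', map_add, map_add, g.app_d, comp_app, add_assoc]

/-- The base change of a quasi-isomorphism along a homotopy pushout. -/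
lemma isQuasiIso_pushout {M N P : DGMod A} {s : M ⟶ N} (hs : IsQuasiIso s) (f : M ⟶ P) :
    IsQuasiIso (prodInr N P ≫ coneInr (s ≫ prodInl N P - f ≫ prodInr N P)) := by
  rintro X l m n rfl rfl
  have key : ∀ (i : ℤ) (x : M.obj X i),
      Hom.app (s ≫ prodInl N P - f ≫ prodInr N P) X i x =
        ((s.app X i x, - f.app X i x) : (prod N P).obj X i) := by
    intro i x
    rw [sub_eq_add_neg]
    exact Prod.ext (show s.app X i x + - 0 = s.app X i x by simp)
      (show 0 + - f.app X i x = - f.app X i x by simp)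
  constructor
  · rintro p hp ⟨⟨x, ⟨a, b⟩⟩, h⟩
    have h₁ : - M.d X rfl x = 0 := congrArg Prod.fst h
    have h₂ := congrArg Prod.snd h
    change Hom.app (s ≫ prodInl N P - f ≫ prodInr N P) X (l + 1) x
      + (prod N P).d X rfl (a, b) = _ at h₂
    rw [key] at h₂
    have h₃ : s.app X _ x + N.d X rfl a = 0 := congrArg Prod.fst h₂
    have h₄ : - f.app X _ x + P.d X rfl b = p := congrArg Prod.snd h₂
    obtain ⟨x', hx'⟩ := (hs X l (l + 1) _ rfl rfl).1 x (neg_eq_zero.1 h₁)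
      ⟨-a, by rw [map_neg]; exact (eq_neg_of_add_eq_zero_left h₃).symm⟩
    refine ⟨b - f.app X _ x', ?_⟩
    rw [map_sub, ← f.app_d, hx', ← h₄]
    abel
  · rintro ⟨x, ⟨a, b⟩⟩ h
    have h₁ : - M.d X rfl x = 0 := congrArg Prod.fst h
    have h₂ := congrArg Prod.snd h
    change Hom.app (s ≫ prodInl N P - f ≫ prodInr N P) X (l + 1 + 1) x
      + (prod N P).d X rfl (a, b) = _ at h₂
    rw [key] at h₂
    have h₃ : s.app X _ x + N.d X rfl a = 0 := congrArg Prod.fst h₂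
    have h₄ : - f.app X _ x + P.d X rfl b = 0 := congrArg Prod.snd h₂
    obtain ⟨x', hx'⟩ := (hs X (l + 1) (l + 1 + 1) _ rfl rfl).1 x (neg_eq_zero.1 h₁)
      ⟨-a, by rw [map_neg]; exact (eq_neg_of_add_eq_zero_left h₃).symm⟩
    obtain ⟨x'', z, hx'', hz⟩ := (hs X l (l + 1) (l + 1 + 1) rfl rfl).2 (a + s.app X _ x')
      (by rw [map_add, ← s.app_d, hx']; exact (add_comm _ _).trans h₃)
    refine ⟨b + f.app X _ (x'' - x'), (x'' - x', (z, (0 : P.obj X l))), ?_, ?_⟩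
    · rw [map_add, ← f.app_d, map_sub, hx'', hx', zero_sub, map_neg]
      exact (add_comm _ _).trans h₄
    · refine Prod.ext (show x = 0 + - M.d X rfl (x'' - x') by simp [hx'', hx']) ?_
      change _ = (prodInr N P).app X (l + 1) (b + f.app X _ (x'' - x')) +
        (Hom.app (s ≫ prodInl N P - f ≫ prodInr N P) X (l + 1) (x'' - x')
          + (prod N P).d X rfl (z, 0))
      rw [key]
      refine Prod.ext
        (show a = 0 + (s.app X _ (x'' - x') + N.d X rfl z) from ?_)
        (show b = b + f.app X _ (x'' - x') + (- f.app X _ (x'' - x') + P.d X rfl 0) by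
          rw [map_zero, add_zero, add_neg_cancel_right])
      rw [map_sub, sub_add_eq_add_sub, ← hz]
      abel

/-- If the source of `f` is acyclic, then `N ⟶ cone f` is a quasi-isomorphism. -/
lemma isQuasiIso_coneInr {M N : DGMod A} (f : M ⟶ N) (hM : M.Acyclic) :
    IsQuasiIso (coneInr f) := by
  rintro X l m n rfl rfl
  constructor
  · rintro y hy ⟨⟨x, z⟩, h⟩
    have h₁ : - M.d X rfl x = 0 := congrArg Prod.fst h
    have h₂ : f.app X _ x + N.d X rfl z = y := congrArg Prod.snd h
    obtain ⟨x', hx'⟩ := hM X l (l + 1) _ rfl rfl x (neg_eq_zero.1 h₁)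
    refine ⟨f.app X _ x' + z, ?_⟩
    rw [map_add, ← f.app_d, hx', h₂]
  · rintro ⟨x, y⟩ h
    have h₁ : - M.d X rfl x = 0 := congrArg Prod.fst h
    have h₂ : f.app X _ x + N.d X rfl y = 0 := congrArg Prod.snd h
    obtain ⟨x', hx'⟩ := hM X (l + 1) (l + 1 + 1) _ rfl rfl x (neg_eq_zero.1 h₁)
    refine ⟨y + f.app X _ x', (- x', (0 : N.obj X l)), ?_, Prod.ext
      (show x = 0 + - M.d X rfl (- x') by simp [hx'])
      (show y = y + f.app X _ x' + (f.app X _ (- x') + N.d X rfl 0) by simp)⟩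
    rw [map_add, ← f.app_d, hx']
    exact (add_comm _ _).trans h₂

end DGMod

section

variable {k : Type u} [Field k] (A : DGCat.{u} k)

/-- The morphisms in the homotopy category whose cone is acyclic. -/
def acyclicConeW : MorphismProperty (HoMod A) :=
  fun M N f => ∃ g : M.as ⟶ N.as, (toHo A).map g = f ∧ (DGMod.cone g).Acyclic

variable {A} in
lemma acyclicConeW_map {M N : DGMod A} {f : M ⟶ N} (hf : DGMod.IsQuasiIso f) :
    acyclicConeW A ((toHo A).map f) :=
  ⟨f, rfl, (DGMod.isQuasiIso_iff_acyclic_cone f).1 hf⟩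

instance : (acyclicConeW A).IsMultiplicative where
  id_mem M := ⟨𝟙 _, rfl, (DGMod.isQuasiIso_iff_acyclic_cone _).1 (.id _)⟩
  comp_mem := by
    rintro ⟨M⟩ ⟨N⟩ ⟨P⟩ _ _ ⟨f, rfl, hf⟩ ⟨g, rfl, hg⟩
    refine ⟨f ≫ g, rfl, (DGMod.isQuasiIso_iff_acyclic_cone _).1 (.comp ?_ ?_)⟩
    · exact (DGMod.isQuasiIso_iff_acyclic_cone f).2 hf
    · exact (DGMod.isQuasiIso_iff_acyclic_cone g).2 hg

instance : (acyclicConeW A).HasLeftCalculusOfFractions where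
  exists_leftFraction := by
    rintro ⟨N⟩ ⟨P⟩ ⟨_, ⟨s, rfl, hs⟩, f⟩
    obtain ⟨f, rfl⟩ := (toHo A).map_surjective f
    let σ := s ≫ DGMod.prodInl N P - f ≫ DGMod.prodInr N P
    refine ⟨⟨(toHo A).map (DGMod.prodInl N P ≫ DGMod.coneInr σ),
      (toHo A).map (DGMod.prodInr N P ≫ DGMod.coneInr σ), acyclicConeW_map
        (DGMod.isQuasiIso_pushout ((DGMod.isQuasiIso_iff_acyclic_cone s).2 hs) f)⟩, ?_⟩
    have h := (DGMod.toHo_map_eq_iff _ _).2 ⟨DGMod.coneHomotopy σ⟩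
    have e : σ ≫ DGMod.coneInr σ = s ≫ DGMod.prodInl N P ≫ DGMod.coneInr σ
        - f ≫ DGMod.prodInr N P ≫ DGMod.coneInr σ := by
      simp [σ, Preadditive.sub_comp]
    rw [e, Functor.map_sub, Functor.map_zero, sub_eq_zero] at h
    exact h.symm
  ext := by
    rintro ⟨M⟩ ⟨N⟩ ⟨P⟩ f₁ f₂ _ ⟨s, rfl, hs⟩ h
    obtain ⟨f₁, rfl⟩ := (toHo A).map_surjective f₁
    obtain ⟨f₂, rfl⟩ := (toHo A).map_surjective f₂
    have h' : (toHo A).map (s ≫ (f₁ - f₂)) = (toHo A).map 0 := by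
      rw [Functor.map_comp, Functor.map_sub, Preadditive.comp_sub, Functor.map_zero, sub_eq_zero]
      exact h
    obtain ⟨H⟩ := (DGMod.toHo_map_eq_iff _ _).1 h'
    let φ := DGMod.coneDesc s (f₁ - f₂) H
    refine ⟨(toHo A).obj (DGMod.cone φ), (toHo A).map (DGMod.coneInr φ), acyclicConeW_map
      (DGMod.isQuasiIso_coneInr φ hs), ?_⟩
    have h₁ := (DGMod.toHo_map_eq_iff _ _).2 ⟨DGMod.coneHomotopy φ⟩
    have h₂ : (toHo A).map ((f₁ - f₂) ≫ DGMod.coneInr φ) = 0 := by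
      rw [← DGMod.coneInr_coneDesc s (f₁ - f₂) H, Category.assoc, Functor.map_comp, h₁]
      simp
    rw [Functor.map_comp, Functor.map_sub, Preadditive.sub_comp, sub_eq_zero] at h₂
    exact h₂

/-- The derived category of dg `A`-modules: the Verdier quotient of the homotopy category by
the acyclic dg modules, i.e. the localization at the morphisms whose cone is acyclic.
It is preadditive because these morphisms have a calculus of fractions. -/
abbrev Derived := (acyclicConeW A).Localization

/-- The canonical functor to the derived category. -/
noncomputable abbrev toDerived : DGMod A ⥤ Derived A := toHo A ⋙ (acyclicConeW A).Q

end

/-! ### Perfect and h-projective dg modules -/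

open Classical in
/-- An object `X` of an additive category `T` is compact if `Hom(X, -)` commutes with direct
sums: for every family `N` with a direct sum `c` in `T`, the canonical map
`⨁ j, Hom(X, N j) → Hom(X, c)` is bijective. -/
def IsCompactObject {T : Type*} [Category* T] [Preadditive T] (X : T) : Prop :=
  ∀ (J : Type w) (N : J → T) (c : Cofan N), Nonempty (IsColimit c) →
    Function.Bijective
      (DirectSum.toAddMonoid fun j => (Preadditive.rightComp X (c.inj j) : (X ⟶ N j) →+ _))

namespace DGMod

variable {k : Type u} [Field k] {A : DGCat.{u} k}

/-- `M` is perfect if it is a compact object of the derived category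
(with respect to families indexed by arbitrary small sets). -/
def Perfect (M : DGMod A) : Prop := IsCompactObject.{u} ((toDerived A).obj M)

/-- `P` is h-projective if `Hom(P, N) = 0` in the homotopy category for all acyclic `N`. -/
def HProjective (P : DGMod A) : Prop :=
  ∀ N : DGMod A, N.Acyclic → ∀ f : P ⟶ N, (toHo A).map f = 0

/-- An h-projective resolution `π : P ⟶ M`. -/
structure HProjResolution (M : DGMod A) where
  P : DGMod A
  π : P ⟶ M
  hProjective : P.HProjective
  isQuasiIso : IsQuasiIso π

/-- Restriction of dg modules along a dg functor. -/
def res {B : DGCat.{u} k} (F : DGFunctor A B) (M : DGMod B) : DGMod A where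
  obj X n := M.obj (F.obj X) n
  d X _ _ h := M.d (F.obj X) h
  d_d X _ _ _ h h' x := M.d_d (F.obj X) h h' x
  act {X Y i j n} h := (M.act h).compl₂ (F.map X Y j)
  act_one {X n} x := by simp [F.map_one, M.act_one]
  act_act h₁ h₂ h₃ h₄ x g f := by
    simp only [LinearMap.compl₂_apply, F.map_comp]
    exact M.act_act h₁ h₂ h₃ h₄ x _ _
  d_act h hi hj hn x f := by
    simp only [LinearMap.compl₂_apply, F.map_d]
    exact M.d_act h hi hj hn x _

end DGMod

/-! ### Dg bimodules and the directed dg category -/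

/-- A dg `(B, A)`-bimodule: complexes `φ(X, Y)`, contravariant in `X ∈ A` and covariant in
`Y ∈ B`, i.e. with a right action `ract h x f = x · f` of `A` and a left action
`lact h g x = g · x` of `B` that commute and are morphisms of complexes. -/
structure DGBimod {k : Type u} [Field k] (B A : DGCat.{u} k) where
  obj : A.Obj → B.Obj → ℤ → ModuleCat.{u} k
  d : ∀ (X : A.Obj) (Y : B.Obj) {m n : ℤ}, m + 1 = n → (obj X Y m →ₗ[k] obj X Y n)
  d_d : ∀ (X : A.Obj) (Y : B.Obj) {l m n : ℤ} (h : l + 1 = m) (h' : m + 1 = n) (x : obj X Y l),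
    d X Y h' (d X Y h x) = 0
  ract : ∀ {X X' : A.Obj} {Y : B.Obj} {i j n : ℤ}, i + j = n →
    (obj X' Y i →ₗ[k] A.Hom X X' j →ₗ[k] obj X Y n)
  ract_one : ∀ {X : A.Obj} {Y : B.Obj} {n : ℤ} (x : obj X Y n),
    ract (add_zero n) x (A.one X) = x
  ract_ract : ∀ {X X' X'' : A.Obj} {Y : B.Obj} {i j l ij jl n : ℤ} (h₁ : i + j = ij)
    (h₂ : ij + l = n) (h₃ : j + l = jl) (h₄ : i + jl = n)
    (x : obj X'' Y i) (g : A.Hom X' X'' j) (f : A.Hom X X' l),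
    ract h₂ (ract h₁ x g) f = ract h₄ x (A.comp h₃ g f)
  d_ract : ∀ {X X' : A.Obj} {Y : B.Obj} {i i' j j' n n' : ℤ} (h : i + j = n) (hi : i + 1 = i')
    (hj : j + 1 = j') (hn : n + 1 = n') (x : obj X' Y i) (f : A.Hom X X' j),
    d X Y hn (ract h x f) = ract (show i' + j = n' by omega) (d X' Y hi x) f
      + i.negOnePow • ract (show i + j' = n' by omega) x (A.d X X' hj f)
  lact : ∀ {X : A.Obj} {Y Y' : B.Obj} {i j n : ℤ}, i + j = n →
    (B.Hom Y Y' i →ₗ[k] obj X Y j →ₗ[k] obj X Y' n)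
  one_lact : ∀ {X : A.Obj} {Y : B.Obj} {n : ℤ} (x : obj X Y n),
    lact (zero_add n) (B.one Y) x = x
  lact_lact : ∀ {X : A.Obj} {Y Y' Y'' : B.Obj} {i j l ij jl n : ℤ} (h₁ : i + j = ij)
    (h₂ : ij + l = n) (h₃ : j + l = jl) (h₄ : i + jl = n)
    (g : B.Hom Y' Y'' i) (f : B.Hom Y Y' j) (x : obj X Y l),
    lact h₂ (B.comp h₁ g f) x = lact h₄ g (lact h₃ f x)
  d_lact : ∀ {X : A.Obj} {Y Y' : B.Obj} {i i' j j' n n' : ℤ} (h : i + j = n) (hi : i + 1 = i')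
    (hj : j + 1 = j') (hn : n + 1 = n') (g : B.Hom Y Y' i) (x : obj X Y j),
    d X Y' hn (lact h g x) = lact (show i' + j = n' by omega) (B.d Y Y' hi g) x
      + i.negOnePow • lact (show i + j' = n' by omega) g (d X Y hj x)
  lact_ract : ∀ {X X' : A.Obj} {Y Y' : B.Obj} {i j l ij jl n : ℤ} (h₁ : i + j = ij)
    (h₂ : ij + l = n) (h₃ : j + l = jl) (h₄ : i + jl = n)
    (g : B.Hom Y Y' i) (x : obj X' Y j) (f : A.Hom X X' l),
    ract h₂ (lact h₁ g x) f = lact h₄ g (ract h₃ x f)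

namespace DGBimod

variable {k : Type u} [Field k] {A B : DGCat.{u} k} (φ : DGBimod B A)

/-- The right dg `A`-module `φ(-, Y)`. -/
def right (Y : B.Obj) : DGMod A where
  obj X n := φ.obj X Y n
  d X _ _ h := φ.d X Y h
  d_d X _ _ _ h h' x := φ.d_d X Y h h' x
  act h := φ.ract h
  act_one x := φ.ract_one x
  act_act h₁ h₂ h₃ h₄ x g f := φ.ract_ract h₁ h₂ h₃ h₄ x g f
  d_act h hi hj hn x f := φ.d_ract h hi hj hn x f

/-- `φ` is right perfect if all right dg modules `φ(-, Y)` are perfect. -/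
def RightPerfect : Prop := ∀ Y : B.Obj, (φ.right Y).Perfect

/-- The hom-complexes of the directed dg category. -/
def dirHom : A.Obj ⊕ B.Obj → A.Obj ⊕ B.Obj → ℤ → ModuleCat.{u} k
  | .inl X, .inl Y, n => A.Hom X Y n
  | .inl X, .inr Y, n => φ.obj X Y n
  | .inr X, .inr Y, n => B.Hom X Y n
  | .inr _, .inl _, _ => ModuleCat.of k PUnit

/-- The differentials of the directed dg category. -/
def dirD : ∀ (X Y : A.Obj ⊕ B.Obj) {m n : ℤ}, m + 1 = n →
    (φ.dirHom X Y m →ₗ[k] φ.dirHom X Y n)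
  | .inl X, .inl Y, _, _, h => A.d X Y h
  | .inl X, .inr Y, _, _, h => φ.d X Y h
  | .inr X, .inr Y, _, _, h => B.d X Y h
  | .inr _, .inl _, _, _, _ => 0

/-- The identities of the directed dg category. -/
def dirOne : ∀ X : A.Obj ⊕ B.Obj, φ.dirHom X X 0
  | .inl X => A.one X
  | .inr Y => B.one Y

/-- The composition of the directed dg category. -/
def dirComp : ∀ (X Y Z : A.Obj ⊕ B.Obj) {i j n : ℤ}, i + j = n →
    (φ.dirHom Y Z i →ₗ[k] φ.dirHom X Y j →ₗ[k] φ.dirHom X Z n)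
  | .inl _, .inl _, .inl _, _, _, _, h => A.comp h
  | .inl _, .inl _, .inr _, _, _, _, h => φ.ract h
  | .inl _, .inr _, .inr _, _, _, _, h => φ.lact h
  | .inr _, .inr _, .inr _, _, _, _, h => B.comp h
  | _, .inr _, .inl _, _, _, _, _ => 0
  | .inr _, .inl _, _, _, _, _, _ => 0

/-- The directed dg category `(A 0; φ B)`: its objects are those of `A` and of `B`, which are
full dg subcategories, `Hom(X, Y) = φ(X, Y)` and `Hom(Y, X) = 0` for `X ∈ A` and `Y ∈ B`, and
the composition is that of `A` and `B` and the actions on `φ`. -/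
def directed : DGCat.{u} k where
  Obj := A.Obj ⊕ B.Obj
  Hom := φ.dirHom
  d := φ.dirD
  d_d := by
    rintro (X | X) (Y | Y) l m n h h' f
    · exact A.d_d X Y h h' f
    · exact φ.d_d X Y h h' f
    · rfl
    · exact B.d_d X Y h h' f
  one := φ.dirOne
  comp {X Y Z _ _ _} h := φ.dirComp X Y Z h
  one_comp := by
    rintro (X | X) (Y | Y) n f
    · exact A.one_comp f
    · exact φ.one_lact f
    · rfl
    · exact B.one_comp f
  comp_one := by
    rintro (X | X) (Y | Y) n f
    · exact A.comp_one f
    · exact φ.ract_one f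
    · rfl
    · exact B.comp_one f
  assoc := by
    rintro (X | X) (Y | Y) (Z | Z) (W | W) i j l ij jl n h₁ h₂ h₃ h₄ f g e
    all_goals first
      | exact A.assoc h₁ h₂ h₃ h₄ f g e
      | exact φ.ract_ract h₁ h₂ h₃ h₄ f g e
      | exact φ.lact_ract h₁ h₂ h₃ h₄ f g e
      | exact φ.lact_lact h₁ h₂ h₃ h₄ f g e
      | exact B.assoc h₁ h₂ h₃ h₄ f g e
      | rfl
      | (simp [dirComp]; done)
      | (simp [dirComp]; exact LinearMap.map_zero₂ (A.comp h₂) e)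
      | (simp [dirComp]; exact LinearMap.map_zero₂ (φ.lact h₂) e)
      | (simp [dirComp]; exact LinearMap.map_zero₂ (B.comp h₂) e)
  d_comp := by
    rintro (X | X) (Y | Y) (Z | Z) i i' j j' n n' h hi hj hn g f
    all_goals first
      | exact A.d_comp h hi hj hn g f
      | exact φ.d_ract h hi hj hn g f
      | exact φ.d_lact h hi hj hn g f
      | exact B.d_comp h hi hj hn g f
      | rfl
      | (simp [dirComp, dirD]; done)
      | (simp [dirComp, dirD]; exact map_zero (A.d X Z hn))
      | (simp [dirComp, dirD]; exact map_zero (B.d X Z hn))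

/-- The inclusion `a : A ↪ (A 0; φ B)`. -/
def inclA : DGFunctor A φ.directed where
  obj := Sum.inl
  map _ _ _ := LinearMap.id
  map_d _ _ := rfl
  map_one _ := rfl
  map_comp _ _ _ := rfl

/-- The inclusion `b : B ↪ (A 0; φ B)`. -/
def inclB : DGFunctor B φ.directed where
  obj := Sum.inr
  map _ _ _ := LinearMap.id
  map_d _ _ := rfl
  map_one _ := rfl
  map_comp _ _ _ := rfl

/-! ### The tensor product with a bimodule -/

/-- The degree `n` part of `⨁ Y, N(Y) ⊗ φ(X, Y)`. -/
abbrev PreTensor (N : DGMod B) (X : A.Obj) (n : ℤ) : Type u :=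
  DirectSum (B.Obj × {p : ℤ × ℤ // p.1 + p.2 = n})
    fun t => N.obj t.1 t.2.1.1 ⊗[k] φ.obj X t.1 t.2.1.2

open Classical in
/-- The element `m ⊗ x` for `m ∈ N(Y)` and `x ∈ φ(X, Y)` of degrees `i + j = n`. -/
noncomputable def preMk (N : DGMod B) (X : A.Obj) {Y : B.Obj} {i j n : ℤ} (h : i + j = n) :
    N.obj Y i →ₗ[k] φ.obj X Y j →ₗ[k] φ.PreTensor N X n :=
  (TensorProduct.mk k (N.obj Y i) (φ.obj X Y j)).compr₂
    (DirectSum.lof k (B.Obj × {p : ℤ × ℤ // p.1 + p.2 = n})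
      (fun t => N.obj t.1 t.2.1.1 ⊗[k] φ.obj X t.1 t.2.1.2) ⟨Y, ⟨(i, j), h⟩⟩)

/-- The submodule spanned by the elements `(m · b) ⊗ x - m ⊗ (b · x)`. -/
def tensorRel (N : DGMod B) (X : A.Obj) (n : ℤ) : Submodule k (φ.PreTensor N X n) :=
  Submodule.span k {z | ∃ (Y Y' : B.Obj) (i j l ij jl : ℤ) (h₁ : i + j = ij) (h₂ : ij + l = n)
    (h₃ : j + l = jl) (h₄ : i + jl = n) (m : N.obj Y' i) (b : B.Hom Y Y' j) (x : φ.obj X Y l),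
    z = φ.preMk N X h₂ (N.act h₁ m b) x - φ.preMk N X h₄ m (φ.lact h₃ b x)}

/-- The degree `n` part of `(N ⊗_B φ)(X)`. -/
abbrev Tensor (N : DGMod B) (X : A.Obj) (n : ℤ) : Type u :=
  φ.PreTensor N X n ⧸ φ.tensorRel N X n

/-- The class of `m ⊗ x` in `(N ⊗_B φ)(X)`. -/
noncomputable def tmk (N : DGMod B) (X : A.Obj) {Y : B.Obj} {i j n : ℤ} (h : i + j = n) :
    N.obj Y i →ₗ[k] φ.obj X Y j →ₗ[k] φ.Tensor N X n :=
  (φ.preMk N X h).compr₂ (φ.tensorRel N X n).mkQ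

lemma tmk_act (N : DGMod B) (X : A.Obj) {Y Y' : B.Obj} {i j l ij jl n : ℤ} (h₁ : i + j = ij)
    (h₂ : ij + l = n) (h₃ : j + l = jl) (h₄ : i + jl = n) (m : N.obj Y' i) (b : B.Hom Y Y' j)
    (x : φ.obj X Y l) :
    φ.tmk N X h₂ (N.act h₁ m b) x = φ.tmk N X h₄ m (φ.lact h₃ b x) := by
  refine (Submodule.Quotient.eq _).2 (Submodule.subset_span ?_)
  exact ⟨Y, Y', i, j, l, ij, jl, h₁, h₂, h₃, h₄, m, b, x, rfl⟩

/-- The elements `m ⊗ x` generate the tensor product. -/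
lemma tensor_hom_ext {N : DGMod B} {X : A.Obj} {n : ℤ} {V : Type*} [AddCommGroup V] [Module k V]
    {f g : φ.Tensor N X n →ₗ[k] V}
    (h : ∀ (Y : B.Obj) (i j : ℤ) (h : i + j = n) (m : N.obj Y i) (x : φ.obj X Y j),
      f (φ.tmk N X h m x) = g (φ.tmk N X h m x)) : f = g := by
  classical
  apply Submodule.linearMap_qext
  apply DirectSum.linearMap_ext
  rintro ⟨Y, ⟨⟨i, j⟩, e⟩⟩
  apply TensorProduct.ext'
  intro m x
  exact h Y i j e m x

open Classical in
/-- The linear map out of the tensor product given by balanced bilinear maps. -/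
noncomputable def tensorLift {N : DGMod B} {X : A.Obj} {n : ℤ} {V : Type*} [AddCommGroup V]
    [Module k V]
    (F : ∀ (Y : B.Obj) (i j : ℤ), i + j = n → (N.obj Y i →ₗ[k] φ.obj X Y j →ₗ[k] V))
    (hF : ∀ (Y Y' : B.Obj) (i j l ij jl : ℤ) (h₁ : i + j = ij) (h₂ : ij + l = n)
      (h₃ : j + l = jl) (h₄ : i + jl = n) (m : N.obj Y' i) (b : B.Hom Y Y' j) (x : φ.obj X Y l),
      F Y ij l h₂ (N.act h₁ m b) x = F Y' i jl h₄ m (φ.lact h₃ b x)) :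
    φ.Tensor N X n →ₗ[k] V :=
  (φ.tensorRel N X n).liftQ
    (DirectSum.toModule k _ V fun t => TensorProduct.lift (F t.1 t.2.1.1 t.2.1.2 t.2.2)) (by
      refine Submodule.span_le.2 ?_
      rintro _ ⟨Y, Y', i, j, l, ij, jl, h₁, h₂, h₃, h₄, m, b, x, rfl⟩
      have := hF Y Y' i j l ij jl h₁ h₂ h₃ h₄ m b x
      simpa [preMk, sub_eq_zero] using this)

@[simp]
lemma tensorLift_tmk {N : DGMod B} {X : A.Obj} {n : ℤ} {V : Type*} [AddCommGroup V] [Module k V]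
    (F : ∀ (Y : B.Obj) (i j : ℤ), i + j = n → (N.obj Y i →ₗ[k] φ.obj X Y j →ₗ[k] V))
    (hF) {Y : B.Obj} {i j : ℤ} (h : i + j = n) (m : N.obj Y i) (x : φ.obj X Y j) :
    φ.tensorLift F hF (φ.tmk N X h m x) = F Y i j h m x := by
  refine (Submodule.liftQ_apply _ _ (φ.preMk N X h m x)).trans ?_
  simp [preMk]

/-- The differential `d (m ⊗ x) = d m ⊗ x + (-1) ^ |m| m ⊗ d x`. -/
noncomputable def tensorD (N : DGMod B) (X : A.Obj) {n n' : ℤ} (hn : n + 1 = n') :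
    φ.Tensor N X n →ₗ[k] φ.Tensor N X n' :=
  φ.tensorLift
    (fun Y i j h => (φ.tmk N X (show (i + 1) + j = n' by omega)).comp (N.d Y rfl)
      + i.negOnePow • (φ.tmk N X (show i + (j + 1) = n' by omega)).compl₂ (φ.d X Y rfl))
    (by
      intro Y Y' i j l ij jl h₁ h₂ h₃ h₄ m b x
      have e₁ := N.d_act h₁ rfl rfl rfl m b
      have e₂ := φ.d_lact h₃ rfl rfl rfl b x
      have f₁ := φ.tmk_act N X (show (i + 1) + j = ij + 1 by omega)
        (show (ij + 1) + l = n' by omega) h₃ (show (i + 1) + jl = n' by omega) (N.d Y' rfl m) b x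
      have f₂ := φ.tmk_act N X (show i + (j + 1) = ij + 1 by omega)
        (show (ij + 1) + l = n' by omega) (show (j + 1) + l = jl + 1 by omega)
        (show i + (jl + 1) = n' by omega) m (B.d Y Y' rfl b) x
      have f₃ := φ.tmk_act N X h₁ (show ij + (l + 1) = n' by omega)
        (show j + (l + 1) = jl + 1 by omega) (show i + (jl + 1) = n' by omega) m b (φ.d X Y rfl x)
      simp only [LinearMap.add_apply, LinearMap.comp_apply, LinearMap.smul_apply,
        LinearMap.compl₂_apply, e₁, e₂, map_add, f₁, f₃, Units.smul_def, map_zsmul, f₂]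
      subst h₁
      simp only [Int.negOnePow_add, Units.val_mul, mul_smul, smul_add]
      abel)

@[simp]
lemma tensorD_tmk (N : DGMod B) (X : A.Obj) {Y : B.Obj} {i j n i' j' n' : ℤ} (h : i + j = n)
    (hn : n + 1 = n') (hi : i + 1 = i') (hj : j + 1 = j') (m : N.obj Y i) (x : φ.obj X Y j) :
    φ.tensorD N X hn (φ.tmk N X h m x) =
      φ.tmk N X (show i' + j = n' by omega) (N.d Y hi m) x
        + i.negOnePow • φ.tmk N X (show i + j' = n' by omega) m (φ.d X Y hj x) := by
  subst hi hj
  simp [tensorD]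

/-- The right action `(m ⊗ x) · a = m ⊗ (x · a)`. -/
noncomputable def tensorAct (N : DGMod B) {X X' : A.Obj} {n p q : ℤ} (h : n + p = q) :
    φ.Tensor N X' n →ₗ[k] A.Hom X X' p →ₗ[k] φ.Tensor N X q :=
  LinearMap.flip
    { toFun := fun a => φ.tensorLift
        (fun _ i j e => (φ.tmk N X (show i + (j + p) = q by omega)).compl₂
          ((φ.ract rfl).flip a))
        (by
          intro Y Y' i j l ij jl h₁ h₂ h₃ h₄ m b x
          simp only [LinearMap.compl₂_apply, LinearMap.flip_apply]
          rw [φ.tmk_act N X h₁ _ (show j + (l + p) = jl + p by omega) (by omega),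
            φ.lact_ract h₃ rfl rfl (by omega)])
      map_add' := fun a a' => by
        apply φ.tensor_hom_ext
        intros
        simp
      map_smul' := fun c a => by
        apply φ.tensor_hom_ext
        intros
        simp }

@[simp]
lemma tensorAct_tmk (N : DGMod B) {X X' : A.Obj} {Y : B.Obj} {i j n p q jp : ℤ} (h : n + p = q)
    (e : i + j = n) (e' : j + p = jp) (m : N.obj Y i) (x : φ.obj X' Y j) (a : A.Hom X X' p) :
    φ.tensorAct N h (φ.tmk N X' e m x) a =
      φ.tmk N X (show i + jp = q by omega) m (φ.ract e' x a) := by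
  subst e'
  simp [tensorAct]

/-- To prove an additive property of elements of the tensor product, prove it for `m ⊗ x`. -/
lemma tensor_induction {N : DGMod B} {X : A.Obj} {n : ℤ} {p : φ.Tensor N X n → Prop}
    (z : φ.Tensor N X n) (zero : p 0) (add : ∀ z z', p z → p z' → p (z + z'))
    (tmk : ∀ (Y : B.Obj) (i j : ℤ) (h : i + j = n) (m : N.obj Y i) (x : φ.obj X Y j),
      p (φ.tmk N X h m x)) : p z := by
  classical
  obtain ⟨z, rfl⟩ := Submodule.Quotient.mk_surjective _ z
  induction z using DirectSum.induction_on with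
  | zero => exact zero
  | add z z' h h' => exact add _ _ h h'
  | of t z =>
    obtain ⟨Y, ⟨⟨i, j⟩, e⟩⟩ := t
    induction z using TensorProduct.induction_on with
    | zero => rw [map_zero]; exact zero
    | add z z' h h' => rw [map_add]; exact add _ _ h h'
    | tmul m x => exact tmk Y i j e m x

lemma tensorD_tensorD (N : DGMod B) (X : A.Obj) {l m n : ℤ} (h : l + 1 = m) (h' : m + 1 = n)
    (z : φ.Tensor N X l) : φ.tensorD N X h' (φ.tensorD N X h z) = 0 := by
  induction z using φ.tensor_induction with
  | zero => simp
  | add z z' h h' => simp [h, h']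
  | tmk Y i j e x y =>
    rw [φ.tensorD_tmk N X e h rfl rfl, map_add, φ.tensorD_tmk N X _ h' rfl rfl,
      Units.smul_def i.negOnePow, map_zsmul, φ.tensorD_tmk N X _ h' rfl rfl]
    simp [N.d_d, φ.d_d, Int.negOnePow_succ, Units.smul_def]

lemma tensorAct_one (N : DGMod B) {X : A.Obj} {n : ℤ} (z : φ.Tensor N X n) :
    φ.tensorAct N (add_zero n) z (A.one X) = z := by
  induction z using φ.tensor_induction with
  | zero => simp
  | add z z' h h' => simp [h, h']
  | tmk Y i j e x y => rw [φ.tensorAct_tmk N _ e (add_zero j), φ.ract_one]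

lemma tensorAct_tensorAct (N : DGMod B) {X Y Z : A.Obj} {i j l ij jl n : ℤ} (h₁ : i + j = ij)
    (h₂ : ij + l = n) (h₃ : j + l = jl) (h₄ : i + jl = n) (z : φ.Tensor N Z i)
    (g : A.Hom Y Z j) (f : A.Hom X Y l) :
    φ.tensorAct N h₂ (φ.tensorAct N h₁ z g) f = φ.tensorAct N h₄ z (A.comp h₃ g f) := by
  induction z using φ.tensor_induction with
  | zero => simp
  | add z z' h h' => simp [h, h']
  | tmk W p q e x y =>
    rw [φ.tensorAct_tmk N h₁ e rfl, φ.tensorAct_tmk N h₂ _ rfl,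
      φ.tensorAct_tmk N h₄ e (show q + jl = q + j + l by omega),
      φ.ract_ract rfl rfl h₃ (by omega)]

lemma tensorD_tensorAct (N : DGMod B) {X Y : A.Obj} {i i' j j' n n' : ℤ} (h : i + j = n)
    (hi : i + 1 = i') (hj : j + 1 = j') (hn : n + 1 = n') (z : φ.Tensor N Y i)
    (f : A.Hom X Y j) :
    φ.tensorD N X hn (φ.tensorAct N h z f) =
      φ.tensorAct N (show i' + j = n' by omega) (φ.tensorD N Y hi z) f
        + i.negOnePow • φ.tensorAct N (show i + j' = n' by omega) z (A.d X Y hj f) := by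
  induction z using φ.tensor_induction with
  | zero => simp
  | add z z' h h' =>
    simp only [map_add, LinearMap.add_apply, h, h', smul_add]
    abel
  | tmk W p q e x y =>
    have h₁ := φ.d_ract (rfl : q + j = _) rfl hj rfl y f
    rw [φ.tensorAct_tmk N h e rfl, φ.tensorD_tmk N X _ hn rfl rfl, φ.tensorD_tmk N Y e hi rfl rfl,
      map_add, LinearMap.add_apply, φ.tensorAct_tmk N _ _ rfl, Units.smul_def, Units.smul_def,
      map_zsmul, LinearMap.smul_apply, φ.tensorAct_tmk N _ _ (show (q + 1) + j = q + j + 1 by omega),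
      φ.tensorAct_tmk N _ e (show q + j' = q + j + 1 by omega), h₁, map_add, Units.smul_def,
      map_zsmul, Units.smul_def, smul_add, smul_smul, ← add_assoc]
    rw [show i.negOnePow = p.negOnePow * q.negOnePow by rw [← e, Int.negOnePow_add],
      Units.val_mul]

/-- The right dg `A`-module `N ⊗_B φ`. -/
noncomputable def tensor (N : DGMod B) : DGMod A where
  obj X n := ModuleCat.of k (φ.Tensor N X n)
  d X _ _ h := φ.tensorD N X h
  d_d X _ _ _ h h' x := φ.tensorD_tensorD N X h h' x
  act h := φ.tensorAct N h
  act_one x := φ.tensorAct_one N x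
  act_act h₁ h₂ h₃ h₄ x g f := φ.tensorAct_tensorAct N h₁ h₂ h₃ h₄ x g f
  d_act h hi hj hn x f := φ.tensorD_tensorAct N h hi hj hn x f

/-- The components `m ⊗ x ↦ f m ⊗ x` of `f ⊗ φ`. -/
noncomputable def tensorMapApp {N N' : DGMod B} (f : N ⟶ N') (X : A.Obj) (n : ℤ) :
    φ.Tensor N X n →ₗ[k] φ.Tensor N' X n :=
  φ.tensorLift (fun Y _ _ h => (φ.tmk N' X h).comp (f.app Y _)) (by
    intro Y Y' i j l ij jl h₁ h₂ h₃ h₄ m b x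
    simp only [LinearMap.comp_apply, f.app_act]
    exact φ.tmk_act N' X h₁ h₂ h₃ h₄ _ b x)

@[simp]
lemma tensorMapApp_tmk {N N' : DGMod B} (f : N ⟶ N') (X : A.Obj) {Y : B.Obj} {i j n : ℤ}
    (h : i + j = n) (m : N.obj Y i) (x : φ.obj X Y j) :
    φ.tensorMapApp f X n (φ.tmk N X h m x) = φ.tmk N' X h (f.app Y i m) x := by
  simp [tensorMapApp]

/-- The morphism `f ⊗ φ : N ⊗_B φ ⟶ N' ⊗_B φ`. -/
noncomputable def tensorMap {N N' : DGMod B} (f : N ⟶ N') : φ.tensor N ⟶ φ.tensor N' where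
  app X n := φ.tensorMapApp f X n
  app_d {X m n} h z := by
    change φ.tensorMapApp f X n (φ.tensorD N X h z) = φ.tensorD N' X h (φ.tensorMapApp f X m z)
    induction z using φ.tensor_induction with
    | zero => simp
    | add z z' h h' => simp [h, h']
    | tmk W p q e x y =>
      rw [φ.tensorMapApp_tmk, φ.tensorD_tmk N X e h rfl rfl, φ.tensorD_tmk N' X e h rfl rfl,
        map_add, Units.smul_def, Units.smul_def, map_zsmul, φ.tensorMapApp_tmk,
        φ.tensorMapApp_tmk, f.app_d]
  app_act {X Y i j n} h z a := by
    change φ.tensorMapApp f X n (φ.tensorAct N h z a) =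
      φ.tensorAct N' h (φ.tensorMapApp f Y i z) a
    induction z using φ.tensor_induction with
    | zero => simp
    | add z z' h h' => simp [h, h']
    | tmk W p q e x y =>
      rw [φ.tensorMapApp_tmk, φ.tensorAct_tmk N h e rfl, φ.tensorAct_tmk N' h e rfl,
        φ.tensorMapApp_tmk]

/-- The action `(m, x) ↦ m · x` of `φ` on a dg module `M` over `(A 0; φ B)`, for
`m ∈ (b_* M)(Y)` and `x ∈ φ(X, Y)`. -/
def actionBilin (M : DGMod φ.directed) (X : A.Obj) (Y : B.Obj) {i j n : ℤ} (h : i + j = n) :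
    (M.res φ.inclB).obj Y i →ₗ[k] φ.obj X Y j →ₗ[k] (M.res φ.inclA).obj X n :=
  M.act (X := Sum.inl X) (Y := Sum.inr Y) h

lemma actionBilin_d (M : DGMod φ.directed) (X : A.Obj) (Y : B.Obj) {i i' j j' n n' : ℤ}
    (h : i + j = n) (hi : i + 1 = i') (hj : j + 1 = j') (hn : n + 1 = n')
    (m : (M.res φ.inclB).obj Y i) (x : φ.obj X Y j) :
    (M.res φ.inclA).d X hn (φ.actionBilin M X Y h m x) =
      φ.actionBilin M X Y (show i' + j = n' by omega) ((M.res φ.inclB).d Y hi m) x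
        + i.negOnePow • φ.actionBilin M X Y (show i + j' = n' by omega) m (φ.d X Y hj x) :=
  M.d_act (X := Sum.inl X) (Y := Sum.inr Y) h hi hj hn m x

lemma actionBilin_act (M : DGMod φ.directed) {X X' : A.Obj} (Y : B.Obj) {i j l ij jl n : ℤ}
    (h₁ : i + j = ij) (h₂ : ij + l = n) (h₃ : j + l = jl) (h₄ : i + jl = n)
    (m : (M.res φ.inclB).obj Y i) (x : φ.obj X' Y j) (a : A.Hom X X' l) :
    (M.res φ.inclA).act h₂ (φ.actionBilin M X' Y h₁ m x) a =
      φ.actionBilin M X Y h₄ m (φ.ract h₃ x a) :=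
  M.act_act (X := Sum.inl X) (Y := Sum.inl X') (Z := Sum.inr Y) h₁ h₂ h₃ h₄ m x a

/-- The components `m ⊗ x ↦ m · x` of the action morphism. -/
noncomputable def actionApp (M : DGMod φ.directed) (X : A.Obj) (n : ℤ) :
    φ.Tensor (M.res φ.inclB) X n →ₗ[k] (M.res φ.inclA).obj X n :=
  φ.tensorLift (fun Y _ _ h => φ.actionBilin M X Y h) (by
    intro Y Y' i j l ij jl h₁ h₂ h₃ h₄ m b x
    exact M.act_act (X := Sum.inl X) (Y := Sum.inr Y) (Z := Sum.inr Y') h₁ h₂ h₃ h₄ m b x)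

@[simp]
lemma actionApp_tmk (M : DGMod φ.directed) (X : A.Obj) {Y : B.Obj} {i j n : ℤ}
    (h : i + j = n) (m : (M.res φ.inclB).obj Y i) (x : φ.obj X Y j) :
    φ.actionApp M X n (φ.tmk (M.res φ.inclB) X h m x) = φ.actionBilin M X Y h m x :=
  φ.tensorLift_tmk (fun Y _ _ h => φ.actionBilin M X Y h) _ h m x

/-- For a dg module `M` over `(A 0; φ B)`, the morphism `b_* M ⊗_B φ ⟶ a_* M` with
`m ⊗ x ↦ m · x` given by the action on `M`. -/
noncomputable def actionMap (M : DGMod φ.directed) :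
    φ.tensor (M.res φ.inclB) ⟶ M.res φ.inclA where
  app X n := φ.actionApp M X n
  app_d {X m n} h z := by
    change φ.actionApp M X n (φ.tensorD _ X h z) =
      (M.res φ.inclA).d X h (φ.actionApp M X m z)
    induction z using φ.tensor_induction with
    | zero => simp
    | add z z' h h' => simp only [map_add, h, h']
    | tmk W p q e x y =>
      rw [φ.tensorD_tmk _ X e h rfl rfl, map_add, Units.smul_def, map_zsmul, φ.actionApp_tmk,
        φ.actionApp_tmk, φ.actionApp_tmk, φ.actionBilin_d M X W e rfl rfl h, Units.smul_def]
  app_act {X Y i j n} h z a := by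
    change φ.actionApp M X n (φ.tensorAct _ h z a) =
      (M.res φ.inclA).act h (φ.actionApp M Y i z) a
    induction z using φ.tensor_induction with
    | zero => simp
    | add z z' h h' => simp only [map_add, LinearMap.add_apply, h, h']
    | tmk W p q e x y =>
      rw [φ.tensorAct_tmk _ h e rfl, φ.actionApp_tmk, φ.actionApp_tmk,
        φ.actionBilin_act M W e h rfl]

/-- The morphism `b_* M ⊗ᴸ_B φ ⟶ a_* M` given by the action on `M`, where the derived tensor
product is computed as `P ⊗_B φ` with an h-projective resolution `π : P ⟶ b_* M`: it is the
composition of `π ⊗ φ` and the action `b_* M ⊗_B φ ⟶ a_* M`. -/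
noncomputable def derivedActionMap (M : DGMod φ.directed)
    (R : DGMod.HProjResolution (M.res φ.inclB)) : φ.tensor R.P ⟶ M.res φ.inclA :=
  φ.tensorMap R.π ≫ φ.actionMap M

end DGBimod

end DG

/-! Write `a_!`, `b_!` for induction along the two inclusions (`DGFunctor.ind`), left adjoint to the
restrictions `a_*`, `b_*`. An h-projective resolution `P → b_* M` corresponds under adjunction to a
morphism `b_! P → M`; let `E` be its cone. As `b` is fully faithful, this morphism becomes a
quasi-isomorphism on the objects of `B`, so `E` is acyclic there. On the objects of `A`, the module
`b_! P` is `P ⊗_B φ`, so `a_* E` is exactly the cone of the derived action map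
(`derivedActionMap_eq`). Since there are no morphisms from `B` to `A`, modules induced from `A`
vanish on `B`; hence a module acyclic on `B`, such as `E`, is quasi-isomorphic to `a_!` of a
resolution of its restriction to `A` (`isQuasiIso_indDesc_inclA`). Thus `M` is glued from `b_! P`
and `a_! a_* E`.

Perfection follows the pieces. Both inductions preserve it (`cpt_ind`), and `a_!` also reflects it
because `a` is fully faithful (`FullyFaithful.cpt_of_cpt_ind`). The restriction `b_*` preserves it,
because extension by zero is right adjoint to `b_*` and respects acyclic modules and direct sums
(`cpt_res_inclB`). So `b_* M` is perfect whenever `M` is; and once `b_* M` is perfect, so is `b_!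
P`, and then `M`, `E` and `a_* E` are perfect together. If `φ` is right perfect, `P ⊗_B φ` is
perfect as well, and the cone may be replaced by its target `a_* M`.

Triangulated structure is replaced by explicit complexes of graded morphisms. For h-projective `P`,
perfection is equivalent to the condition `Cpt`: the graded morphisms from `P` to a direct sum,
modulo those landing in a finite subsum, form an acyclic complex (`perfect_iff_cpt`). H-projectivity
has the same shape with the zero ideal, so `RightIdeal.Perp` treats extensions for both conditions
at once. The tensor-Hom adjunction `curry`/`uncurry`, compatible with differentials, transports both
conditions along tensor products and induction.

The equivalence needs h-projective resolutions, provided by the bar resolution (`barResolution`).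
Over a field every family of complexes is h-projective over the discrete category of objects, so
free modules are h-projective, and so is the totalization of a complex of them. The bar resolution
is functorial for graded morphisms of every degree. Applied to the modules `φ(-, Y)` it therefore
yields a bimodule `φ.bar`, and its contraction, compatible up to sign with the left action, shows
that `P ⊗ φ.bar → P ⊗ φ` is a quasi-isomorphism for every `P` (`isQuasiIso_tensorBarπ`). -/

namespace DG
namespace DGMod

variable {k : Type u} [Field k] {A : DGCat.{u} k}

/-! ### Graded morphisms of dg modules -/

/-- A graded morphism of degree `n` of dg modules, not necessarily closed. -/
structure GHom (M N : DGMod A) (n : ℤ) where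
  app : ∀ (X : A.Obj) {i j : ℤ}, i + n = j → (M.obj X i →ₗ[k] N.obj X j)
  app_act : ∀ {X Y : A.Obj} {i j p i' j' : ℤ} (h : i + n = j) (hi : i + p = i')
    (h' : i' + n = j') (x : M.obj Y i) (a : A.Hom X Y p),
    app X h' (M.act hi x a) = N.act (show j + p = j' by omega) (app Y h x) a

namespace GHom

variable {M N P Q : DGMod A} {n : ℤ}

@[ext]
lemma ext {f g : GHom M N n}
    (H : ∀ (X : A.Obj) (i j : ℤ) (h : i + n = j) (x : M.obj X i), f.app X h x = g.app X h x) :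
    f = g := by
  obtain ⟨f, hf⟩ := f
  obtain ⟨g, hg⟩ := g
  congr 1
  funext X i j h
  exact LinearMap.ext (H X i j h)

instance : Zero (GHom M N n) := ⟨⟨fun _ _ _ _ => 0, by simp⟩⟩
instance : Add (GHom M N n) := ⟨fun f g => ⟨fun X _ _ h => f.app X h + g.app X h,
  fun h hi h' x a => by simp [f.app_act h hi h', g.app_act h hi h']⟩⟩
instance : Neg (GHom M N n) := ⟨fun f => ⟨fun X _ _ h => - f.app X h,
  fun h hi h' x a => by simp [f.app_act h hi h']⟩⟩
instance : SMul k (GHom M N n) := ⟨fun c f => ⟨fun X _ _ h => c • f.app X h,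
  fun h hi h' x a => by simp [f.app_act h hi h']⟩⟩

section

variable (f g : GHom M N n) (X : A.Obj) {i j : ℤ} (h : i + n = j) (x : M.obj X i)

@[simp] lemma zero_app : (0 : GHom M N n).app X h x = 0 := rfl
@[simp] lemma add_app : (f + g).app X h x = f.app X h x + g.app X h x := rfl
@[simp] lemma neg_app : (-f).app X h x = - f.app X h x := rfl
@[simp] lemma smul_app (c : k) : (c • f).app X h x = c • f.app X h x := rfl

end

instance : AddCommGroup (GHom M N n) where
  add_assoc f g h := by ext; simp [add_assoc]
  zero_add f := by ext; simp
  add_zero f := by ext; simp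
  nsmul := nsmulRec
  zsmul := zsmulRec
  neg_add_cancel f := by ext; simp
  add_comm f g := by ext; simp [add_comm]

instance : Module k (GHom M N n) where
  one_smul f := by ext; simp
  mul_smul a b f := by ext; simp [mul_smul]
  smul_zero a := by ext; simp
  smul_add a f g := by ext; simp
  add_smul a b f := by ext; simp [add_smul]
  zero_smul f := by ext; simp

/-- Evaluation at an element. -/
def eval (X : A.Obj) {i j : ℤ} (h : i + n = j) (x : M.obj X i) : GHom M N n →ₗ[k] N.obj X j where
  toFun f := f.app X h x
  map_add' _ _ := rfl
  map_smul' _ _ := rfl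

section

variable (f g : GHom M N n) (X : A.Obj) {i j : ℤ} (h : i + n = j) (x : M.obj X i)

@[simp] lemma sub_app : (f - g).app X h x = f.app X h x - g.app X h x :=
  map_sub (eval X h x) f g
@[simp] lemma units_smul_app (c : ℤˣ) : (c • f).app X h x = c • f.app X h x := by
  rw [Units.smul_def, Units.smul_def]; exact map_zsmul (eval X h x) (c : ℤ) f
lemma sum_app {ι : Type*} (s : Finset ι) (f : ι → GHom M N n) :
    (∑ t ∈ s, f t).app X h x = ∑ t ∈ s, (f t).app X h x :=
  map_sum (eval X h x) f s

end

/-- The differential `f ↦ d ∘ f - (-1) ^ |f| f ∘ d`. -/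
def D {n n' : ℤ} (hn : n + 1 = n') : GHom M N n →ₗ[k] GHom M N n' where
  toFun f :=
    { app := fun X i j h => (N.d X (show (i + n) + 1 = j by omega)) ∘ₗ f.app X rfl
        - n.negOnePow • (f.app X (show (i + 1) + n = j by omega) ∘ₗ M.d X rfl)
      app_act := by
        intro X Y i j p i' j' h hi h' x a
        subst hi h h' hn
        have e₁ := f.app_act rfl rfl rfl x a
        have e₂ := M.d_act rfl rfl rfl rfl x a
        have e₃ := N.d_act (show (i + n) + p = i + p + n by omega) rfl rfl
          (show i + p + n + 1 = i + p + (n + 1) by omega) (f.app Y rfl x) a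
        have e₄ := f.app_act (show (i + 1) + n = i + (n + 1) by omega)
          (show i + 1 + p = i + p + 1 by omega) (show i + p + 1 + n = i + p + (n + 1) by omega)
          (M.d Y rfl x) a
        have e₅ := f.app_act (show i + n = _ from rfl)
          (show i + (p + 1) = i + p + 1 by omega) (show i + p + 1 + n = i + p + (n + 1) by omega)
          x (A.d X Y rfl a)
        have e₆ := N.d_act (show (i + n) + p = i + p + n by omega)
          (show i + n + 1 = i + (n + 1) by omega) rfl
          (show i + p + n + 1 = i + p + (n + 1) by omega) (f.app Y rfl x) a
        simp only [LinearMap.sub_apply, LinearMap.comp_apply, LinearMap.smul_apply, e₁, e₆, e₂,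
          map_add, e₄, Units.smul_def, map_zsmul, e₅, map_sub, Int.negOnePow_add,
          mul_smul, smul_add]
        rw [smul_comm (i.negOnePow : ℤ)]
        abel }
  map_add' f g := by
    ext X i j h x
    change N.d X _ (f.app X _ x + g.app X _ x) - n.negOnePow • (f.app X _ _ + g.app X _ _) =
      (N.d X _ (f.app X _ x) - n.negOnePow • f.app X _ _) +
      (N.d X _ (g.app X _ x) - n.negOnePow • g.app X _ _)
    rw [map_add, smul_add]; abel
  map_smul' c f := by
    ext X i j h x
    change N.d X _ (c • f.app X _ x) - n.negOnePow • (c • f.app X _ _) =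
      c • (N.d X _ (f.app X _ x) - n.negOnePow • f.app X _ _)
    rw [map_smul, smul_sub, Units.smul_def, Units.smul_def, smul_comm c]

lemma D_app {n n' : ℤ} (hn : n + 1 = n') (f : GHom M N n) (X : A.Obj) {i i' j j' : ℤ}
    (h : i + n' = j') (hi : i + 1 = i') (hj : j + 1 = j') (x : M.obj X i) :
    (D hn f).app X h x = N.d X hj (f.app X (show i + n = j by omega) x)
      - n.negOnePow • f.app X (show i' + n = j' by omega) (M.d X hi x) := by
  subst hi
  obtain rfl : i + n = j := by omega
  rfl

lemma map_units_smul {V W : Type*} [AddCommGroup V] [AddCommGroup W] [Module k V] [Module k W]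
    (f : V →ₗ[k] W) (c : ℤˣ) (x : V) : f (c • x) = c • f x := by
  rw [Units.smul_def, Units.smul_def, map_zsmul]

lemma D_D {n n' n'' : ℤ} (hn : n + 1 = n') (hn' : n' + 1 = n'') (f : GHom M N n) :
    D hn' (D hn f) = 0 := by
  ext X i j h x
  rw [D_app hn' _ X h rfl (show i + n' + 1 = j by omega),
    D_app hn _ X rfl rfl (show i + n + 1 = i + n' by omega),
    D_app hn _ X (show i + 1 + n' = j by omega) rfl (show i + n' + 1 = j by omega)]
  subst hn
  simp [N.d_d, M.d_d, Int.negOnePow_succ]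

/-- The composition `g ∘ f`. -/
def comp {p q r : ℤ} (h : p + q = r) : GHom M N p →ₗ[k] GHom N P q →ₗ[k] GHom M P r :=
  LinearMap.mk₂ k (fun f g =>
    { app := fun X i j e => g.app X (show (i + p) + q = j by omega) ∘ₗ f.app X rfl
      app_act := by
        intro X Y i j s i' j' e hi e' x a
        subst e hi e' h
        simp only [LinearMap.comp_apply]
        rw [f.app_act rfl rfl rfl x a, g.app_act _ _ _ _ a] })
    (fun _ _ g => by ext X i j e x; exact map_add (g.app X _) _ _)
    (fun _ _ g => by ext X i j e x; exact map_smul (g.app X _) _ _)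
    (fun _ _ _ => by ext; rfl) (fun _ _ _ => by ext; rfl)

lemma comp_app {p q r : ℤ} (h : p + q = r) (f : GHom M N p) (g : GHom N P q) (X : A.Obj)
    {i j l : ℤ} (e : i + r = l) (e' : i + p = j) (x : M.obj X i) :
    (comp h f g).app X e x = g.app X (show j + q = l by omega) (f.app X e' x) := by
  subst e'; rfl

lemma comp_assoc {p q r pq qr s : ℤ} (h₁ : p + q = pq) (h₂ : pq + r = s) (h₃ : q + r = qr)
    (h₄ : p + qr = s) (f : GHom M N p) (g : GHom N P q) (e : GHom P Q r) :
    comp h₂ (comp h₁ f g) e = comp h₄ f (comp h₃ g e) := by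
  ext X i j h x
  rw [comp_app h₂ _ _ X h rfl, comp_app h₁ _ _ X _ rfl, comp_app h₄ _ _ X _ rfl,
    comp_app h₃ _ _ X _ (show i + p + q = i + pq by omega)]

/-- Composition is written in diagrammatic order, so the sign comes from the second factor: this is
`D (g ∘ f) = D g ∘ f + (-1) ^ |g| g ∘ D f`. -/
lemma D_comp {p p' q q' r r' : ℤ} (h : p + q = r) (hp : p + 1 = p') (hq : q + 1 = q')
    (hr : r + 1 = r') (f : GHom M N p) (g : GHom N P q) :
    D hr (comp h f g) = comp (show p + q' = r' by omega) f (D hq g)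
      + q.negOnePow • comp (show p' + q = r' by omega) (D hp f) g := by
  ext X i j e x
  subst h
  rw [D_app hr _ X e rfl (show i + (p + q) + 1 = j by omega), add_app, units_smul_app,
    comp_app _ f g X _ rfl, comp_app _ f g X _ (show i + 1 + p = i + p + 1 by omega),
    comp_app _ f _ X _ rfl, comp_app _ _ g X _ (show i + p' = i + p + 1 by omega),
    D_app hq _ X _ rfl (show i + (p + q) + 1 = j by omega), D_app hp _ X _ rfl rfl,
    map_sub, map_units_smul, Int.negOnePow_add, mul_smul, smul_sub,
    smul_comm p.negOnePow]
  abel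

/-- A morphism as a graded morphism of degree zero. -/
def ofHom (f : M ⟶ N) : GHom M N 0 where
  app X i _ h := N.cast X (show i = _ by omega) ∘ₗ f.app X i
  app_act {X Y i j p i' j'} h hi h' x a := by
    obtain rfl : j = i := by omega
    obtain rfl : i' = j' := by omega
    exact f.app_act hi x a

lemma ofHom_app (f : M ⟶ N) (X : A.Obj) {i : ℤ} (h : i + 0 = i) (x : M.obj X i) :
    (ofHom f).app X h x = f.app X i x := rfl

lemma D_ofHom (f : M ⟶ N) {n : ℤ} (h : 0 + 1 = n) : D h (ofHom f) = 0 := by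
  ext X i j e x
  subst h
  rw [D_app rfl _ X e e (show i + 1 = j by omega), ofHom_app]
  obtain rfl : i + 1 = j := by omega
  rw [ofHom_app, f.app_d]
  simp

/-- A closed graded morphism of degree zero as a morphism. -/
def toHom (f : GHom M N 0) (hf : D (zero_add 1) f = 0) : M ⟶ N where
  app X n := f.app X (add_zero n)
  app_d {X m n} h x := by
    have := congrArg (fun g => g.app X (show m + 1 = n from h) x) hf
    rw [D_app _ f X _ h h] at this
    exact (sub_eq_zero.1 (by simpa using this)).symm
  app_act h x a := f.app_act _ _ _ _ _

@[simp] lemma toHom_app (f : GHom M N 0) (hf : D (zero_add 1) f = 0) (X : A.Obj) (i : ℤ)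
    (x : M.obj X i) : (toHom f hf).app X i x = f.app X (add_zero i) x := rfl

@[simp] lemma ofHom_toHom (f : GHom M N 0) (hf : D (zero_add 1) f = 0) :
    ofHom (toHom f hf) = f := by
  ext X i j e x
  obtain rfl : i = j := by omega
  rfl

lemma ofHom_injective : Function.Injective (ofHom : (M ⟶ N) → GHom M N 0) := by
  intro f g h
  ext X i x
  exact congrArg (fun f => f.app X (add_zero i) x) h

lemma ofHom_comp (f : M ⟶ N) (g : N ⟶ P) : ofHom (f ≫ g) = comp (zero_add 0) (ofHom f) (ofHom g) := by
  ext X i j e x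
  obtain rfl : i = j := by omega
  rw [comp_app _ _ _ X _ (add_zero i)]; rfl

lemma ofHom_add (f g : M ⟶ N) : ofHom (f + g) = ofHom f + ofHom g := by
  ext X i j e x
  obtain rfl : i = j := by omega
  rfl

lemma ofHom_zero : ofHom (0 : M ⟶ N) = 0 := by
  ext X i j e x
  obtain rfl : i = j := by omega
  rfl

lemma ofHom_sum {ι : Type*} (s : Finset ι) (f : ι → (M ⟶ N)) :
    ofHom (∑ t ∈ s, f t) = ∑ t ∈ s, ofHom (f t) :=
  map_sum (AddMonoidHom.mk' ofHom ofHom_add) f s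

/-- The identity. -/
abbrev id (M : DGMod A) : GHom M M 0 := ofHom (𝟙 M)

lemma id_comp {n : ℤ} (f : GHom M N n) : comp (zero_add n) (id M) f = f := by
  ext X i j e x
  rw [comp_app _ _ _ X _ (add_zero i)]; rfl

lemma comp_id {n : ℤ} (f : GHom M N n) : comp (add_zero n) f (id N) = f := by
  ext X i j e x
  rw [comp_app _ _ _ X _ e]; rfl

end GHom

/-- Homotopies are graded morphisms of degree `-1`. -/
lemma nonempty_homotopy_iff {M N : DGMod A} (f g : M ⟶ N) :
    Nonempty (Homotopy f g) ↔
      ∃ s : GHom M N (-1), GHom.D (show -1 + 1 = 0 by omega) s = GHom.ofHom f - GHom.ofHom g := by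
  constructor
  · rintro ⟨H⟩
    refine ⟨⟨fun X i j h => H.s X (show j + 1 = i by omega), fun h hi h' x a => ?_⟩, ?_⟩
    · exact H.s_act hi _ _ x a
    · ext X i j h x
      obtain rfl : i = j := by omega
      rw [GHom.D_app _ _ X _ rfl (show i - 1 + 1 = i by omega)]
      have := H.comm X (show i - 1 + 1 = i by omega) rfl x
      simpa [GHom.ofHom_app] using this.symm
  · rintro ⟨s, hs⟩
    refine ⟨⟨fun X m n h => s.app X (show n + -1 = m by omega), fun h hi hn x a => ?_, ?_⟩⟩
    · exact s.app_act _ _ _ x a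
    · intro X l m n h h' x
      have := congrArg (fun g => g.app X (add_zero m) x) hs
      rw [GHom.D_app _ _ X _ h' h] at this
      simpa [GHom.ofHom_app] using this.symm

end DGMod

end DG

/-! ### Complexes of graded morphisms: extensions, shifts, h-projectivity, cones -/

namespace DG

namespace DGMod

variable {k : Type u} [Field k] {A : DGCat.{u} k}

namespace GHom

variable {M N P Q : DGMod A}

lemma D_comp_of_closed_left {p q q' r r' : ℤ} (h : p + q = r) (hq : q + 1 = q')
    (hr : r + 1 = r') {f : GHom M N p} (hf : D (show p + 1 = p + 1 from rfl) f = 0)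
    (g : GHom N P q) :
    D hr (comp h f g) = comp (show p + q' = r' by omega) f (D hq g) := by
  rw [D_comp h rfl hq hr, hf]; simp

lemma D_comp_of_closed_right {p p' q r r' : ℤ} (h : p + q = r) (hp : p + 1 = p')
    (hr : r + 1 = r') (f : GHom M N p) {g : GHom N P q}
    (hg : D (show q + 1 = q + 1 from rfl) g = 0) :
    D hr (comp h f g) = q.negOnePow • comp (show p' + q = r' by omega) (D hp f) g := by
  rw [D_comp h hp rfl hr, hg]; simp

lemma comp_units_smul {p q r : ℤ} (h : p + q = r) (f : GHom M N p) (g : GHom N P q) (c : ℤˣ) :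
    comp h f (c • g) = c • comp h f g := by
  rw [Units.smul_def, map_zsmul, Units.smul_def]

lemma units_smul_comp {p q r : ℤ} (h : p + q = r) (f : GHom M N p) (g : GHom N P q) (c : ℤˣ) :
    comp h (c • f) g = c • comp h f g := by
  rw [Units.smul_def, map_zsmul, Units.smul_def, LinearMap.smul_apply]

lemma D_units_smul {n n' : ℤ} (h : n + 1 = n') (c : ℤˣ) (f : GHom M N n) :
    D h (c • f) = c • D h f := by
  rw [Units.smul_def, map_zsmul, Units.smul_def]

lemma exists_units_smul {n : ℤ} (c : ℤˣ) (f : GHom M N n) : ∃ g, c • g = f :=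
  ⟨c⁻¹ • f, by rw [smul_smul]; simp⟩

end GHom

open GHom

/-! ### Graded split extensions -/

/-- Data exhibiting the graded module underlying `E` as the direct sum of a shift of `P₁` and of
`P₂`, with differential twisted by `g`. -/
structure GradedSplit (P₁ P₂ E : DGMod A) (s t r : ℤ) where
  hst : s + t = 0
  hr : t + 1 = r
  g : GHom P₁ P₂ r
  i₁ : GHom P₁ E t
  i₂ : GHom P₂ E 0
  p₁ : GHom E P₁ s
  p₂ : GHom E P₂ 0
  D_i₁ : D hr i₁ = comp (add_zero r) g i₂
  D_i₂ : D rfl i₂ = 0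
  D_p₁ : D rfl p₁ = 0
  D_p₂ : D (zero_add 1) p₂ = - comp (show s + r = 1 by omega) p₁ g
  i₁_p₁ : comp (show t + s = 0 by omega) i₁ p₁ = GHom.id P₁
  i₂_p₂ : comp (add_zero 0) i₂ p₂ = GHom.id P₂
  i₁_p₂ : comp (add_zero t) i₁ p₂ = 0
  i₂_p₁ : comp (zero_add s) i₂ p₁ = 0
  total : comp hst p₁ i₁ + comp (add_zero 0) p₂ i₂ = GHom.id E

/-- A class of graded morphisms with target `L` which is stable under precomposition. -/
structure RightIdeal (L : DGMod A) where
  mem : ∀ (P : DGMod A) (n : ℤ), Submodule k (GHom P L n)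
  precomp : ∀ {P Q : DGMod A} {p q r : ℤ} (h : p + q = r) (e : GHom P Q p) (f : GHom Q L q),
    f ∈ mem Q q → comp h e f ∈ mem P r

/-- The graded morphisms from `P` to `L` modulo `I` form an acyclic complex. -/
def RightIdeal.Perp {L : DGMod A} (I : RightIdeal L) (P : DGMod A) : Prop :=
  ∀ {n n' n'' : ℤ} (h : n + 1 = n') (h' : n' + 1 = n'') (f : GHom P L n'),
    D h' f ∈ I.mem P n'' → ∃ g : GHom P L n, f - D h g ∈ I.mem P n'

lemma RightIdeal.units_smul_mem {L : DGMod A} (I : RightIdeal L) {P : DGMod A} {n : ℤ} (c : ℤˣ)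
    {f : GHom P L n} (hf : f ∈ I.mem P n) : c • f ∈ I.mem P n := by
  rw [Units.smul_def]; exact zsmul_mem hf _

namespace GradedSplit

variable {P₁ P₂ E L : DGMod A} {s t r : ℤ} (S : GradedSplit P₁ P₂ E s t r) {I : RightIdeal L}

include S

/-- The identity of `E` is the sum of the two projectors through `P₁` and `P₂`, and the ideal is
stable under precomposition; so membership can be tested on the two summands. -/
lemma mem_of_mem {n m : ℤ} (f : GHom E L n) (hm : t + n = m)
    (h₁ : comp hm S.i₁ f ∈ I.mem P₁ m) (h₂ : comp (zero_add n) S.i₂ f ∈ I.mem P₂ n) :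
    f ∈ I.mem E n := by
  have hst := S.hst
  rw [← id_comp f, ← S.total, map_add, LinearMap.add_apply,
    comp_assoc S.hst (zero_add n) hm (show s + m = n by omega),
    comp_assoc (add_zero 0) (zero_add n) (zero_add n) (zero_add n)]
  exact add_mem (I.precomp _ _ _ h₁) (I.precomp _ _ _ h₂)

lemma i₁_comp_p₁_comp {n m : ℤ} (hm : s + n = m) (f : GHom P₁ L n) :
    comp (show t + m = n by have := S.hst; omega) S.i₁ (comp hm S.p₁ f) = f := by
  have hst := S.hst
  rw [← comp_assoc (show t + s = 0 by omega) (zero_add n), S.i₁_p₁, id_comp]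

lemma i₂_comp_p₂_comp {n : ℤ} (f : GHom P₂ L n) :
    comp (zero_add n) S.i₂ (comp (zero_add n) S.p₂ f) = f := by
  rw [← comp_assoc (add_zero 0) (zero_add n), S.i₂_p₂, id_comp]

lemma i₂_comp_p₁_comp {n m : ℤ} (hm : s + n = m) (f : GHom P₁ L n) :
    comp (zero_add m) S.i₂ (comp hm S.p₁ f) = 0 := by
  rw [← comp_assoc (zero_add s) hm, S.i₂_p₁]; simp

lemma D_i₁_comp {n n' m m' : ℤ} (hn : n + 1 = n') (hm : t + n = m) (hm' : m + 1 = m')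
    (f : GHom E L n) :
    D hm' (comp hm S.i₁ f) = comp (show t + n' = m' by omega) S.i₁ (D hn f)
      + n.negOnePow • comp (show r + n = m' by have := S.hr; omega) S.g
        (comp (zero_add n) S.i₂ f) := by
  rw [D_comp hm S.hr hn hm', S.D_i₁, comp_assoc (add_zero r)]

lemma D_i₂_comp {n n' : ℤ} (hn : n + 1 = n') (f : GHom E L n) :
    D hn (comp (zero_add n) S.i₂ f) = comp (zero_add n') S.i₂ (D hn f) :=
  D_comp_of_closed_left _ hn hn S.D_i₂ f

lemma D_p₁_comp {n n' m m' : ℤ} (hn : n + 1 = n') (hm : s + n = m) (hm' : m + 1 = m')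
    (f : GHom P₁ L n) :
    D hm' (comp hm S.p₁ f) = comp (show s + n' = m' by omega) S.p₁ (D hn f) :=
  D_comp_of_closed_left _ hn hm' S.D_p₁ f

/-- Two-step correction: first make the restriction to `P₂` vanish modulo `I`, then the restriction
to `P₁`. The twist `g` couples the two restrictions only through the one to `P₂`, which by then lies
in `I`. -/
lemma perp_middle (h₁ : I.Perp P₁) (h₂ : I.Perp P₂) : I.Perp E := by
  intro n n' n'' h h' f hf
  have hr := S.hr
  obtain ⟨a, ha⟩ := h₂ h h' (comp (zero_add n') S.i₂ f)
    (by rw [S.D_i₂_comp h']; exact I.precomp _ _ _ hf)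
  -- `f'` differs from `f` by a boundary, and its restriction to `P₂` now lies in `I`.
  let f' := f - D h (comp (zero_add n) S.p₂ a)
  have hf' : D h' f' = D h' f := by rw [map_sub, D_D, sub_zero]
  have e₂ : comp (zero_add n') S.i₂ f' ∈ I.mem P₂ n' := by
    rw [map_sub, ← S.D_i₂_comp h, S.i₂_comp_p₂_comp]; exact ha
  obtain ⟨b, hb⟩ := h₁ (show t + n + 1 = t + n' by omega) (show t + n' + 1 = t + n'' by omega)
    (comp rfl S.i₁ f') (by
      rw [S.D_i₁_comp h' rfl _ f', hf']
      exact add_mem (I.precomp _ _ _ hf) (I.units_smul_mem _ (I.precomp _ _ _ e₂)))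
  have hst := S.hst
  refine ⟨comp (zero_add n) S.p₂ a + comp (show s + (t + n) = n by omega) S.p₁ b, ?_⟩
  rw [map_add, ← sub_sub]
  refine S.mem_of_mem _ rfl ?_ ?_
  · rw [map_sub]
    have := S.D_i₁_comp h rfl (show t + n + 1 = t + n' by omega)
      (comp (show s + (t + n) = n by omega) S.p₁ b)
    rw [S.i₁_comp_p₁_comp, S.i₂_comp_p₁_comp] at this
    simp only [map_zero, smul_zero, add_zero] at this
    rw [← this]
    exact hb
  · rw [map_sub, ← S.D_i₂_comp h, S.i₂_comp_p₁_comp, map_zero, sub_zero]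
    exact e₂

/-- A morphism `f` on `P₂` extends to a cocycle modulo `I` on `E` exactly when the obstruction `f ∘
g` on `P₁` is a boundary modulo `I`, which holds because `P₁` satisfies `Perp`. A primitive of the
extension restricts to a primitive of `f`. -/
lemma perp_right (h₁ : I.Perp P₁) (h : I.Perp E) : I.Perp P₂ := by
  intro n n' n'' hn hn' f hf
  have hr := S.hr
  have hst := S.hst
  obtain ⟨b, hb⟩ := h₁ (show r + n' - 1 + 1 = r + n' by omega)
    (show r + n' + 1 = r + n'' by omega) (comp rfl S.g f) (by
      -- The twist is closed: `D (D i₁) = 0` says that `i₂ ∘ D g` vanishes, and `p₂` is a left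
      -- inverse of `i₂`.
      have e : D rfl S.g = 0 := by
        have h₁ : D rfl (comp (add_zero r) S.g S.i₂) = 0 := by rw [← S.D_i₁, D_D]
        rw [D_comp_of_closed_right _ rfl _ _ S.D_i₂] at h₁
        have h₂ := congrArg (fun e => comp (add_zero _) e S.p₂) h₁
        simp only [Int.negOnePow_zero, one_smul] at h₂
        rw [comp_assoc _ _ (add_zero 0) (add_zero _), S.i₂_p₂, comp_id] at h₂
        simpa using h₂
      rw [D_comp_of_closed_left _ hn' _ e]
      exact I.precomp _ _ _ hf)
  -- The sign of the second term cancels the contribution `-(-1) ^ n' f ∘ g ∘ p₁` of `D p₂` to `D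
  -- F`, up to an element of `I`.
  let F := comp (zero_add n') S.p₂ f + n'.negOnePow • comp (show s + (r + n' - 1) = n' by omega) S.p₁ b
  have hF : D hn' F ∈ I.mem E n'' := by
    rw [map_add, D_units_smul, S.D_p₁_comp (show r + n' - 1 + 1 = r + n' by omega) _ hn',
      D_comp _ (zero_add 1) hn' hn', S.D_p₂, map_neg, LinearMap.neg_apply,
      comp_assoc _ _ (rfl : r + n' = _) (show s + (r + n') = n'' by omega), smul_neg, add_assoc,
      ← sub_eq_neg_add, sub_eq_add_neg, ← smul_neg, ← smul_add]
    refine add_mem (I.precomp _ _ _ hf) (I.units_smul_mem _ ?_)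
    have := neg_mem (I.precomp (show s + (r + n') = n'' by omega) S.p₁ _ hb)
    rw [map_sub, neg_sub] at this
    rwa [← sub_eq_add_neg]
  obtain ⟨c, hc⟩ := h hn hn' F hF
  refine ⟨comp (zero_add n) S.i₂ c, ?_⟩
  have := I.precomp (zero_add n') S.i₂ _ hc
  rw [map_sub, ← S.D_i₂_comp hn, map_add, S.i₂_comp_p₂_comp, comp_units_smul,
    S.i₂_comp_p₁_comp, smul_zero, add_zero] at this
  exact this

end GradedSplit

/-- The ideal of zero morphisms. -/
def zeroIdeal (L : DGMod A) : RightIdeal L where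
  mem _ _ := ⊥
  precomp h e f hf := by rw [(Submodule.mem_bot k).1 hf]; simp

/-! ### Shifts -/

lemma d_cast (M : DGMod A) (X : A.Obj) {i j i' : ℤ} (h : i = j) (h' : j + 1 = i')
    (x : M.obj X i) : M.d X h' (M.cast X h x) = M.d X (show i + 1 = i' by omega) x := by
  subst h; rfl

lemma cast_d (M : DGMod A) (X : A.Obj) {i i' j : ℤ} (h : i + 1 = i') (h' : i' = j)
    (x : M.obj X i) : M.cast X h' (M.d X h x) = M.d X (show i + 1 = j by omega) x := by
  subst h'; rfl

lemma cast_act (M : DGMod A) {X Y : A.Obj} {i p i' j : ℤ} (h : i + p = i') (h' : i' = j)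
    (x : M.obj Y i) (a : A.Hom X Y p) :
    M.cast X h' (M.act h x a) = M.act (show i + p = j by omega) x a := by
  subst h'; rfl

lemma act_cast (M : DGMod A) {X Y : A.Obj} {i j p i' : ℤ} (h : i = j) (h' : j + p = i')
    (x : M.obj Y i) (a : A.Hom X Y p) :
    M.act h' (M.cast Y h x) a = M.act (show i + p = i' by omega) x a := by
  subst h; rfl

lemma cast_cast (M : DGMod A) (X : A.Obj) {i j l : ℤ} (h : i = j) (h' : j = l) (x : M.obj X i) :
    M.cast X h' (M.cast X h x) = M.cast X (h.trans h') x := by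
  subst h; rfl

/-- The shift `M[s]`. -/
@[reducible]
def shift (M : DGMod A) (s : ℤ) : DGMod A where
  obj X n := M.obj X (n + s)
  d X m n h := s.negOnePow • M.d X (show m + s + 1 = n + s by omega)
  d_d X l m n h h' x := by
    simp only [LinearMap.smul_apply, map_units_smul, M.d_d, smul_zero]
  act {X Y i j n} h := M.act (show i + s + j = n + s by omega)
  act_one x := M.act_one x
  act_act {X Y Z i j l ij jl n} h₁ h₂ h₃ h₄ x g f := M.act_act _ _ h₃ _ x g f
  d_act {X Y i i' j j' n n'} h hi hj hn x f := by
    have := M.d_act (show i + s + j = n + s by omega) (show i + s + 1 = i' + s by omega) hj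
      (show n + s + 1 = n' + s by omega) x f
    simp only [LinearMap.smul_apply, this, smul_add, Int.negOnePow_add, mul_smul,
      Units.smul_def, map_zsmul]
    rw [smul_comm (i.negOnePow : ℤ), smul_smul (s.negOnePow : ℤ) (s.negOnePow : ℤ),
      ← Units.val_mul, Int.units_mul_self, Units.val_one, one_smul]

/-- The identity as a closed graded morphism `M[s] → M` of degree `s`. -/
def down (M : DGMod A) (s : ℤ) : GHom (shift M s) M s where
  app X _ _ h := M.cast X h
  app_act _ _ _ _ _ := (M.cast_act _ _ _ _).trans (M.act_cast _ _ _ _).symm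

/-- The identity as a closed graded morphism `M → M[s]` of degree `-s`. -/
def up (M : DGMod A) {s t : ℤ} (h : s + t = 0) : GHom M (shift M s) t where
  app X i j e := M.cast X (show i = j + s by omega)
  app_act _ hi h' x a := (M.cast_act hi _ x a).trans
    (M.act_cast (i' := _ + s) _ (by omega) x a).symm

lemma D_down (M : DGMod A) {s s' : ℤ} (h : s + 1 = s') : D h (down M s) = 0 := by
  ext X i j e x
  rw [D_app h _ X e rfl (show i + s + 1 = j by omega)]
  change M.d X _ (M.cast X rfl x) - s.negOnePow • M.cast X _ (s.negOnePow • M.d X _ x) = 0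
  rw [map_units_smul, smul_smul, Int.units_mul_self, one_smul, cast_d, cast_rfl, sub_self]

lemma D_up (M : DGMod A) {s t t' : ℤ} (h : s + t = 0) (ht : t + 1 = t') : D ht (up M h) = 0 := by
  ext X i j e x
  rw [D_app ht _ X e rfl (show i + t + 1 = j by omega)]
  change s.negOnePow • M.d X _ (M.cast X _ x) - t.negOnePow • M.cast X _ (M.d X _ x) = 0
  rw [d_cast, cast_d]
  obtain rfl : t = -s := by omega
  rw [Int.negOnePow_neg, sub_self]

lemma up_down (M : DGMod A) {s t : ℤ} (h : s + t = 0) :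
    comp (show t + s = 0 by omega) (up M h) (down M s) = GHom.id M := by
  ext X i j e x
  rw [GHom.comp_app _ _ _ X e rfl]
  exact M.cast_cast X _ _ x

lemma down_up (M : DGMod A) {s t : ℤ} (h : s + t = 0) :
    comp h (down M s) (up M h) = GHom.id (shift M s) := by
  ext X i j e x
  rw [GHom.comp_app _ _ _ X e rfl]
  obtain rfl : i = j := by omega
  exact M.cast_cast X (rfl : i + s = _) rfl x

lemma shift_acyclic {M : DGMod A} (hM : M.Acyclic) (s : ℤ) : (shift M s).Acyclic := by
  intro X l m n h h' x hx
  have hx' : s.negOnePow • M.d X (show m + s + 1 = n + s by omega) x = 0 := hx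
  obtain ⟨y, hy⟩ := hM X (l + s) (m + s) (n + s) (by omega) (by omega) x
    ((smul_eq_zero_iff_eq _).1 hx')
  refine ⟨s.negOnePow • y, ?_⟩
  change s.negOnePow • M.d X _ (s.negOnePow • y) = x
  rw [map_units_smul, smul_smul, Int.units_mul_self, one_smul, hy]

/-! ### H-projective dg modules -/

/-- The definition of h-projectivity only speaks of degree zero. A closed morphism `P → N` of degree
`n'` is a closed morphism `P → N[n']` of degree zero, and `N[n']` is acyclic with `N`. -/
lemma hProjective_iff_perp {P : DGMod A} :
    P.HProjective ↔ ∀ N : DGMod A, N.Acyclic → (zeroIdeal N).Perp P := by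
  constructor
  · intro hP N hN n n' n'' h h' f hf
    have hf : D h' f = 0 := hf
    have hs : n' + -n' = 0 := by omega
    have e : D (zero_add 1) (comp hs f (up N hs)) = 0 := by
      rw [D_comp_of_closed_right _ h' _ _ (D_up N hs rfl), hf]; simp
    have := hP (shift N n') (shift_acyclic hN n') (toHom _ e)
    rw [show (0 : (toHo A).obj P ⟶ (toHo A).obj (shift N n')) = (toHo A).map 0 by simp,
      toHo_map_eq_iff, nonempty_homotopy_iff] at this
    obtain ⟨s, hs'⟩ := this
    rw [ofHom_toHom, ofHom_zero, sub_zero] at hs'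
    -- Composing with `down`, which has degree `n'`, multiplies the differential by `(-1) ^ n'`; `c`
    -- absorbs this sign.
    obtain ⟨c, hc⟩ := exists_units_smul n'.negOnePow
      (comp (show -1 + n' = n by omega) s (down N n'))
    refine ⟨c, ?_⟩
    have h₁ : D h (n'.negOnePow • c) = n'.negOnePow • f := by
      rw [hc, D_comp_of_closed_right _ (show -1 + 1 = 0 by omega) h s (D_down N rfl), hs',
        comp_assoc _ _ (show -n' + n' = 0 by omega) (add_zero n'), up_down, comp_id]
    rw [D_units_smul] at h₁
    rw [smul_left_cancel _ h₁, sub_self]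
    exact zero_mem _
  · intro hP N hN f
    obtain ⟨g, hg⟩ := hP N hN (show -1 + 1 = 0 by omega) (zero_add 1) (ofHom f) (D_ofHom f _)
    rw [show (0 : (toHo A).obj P ⟶ (toHo A).obj N) = (toHo A).map 0 by simp,
      toHo_map_eq_iff, nonempty_homotopy_iff]
    exact ⟨g, by rw [ofHom_zero, sub_zero]; exact (sub_eq_zero.1 ((Submodule.mem_bot k).1 hg)).symm⟩

lemma HProjective.exists_D_eq {P N : DGMod A} (hP : P.HProjective) (hN : N.Acyclic) {n n' n'' : ℤ}
    (h : n + 1 = n') (h' : n' + 1 = n'') (f : GHom P N n') (hf : D h' f = 0) :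
    ∃ g : GHom P N n, D h g = f := by
  obtain ⟨g, hg⟩ := hProjective_iff_perp.1 hP N hN h h' f hf
  exact ⟨g, (sub_eq_zero.1 ((Submodule.mem_bot k).1 hg)).symm⟩

lemma hProjective_of_exists_D_eq {P : DGMod A}
    (hP : ∀ (N : DGMod A), N.Acyclic → ∀ {n n' n'' : ℤ} (h : n + 1 = n') (h' : n' + 1 = n'')
      (f : GHom P N n'), D h' f = 0 → ∃ g : GHom P N n, D h g = f) : P.HProjective := by
  refine hProjective_iff_perp.2 fun N hN n n' n'' h h' f hf => ?_
  obtain ⟨g, hg⟩ := hP N hN h h' f hf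
  exact ⟨g, by rw [hg, sub_self]; exact zero_mem _⟩

namespace HProjective

lemma middle {P₁ P₂ E : DGMod A} {s t r : ℤ} (S : GradedSplit P₁ P₂ E s t r)
    (h₁ : P₁.HProjective) (h₂ : P₂.HProjective) : E.HProjective :=
  hProjective_iff_perp.2 fun N hN =>
    S.perp_middle (hProjective_iff_perp.1 h₁ N hN) (hProjective_iff_perp.1 h₂ N hN)

end HProjective

/-! ### Cones as graded split extensions -/

/-- The first projection of a cone. -/
def coneFst {M N : DGMod A} (f : M ⟶ N) : GHom (cone f) M 1 where
  app X _ _ h := M.cast X h ∘ₗ LinearMap.fst k _ _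
  app_act _ _ _ _ _ := (M.cast_act _ _ _ _).trans (M.act_cast _ _ _ _).symm

/-- The second projection of a cone. -/
def coneSnd {M N : DGMod A} (f : M ⟶ N) : GHom (cone f) N 0 where
  app X i j h := N.cast X (show i = j by omega) ∘ₗ LinearMap.snd k _ _
  app_act _ _ _ _ _ := (N.cast_act _ _ _ _).trans (N.act_cast _ _ _ _).symm

/-- The inclusion of the source in a cone. -/
def coneInl {M N : DGMod A} (f : M ⟶ N) : GHom M (cone f) (-1) where
  app X i j h := LinearMap.inl k _ _ ∘ₗ M.cast X (show i = j + 1 by omega)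
  app_act {X Y i j p i' j'} h hi h' x a := Prod.ext
    ((M.cast_act hi (show i' = j' + 1 by omega) x a).trans
      (M.act_cast (i' := j' + 1) _ (by omega) x a).symm)
    (show (0 : N.obj X j') = N.act (show j + p = j' by omega) 0 a by simp)

lemma coneFst_app {M N : DGMod A} (f : M ⟶ N) (X : A.Obj) {i j : ℤ} (h : i + 1 = j)
    (x : M.obj X (i + 1)) (y : N.obj X i) : (coneFst f).app X h (x, y) = M.cast X h x := rfl

lemma coneSnd_app {M N : DGMod A} (f : M ⟶ N) (X : A.Obj) {i j : ℤ} (h : i + 0 = j)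
    (x : M.obj X (i + 1)) (y : N.obj X i) :
    (coneSnd f).app X h (x, y) = N.cast X (show i = j by omega) y := rfl

lemma cone_d {M N : DGMod A} (f : M ⟶ N) (X : A.Obj) {m n : ℤ} (h : m + 1 = n)
    (x : M.obj X (m + 1)) (y : N.obj X m) :
    (cone f).d X h (x, y) = ((-(M.d X (show m + 1 + 1 = n + 1 by omega) x),
      N.cast X h (f.app X (m + 1) x) + N.d X h y) : M.obj X (n + 1) × N.obj X n) := rfl

section

variable {M N : DGMod A} (f : M ⟶ N)

lemma D_coneInl : D (show -1 + 1 = 0 by omega) (coneInl f) =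
    comp (add_zero 0) (ofHom f) (ofHom (coneInr f)) := by
  ext X i j e x
  obtain rfl : i = j := by omega
  rw [D_app _ _ X e rfl (show i - 1 + 1 = i by omega), GHom.comp_app _ _ _ X e e]
  have e₁ := cone_d f X (show i - 1 + 1 = i by omega) (M.cast X (by omega) x) 0
  refine Eq.trans (congrArg₂ (· - ·) e₁ rfl) ?_
  rw [d_cast]
  have aux : ∀ (p : ℤ) (h : i = p) (h' : p = i),
      N.cast X h' (f.app X p (M.cast X h x)) = f.app X i x := by
    rintro _ rfl _; rfl
  rw [aux]
  change ((-M.d X _ x, f.app X i x + N.d X _ 0) : M.obj X (i + 1) × N.obj X i)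
    - (-1 : ℤ).negOnePow • ((M.d X rfl x, 0) : M.obj X (i + 1) × N.obj X i) =
      ((0, f.app X i x) : M.obj X (i + 1) × N.obj X i)
  rw [map_zero, Int.negOnePow_neg, Int.negOnePow_one]
  exact Prod.ext (show - M.d X _ x - (-1 : ℤˣ) • M.d X _ x = 0 by simp [Units.smul_def])
    (show f.app X i x + 0 - (-1 : ℤˣ) • 0 = f.app X i x by simp)

lemma D_coneFst {n : ℤ} (h : 1 + 1 = n) : D h (coneFst f) = 0 := by
  ext X i j e x
  obtain ⟨x, y⟩ := x
  refine (D_app h _ X e rfl (show i + 1 + 1 = j by omega) _).trans ?_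
  rw [cone_d]
  change M.d X _ (M.cast X rfl x) - (1 : ℤ).negOnePow • M.cast X _ (-(M.d X _ x)) = 0
  rw [map_neg, cast_d, Int.negOnePow_one]
  simp

lemma D_coneSnd : D (zero_add 1) (coneSnd f) = - comp (add_zero 1) (coneFst f) (ofHom f) := by
  ext X i j e x
  obtain ⟨x, y⟩ := x
  refine (D_app _ _ X e rfl e _).trans ?_
  obtain rfl : i + 1 = j := e
  refine Eq.trans ?_ (congrArg Neg.neg (GHom.comp_app (add_zero 1) (coneFst f) (ofHom f) X rfl
    rfl ((x, y) : M.obj X (i + 1) × N.obj X i))).symm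
  rw [cone_d, coneSnd_app, coneSnd_app, coneFst_app, cast_rfl, cast_rfl, ofHom_app, cast_rfl,
    Int.negOnePow_zero, one_smul, cast_rfl]
  exact (sub_eq_neg_add _ _).trans (by rw [neg_add]; simp)

lemma coneInl_coneFst : comp (show -1 + 1 = 0 by omega) (coneInl f) (coneFst f) = GHom.id M := by
  ext X i j e x
  rw [GHom.comp_app _ _ _ X e rfl]
  exact M.cast_cast X _ _ x

lemma coneInr_coneSnd : comp (add_zero 0) (ofHom (coneInr f)) (coneSnd f) = GHom.id N := by
  ext X i j e x
  rw [GHom.comp_app _ _ _ X e (add_zero i)]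
  rfl

lemma coneInl_coneSnd : comp (add_zero (-1)) (coneInl f) (coneSnd f) = 0 := by
  ext X i j e x
  rw [GHom.comp_app _ _ _ X e rfl]
  exact map_zero (N.cast X _)

lemma coneInr_coneFst : comp (zero_add 1) (ofHom (coneInr f)) (coneFst f) = 0 := by
  ext X i j e x
  rw [GHom.comp_app _ _ _ X e (add_zero i)]
  exact map_zero (M.cast X _)

/-- The cone is a graded split extension. -/
def coneSplit : GradedSplit M N (cone f) 1 (-1) 0 where
  hst := by omega
  hr := by omega
  g := ofHom f
  i₁ := coneInl f
  i₂ := ofHom (coneInr f)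
  p₁ := coneFst f
  p₂ := coneSnd f
  D_i₁ := D_coneInl f
  D_i₂ := D_ofHom _ _
  D_p₁ := D_coneFst f _
  D_p₂ := D_coneSnd f
  i₁_p₁ := coneInl_coneFst f
  i₂_p₂ := coneInr_coneSnd f
  i₁_p₂ := coneInl_coneSnd f
  i₂_p₁ := coneInr_coneFst f
  total := by
    ext X i j e x
    obtain rfl : i = j := by omega
    obtain ⟨x, y⟩ := x
    refine (GHom.add_app _ _ X e _).trans ?_
    refine Eq.trans (congrArg₂ (· + ·) (GHom.comp_app _ _ _ X e rfl _)
      (GHom.comp_app _ _ _ X e (add_zero i) _)) ?_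
    refine Prod.ext (show M.cast X (rfl : i + 1 = _) (M.cast X rfl x) + 0 = x by simp)
      (show 0 + y = y by simp)

end

/-! ### Lifting along quasi-isomorphisms -/

/-- Closed graded morphisms from an h-projective dg module lift along quasi-isomorphisms, up to
homotopy. -/
lemma HProjective.exists_lift {P N N' : DGMod A} (hP : P.HProjective) {s : N ⟶ N'}
    (hs : IsQuasiIso s) {n n' n'' : ℤ} (h : n + 1 = n') (h' : n' + 1 = n'') (f : GHom P N' n')
    (hf : D h' f = 0) :
    ∃ (g : GHom P N n') (e : GHom P N' n), D h' g = 0 ∧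
      f = comp (add_zero n') g (ofHom s) + D h e := by
  -- The image of `f` in the acyclic module `cone s` is a boundary `D H`. The component of `H` in
  -- the shift of `N` is the lift, and its component in `N'` is the homotopy.
  obtain ⟨H, hH⟩ := hP.exists_D_eq ((isQuasiIso_iff_acyclic_cone s).1 hs) h h'
    (comp (add_zero n') f (ofHom (coneInr s)))
    (by rw [D_comp_of_closed_right _ h' _ _ (D_ofHom _ _), hf]; simp)
  refine ⟨comp h H (coneFst s), comp (add_zero n) H (coneSnd s), ?_, ?_⟩
  · rw [D_comp_of_closed_right _ h _ _ (D_coneFst s _), hH,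
      comp_assoc _ _ (zero_add 1) h', coneInr_coneFst]
    simp
  · rw [D_comp _ h (zero_add 1) h, D_coneSnd, hH,
      comp_assoc _ _ (add_zero 0) (add_zero n'), coneInr_coneSnd, comp_id, map_neg,
      ← comp_assoc h (add_zero n') (add_zero 1) h]
    change f = _ + (- comp _ _ (ofHom s) + _)
    simp

/-- A graded morphism from an h-projective dg module is a boundary if its composition with a
quasi-isomorphism is. -/
lemma HProjective.exists_D_eq_of_comp {P N N' : DGMod A} (hP : P.HProjective) {s : N ⟶ N'}
    (hs : IsQuasiIso s) {n n' n'' : ℤ} (h : n + 1 = n') (h' : n' + 1 = n'') (f : GHom P N n')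
    (hf : D h' f = 0) (e : GHom P N' n) (he : comp (add_zero n') f (ofHom s) = D h e) :
    ∃ g : GHom P N n, D h g = f := by
  -- The pair `(f, -e)` is closed as a morphism to `cone s`, precisely because `s ∘ f = D e`. The
  -- first component of a primitive of it is, up to the sign from the degree of `coneFst`, a
  -- primitive of `f`.
  obtain ⟨H, hH⟩ := hP.exists_D_eq ((isQuasiIso_iff_acyclic_cone s).1 hs)
    (show n - 1 + 1 = n by omega) h
    (comp (show n' + -1 = n by omega) f (coneInl s) - comp (add_zero n) e (ofHom (coneInr s))) (by
      rw [map_sub, D_comp _ h' (show -1 + 1 = 0 by omega) h, hf,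
        D_comp_of_closed_right _ h _ e (D_ofHom _ _), ← he, D_coneInl,
        ← comp_assoc (add_zero n') (add_zero n')]
      simp only [map_zero, LinearMap.zero_apply, smul_zero, add_zero, Int.negOnePow_zero, one_smul]
      exact sub_self _)
  have h₁ := congrArg (fun F => comp h F (coneFst s)) hH
  simp only [map_sub, LinearMap.sub_apply] at h₁
  rw [comp_assoc _ _ (show -1 + 1 = 0 by omega) (add_zero n'), coneInl_coneFst, comp_id,
    comp_assoc _ _ (zero_add 1) h, coneInr_coneFst, map_zero, sub_zero] at h₁
  obtain ⟨c, hc⟩ := exists_units_smul ((1 : ℤ).negOnePow) (comp (show n - 1 + 1 = n by omega) H (coneFst s))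
  refine ⟨c, smul_left_cancel ((1 : ℤ).negOnePow) ?_⟩
  rw [← D_units_smul, hc, D_comp_of_closed_right _ (show n - 1 + 1 = n by omega) h H
    (D_coneFst s _), h₁]

end DGMod

end DG

/-! ### Direct sums and the chain-level form of compactness -/

namespace DG

namespace DGMod

variable {k : Type u} [Field k] {A : DGCat.{u} k}

open GHom

/-! ### Direct sums -/

section DirectSum

variable {J : Type u}

/-- The direct sum of a family of dg modules. -/
@[reducible]
def dsum (N : J → DGMod A) : DGMod A where
  obj X n := ModuleCat.of k (Π₀ j, (N j).obj X n)
  d X m n h := DFinsupp.mapRange.linearMap fun j => (N j).d X h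
  d_d X l m n h h' x := by ext j; simp [(N j).d_d]
  act {X Y i j n} h := LinearMap.mk₂ k
    (fun x a => DFinsupp.mapRange (fun l y => (N l).act h y a) (by simp) x)
    (fun _ _ _ => by ext l; simp) (fun _ _ _ => by ext l; simp)
    (fun _ _ _ => by ext l; simp) (fun _ _ _ => by ext l; simp)
  act_one x := by ext l; simp [(N l).act_one]
  act_act h₁ h₂ h₃ h₄ x g f := by
    ext l
    simp only [LinearMap.mk₂_apply, DFinsupp.mapRange_apply]
    exact (N l).act_act h₁ h₂ h₃ h₄ _ g f
  d_act h hi hj hn x f := by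
    ext l
    simp only [LinearMap.mk₂_apply, DFinsupp.mapRange_apply, DFinsupp.mapRange.linearMap_apply,
      DFinsupp.add_apply, Units.smul_def, DFinsupp.zsmul_apply]
    exact (N l).d_act h hi hj hn _ f

variable {N N' N'' : J → DGMod A}

lemma dsum_d_apply (X : A.Obj) {m n : ℤ} (h : m + 1 = n) (x : Π₀ j, (N j).obj X m) (j : J) :
    ((dsum N).d X h x : Π₀ j, (N j).obj X n) j = (N j).d X h (x j) := by
  simp

lemma dsum_act_apply {X Y : A.Obj} {i p n : ℤ} (h : i + p = n) (x : Π₀ j, (N j).obj Y i)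
    (a : A.Hom X Y p) (j : J) :
    ((dsum N).act h x a : Π₀ j, (N j).obj X n) j = (N j).act h (x j) a := by
  simp

/-- The projection to a summand. -/
def dsumProj (N : J → DGMod A) (j : J) : dsum N ⟶ N j where
  app _ _ := DFinsupp.lapply j
  app_d h x := dsum_d_apply _ h x j
  app_act h x a := dsum_act_apply h x a j

open Classical in
/-- The inclusion of a summand. -/
noncomputable def dsumInj (N : J → DGMod A) (j : J) : N j ⟶ dsum N where
  app X n := DFinsupp.lsingle (R := k) (M := fun j => (N j).obj X n) j
  app_d {X m n} h x := by
    refine Eq.symm ?_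
    change DFinsupp.mapRange (fun j => (N j).d X h) (fun j => map_zero _) (DFinsupp.single j x) = DFinsupp.single j _
    rw [DFinsupp.mapRange_single]
  app_act {X Y i p n} h x a := by
    refine Eq.symm ?_
    change DFinsupp.mapRange (fun j y => (N j).act h y a) (fun j => by simp) (DFinsupp.single j x) =
      DFinsupp.single j _
    rw [DFinsupp.mapRange_single]

open Classical in
lemma dsumInj_app (j : J) (X : A.Obj) (n : ℤ) (x : (N j).obj X n) :
    (dsumInj N j).app X n x = (DFinsupp.single j x : Π₀ j, (N j).obj X n) := rfl

/-- The direct sum of a family of graded morphisms. -/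
def dsumMap {n : ℤ} (f : ∀ j, GHom (N j) (N' j) n) : GHom (dsum N) (dsum N') n where
  app X _ _ h := DFinsupp.mapRange.linearMap fun j => (f j).app X h
  app_act h hi h' x a := by
    ext j
    simp only [LinearMap.mk₂_apply, DFinsupp.mapRange_apply, DFinsupp.mapRange.linearMap_apply]
    exact (f j).app_act h hi h' _ a

lemma dsumMap_app {n : ℤ} (f : ∀ j, GHom (N j) (N' j) n) (X : A.Obj) {i i' : ℤ} (h : i + n = i')
    (x : Π₀ j, (N j).obj X i) (j : J) :
    ((dsumMap f).app X h x : Π₀ j, (N' j).obj X i') j = (f j).app X h (x j) := by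
  simp [dsumMap]

open Classical in
/-- The graded morphism out of a direct sum given by its components. -/
noncomputable def dsumDesc {L : DGMod A} {n : ℤ} (f : ∀ j, GHom (N j) L n) :
    GHom (dsum N) L n where
  app X i i' h := DFinsupp.lsum (R := k) (M := fun j => (N j).obj X i) ℕ fun j => (f j).app X h
  app_act {X Y i j p i' j'} h hi h' x a := by
    have : (DFinsupp.lsum (R := k) (M := fun j => (N j).obj X i') ℕ fun j => (f j).app X h') ∘ₗ
        ((dsum N).act hi).flip a = (L.act (show j + p = j' by omega)).flip a ∘ₗ
        (DFinsupp.lsum (R := k) (M := fun j => (N j).obj Y i) ℕ fun j => (f j).app Y h) := by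
      refine DFinsupp.lhom_ext fun l y => ?_
      have e : (dsum N).act hi (DFinsupp.single l y : Π₀ j, (N j).obj Y i) a =
          (DFinsupp.single l ((N l).act hi y a) : Π₀ j, (N j).obj X i') :=
        ((dsumInj N l).app_act hi y a).symm
      simp only [LinearMap.comp_apply, LinearMap.flip_apply, e, DFinsupp.lsum_single]
      exact (f l).app_act h hi h' y a
    exact LinearMap.congr_fun this x

open Classical in
lemma dsumDesc_single {L : DGMod A} {n : ℤ} (f : ∀ j, GHom (N j) L n) (X : A.Obj) {i i' : ℤ}
    (h : i + n = i') (j : J) (x : (N j).obj X i) :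
    (dsumDesc f).app X h (DFinsupp.single j x : Π₀ j, (N j).obj X i) = (f j).app X h x :=
  DFinsupp.lsum_single ℕ (fun j => (f j).app X h) j x

lemma inj_dsumDesc {L : DGMod A} {n : ℤ} (f : ∀ j, GHom (N j) L n) (j : J) :
    comp (zero_add n) (ofHom (dsumInj N j)) (dsumDesc f) = f j := by
  ext X i i' h x
  rw [GHom.comp_app _ _ _ X h (add_zero i)]
  exact dsumDesc_single f X h j x

lemma dsum_hom_ext {L : DGMod A} {n : ℤ} {f g : GHom (dsum N) L n}
    (H : ∀ j, comp (zero_add n) (ofHom (dsumInj N j)) f =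
      comp (zero_add n) (ofHom (dsumInj N j)) g) : f = g := by
  classical
  ext X i i' h x
  refine LinearMap.congr_fun (DFinsupp.lhom_ext (φ := f.app X h) (ψ := g.app X h)
    fun j y => ?_) x
  have := congrArg (fun e => e.app X h y) (H j)
  simp only [GHom.comp_app _ _ _ X h (add_zero i)] at this
  exact this

lemma comp_inj_D {L : DGMod A} {n n' : ℤ} (h : n + 1 = n') (f : GHom (dsum N) L n) (j : J) :
    comp (zero_add n') (ofHom (dsumInj N j)) (D h f) =
      D h (comp (zero_add n) (ofHom (dsumInj N j)) f) :=
  (D_comp_of_closed_left _ h h (D_ofHom _ _) f).symm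

lemma D_dsumMap {n n' : ℤ} (h : n + 1 = n') (f : ∀ j, GHom (N j) (N' j) n) :
    D h (dsumMap f) = dsumMap fun j => D h (f j) := by
  refine GHom.ext fun X i i' e x => ?_
  rw [D_app h _ X e rfl (show i + n + 1 = i' by omega)]
  ext j
  rw [dsumMap_app, D_app h _ X e rfl (show i + n + 1 = i' by omega)]
  refine (DFinsupp.sub_apply _ _ _).trans (congrArg₂ (· - ·) ?_ ?_)
  · rw [dsum_d_apply, dsumMap_app]
  · rw [Units.smul_def, DFinsupp.zsmul_apply, dsumMap_app, dsum_d_apply, Units.smul_def]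

lemma D_dsumMap_eq_zero {n n' : ℤ} (h : n + 1 = n') {f : ∀ j, GHom (N j) (N' j) n}
    (hf : ∀ j, D h (f j) = 0) : D h (dsumMap f) = 0 := by
  rw [D_dsumMap, funext hf]
  refine GHom.ext fun X i i' e x => ?_
  ext j
  rw [dsumMap_app]; rfl

lemma D_dsumDesc_eq_zero {L : DGMod A} {n n' : ℤ} (h : n + 1 = n') {f : ∀ j, GHom (N j) L n}
    (hf : ∀ j, D h (f j) = 0) : D h (dsumDesc f) = 0 :=
  dsum_hom_ext fun j => by rw [comp_inj_D, inj_dsumDesc, hf, map_zero]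

lemma dsumMap_comp {p q r : ℤ} (h : p + q = r) (f : ∀ j, GHom (N j) (N' j) p)
    (g : ∀ j, GHom (N' j) (N'' j) q) :
    comp h (dsumMap f) (dsumMap g) = dsumMap fun j => comp h (f j) (g j) := by
  refine GHom.ext fun X i i' e x => ?_
  rw [GHom.comp_app _ _ _ X e rfl]
  ext j
  rw [dsumMap_app, dsumMap_app, dsumMap_app, GHom.comp_app _ _ _ X e rfl]

lemma dsumMap_id : (dsumMap fun j => GHom.id (N j)) = GHom.id (dsum N) := by
  refine GHom.ext fun X i i' h x => ?_
  obtain rfl : i = i' := by omega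
  ext j
  rw [dsumMap_app]
  rfl

lemma inj_dsumMap {n : ℤ} (f : ∀ j, GHom (N j) (N' j) n) (j : J) :
    comp (zero_add n) (ofHom (dsumInj N j)) (dsumMap f) =
      comp (add_zero n) (f j) (ofHom (dsumInj N' j)) := by
  classical
  refine GHom.ext fun X i i' h x => ?_
  rw [GHom.comp_app _ _ _ X h (add_zero i), GHom.comp_app _ _ _ X h h]
  obtain rfl : i + n = i' := h
  change DFinsupp.mapRange (fun j => (f j).app X rfl) (fun j => map_zero _) (DFinsupp.single j x) =
    DFinsupp.single j _
  rw [DFinsupp.mapRange_single]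

lemma HProjective.dsum (hN : ∀ j, (N j).HProjective) : (dsum N).HProjective := by
  refine hProjective_of_exists_D_eq fun L hL n n' n'' h h' f hf => ?_
  have (j : J) : ∃ g, D h g = comp (zero_add n') (ofHom (dsumInj N j)) f :=
    (hN j).exists_D_eq hL h h' _ (by rw [← comp_inj_D, hf, map_zero])
  choose g hg using this
  exact ⟨dsumDesc g, dsum_hom_ext fun j => by rw [comp_inj_D, inj_dsumDesc, hg]⟩

/-- Preimages and primitives are chosen in each summand and truncated to the finite support of the
given element. -/
lemma isQuasiIso_dsumMap {f : ∀ j, N j ⟶ N' j} (hf : ∀ j, IsQuasiIso (f j)) {g : dsum N ⟶ dsum N'}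
    (hg : ofHom g = dsumMap fun j => ofHom (f j)) : IsQuasiIso g := by
  classical
  have hg' (X : A.Obj) (i : ℤ) (x : Π₀ j, (N j).obj X i) (j : J) :
      (g.app X i x : Π₀ j, (N' j).obj X i) j = (f j).app X i (x j) := by
    rw [← ofHom_app g X (add_zero i), hg, dsumMap_app, ofHom_app]
  intro X l m n h h'
  refine ⟨fun x hx ⟨y, hy⟩ => ?_, fun y hy => ?_⟩
  · have (j : J) : ∃ z, (N j).d X h z = (x : Π₀ j, (N j).obj X m) j :=
      (hf j X l m n h h').1 _ (by rw [← dsum_d_apply, hx]; rfl)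
        ⟨(y : Π₀ j, (N' j).obj X l) j, by rw [← dsum_d_apply, hy, hg']⟩
    choose z hz using this
    refine ⟨DFinsupp.mk (DFinsupp.support (x : Π₀ j, (N j).obj X m)) fun j => z j, ?_⟩
    ext j
    rw [dsum_d_apply, DFinsupp.mk_apply]
    split_ifs with hj
    · exact hz j
    · rw [map_zero, DFinsupp.notMem_support_iff.1 hj]
  · have (j : J) := (hf j X l m n h h').2 ((y : Π₀ j, (N' j).obj X m) j)
      (by rw [← dsum_d_apply, hy]; rfl)
    choose x z hx hz using this
    let s := DFinsupp.support (y : Π₀ j, (N' j).obj X m)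
    refine ⟨DFinsupp.mk s fun j => x j, DFinsupp.mk s fun j => z j, ?_, ?_⟩
    · ext j
      rw [dsum_d_apply, DFinsupp.mk_apply]
      split_ifs with hj
      · exact hx j
      · exact map_zero _
    · ext j
      refine Eq.trans ?_ (DFinsupp.add_apply (β := fun j => (N' j).obj X m) _ _ j).symm
      rw [dsum_d_apply, hg', DFinsupp.mk_apply, DFinsupp.mk_apply]
      split_ifs with hj
      · exact hz j
      · rw [map_zero, map_zero, DFinsupp.notMem_support_iff.1 hj, add_zero]

/-! ### Graded morphisms with values in finite subsums -/

/-- The graded morphisms to a direct sum which factor through a finite subsum. -/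
def smallIdeal (N : J → DGMod A) : RightIdeal (dsum N) where
  mem P n :=
    { carrier := {f | ∃ F : Finset J, ∀ (X : A.Obj) (i i' : ℤ) (h : i + n = i') (x : P.obj X i),
        ∀ j ∉ F, (f.app X h x : Π₀ j, (N j).obj X i') j = 0}
      add_mem' := by
        classical
        rintro f g ⟨F, hF⟩ ⟨G, hG⟩
        refine ⟨F ∪ G, fun X i i' h x j hj => ?_⟩
        rw [Finset.mem_union, not_or] at hj
        refine (DFinsupp.add_apply _ _ j).trans ?_
        rw [hF X i i' h x j hj.1, hG X i i' h x j hj.2, add_zero]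
      zero_mem' := ⟨∅, fun _ _ _ _ _ _ _ => rfl⟩
      smul_mem' := by
        rintro c f ⟨F, hF⟩
        refine ⟨F, fun X i i' h x j hj => ?_⟩
        refine (DFinsupp.smul_apply _ _ j).trans ?_
        rw [hF X i i' h x j hj, smul_zero] }
  precomp := by
    rintro P Q p q r h e f ⟨F, hF⟩
    refine ⟨F, fun X i i' h x j hj => ?_⟩
    rw [GHom.comp_app _ _ _ X h rfl]
    exact hF X _ _ _ _ j hj

lemma comp_dsumMap_mem {P : DGMod A} {p q r : ℤ} (h : p + q = r) {f : GHom P (dsum N) p}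
    (hf : f ∈ (smallIdeal N).mem P p) (g : ∀ j, GHom (N j) (N' j) q) :
    comp h f (dsumMap g) ∈ (smallIdeal N').mem P r := by
  obtain ⟨F, hF⟩ := hf
  refine ⟨F, fun X i i' h x j hj => ?_⟩
  rw [GHom.comp_app _ _ _ X h rfl, dsumMap_app, hF X _ _ _ _ j hj, map_zero]

/-- This turns membership in `smallIdeal` into an actual finite sum of morphisms through single
summands, the form in which compactness in an additive category is stated. -/
lemma eq_sum_of_forall_notMem {P : DGMod A} {n : ℤ} {f : GHom P (dsum N) n} {F : Finset J}
    (hF : ∀ (X : A.Obj) (i i' : ℤ) (h : i + n = i')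
      (x : P.obj X i), ∀ j ∉ F, (f.app X h x : Π₀ j, (N j).obj X i') j = 0) :
    f = ∑ j ∈ F, comp (add_zero n) (comp (add_zero n) f (ofHom (dsumProj N j)))
      (ofHom (dsumInj N j)) := by
  classical
  refine GHom.ext fun X i i' h x => ?_
  rw [sum_app]
  ext j
  rw [DFinsupp.finsetSum_apply]
  have e (l : J) : ((comp (add_zero n) (comp (add_zero n) f (ofHom (dsumProj N l)))
      (ofHom (dsumInj N l))).app X h x : Π₀ j, (N j).obj X i') =
      DFinsupp.single l ((f.app X h x : Π₀ j, (N j).obj X i') l) := by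
    rw [GHom.comp_app _ _ _ X h h, GHom.comp_app _ _ _ X h h]
    rfl
  simp only [e]
  by_cases hj : j ∈ F
  · rw [Finset.sum_eq_single_of_mem j hj fun l _ hl => DFinsupp.single_eq_of_ne hl.symm,
      DFinsupp.single_eq_same]
  · rw [hF X i i' h x j hj, Finset.sum_eq_zero]
    intro l hl
    exact DFinsupp.single_eq_of_ne (by rintro rfl; exact hj hl)

end DirectSum

/-- The graded morphisms from `P` to a direct sum are, up to homotopy, those which factor through
a finite subsum. -/
def Cpt (P : DGMod A) : Prop := ∀ (J : Type u) (N : J → DGMod A), (smallIdeal N).Perp P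

/-- In `Cpt` it is enough to treat closed `f`. If `D f` lives on the finite set `F`, let `pr f` be
the part of `f` on `F`. It lies in the ideal, and `f - pr f` is closed because `D (pr f) = pr (D f)
= D f`. -/
lemma cpt_of_closed {P : DGMod A} (H : ∀ (J : Type u) (N : J → DGMod A) {n n' n'' : ℤ}
    (h : n + 1 = n') (h' : n' + 1 = n'') (f : GHom P (dsum N) n'), D h' f = 0 →
      ∃ g : GHom P (dsum N) n, f - D h g ∈ (smallIdeal N).mem P n') : P.Cpt := by
  classical
  intro J N n n' n'' h h' f hf
  obtain ⟨F, hF⟩ := hf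
  let pr (f : GHom P (dsum N) n') := ∑ j ∈ F, comp (add_zero n')
    (comp (add_zero n') f (ofHom (dsumProj N j))) (ofHom (dsumInj N j))
  have h₁ : pr f ∈ (smallIdeal N).mem P n' := by
    refine sum_mem fun j _ => ⟨{j}, fun X i i' h x l hl => ?_⟩
    rw [GHom.comp_app _ _ _ X h h]
    obtain rfl : i + n' = i' := h
    exact DFinsupp.single_eq_of_ne (by simpa using hl)
  obtain ⟨g, hg⟩ := H J N h h' (f - pr f) (by
    rw [map_sub, sub_eq_zero, map_sum, eq_sum_of_forall_notMem hF]
    refine Finset.sum_congr rfl fun j _ => ?_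
    rw [D_comp_of_closed_right _ h' _ _ (D_ofHom _ _),
      D_comp_of_closed_right _ h' _ _ (D_ofHom _ _)]
    simp)
  refine ⟨g, ?_⟩
  have := add_mem hg h₁
  rwa [show f - pr f - D h g + pr f = f - D h g by abel] at this

end DGMod

end DG

/-! ### Compactness in the derived category of h-projective dg modules -/

namespace DG

/-- Injectivity is automatic in a preadditive category: the identity on one summand and zero on the
others define a projection from the coproduct that recovers each coordinate. Hence compactness is a
statement about surjectivity only. -/
lemma IsCompactObject.injective {T : Type*} [Category* T] [Preadditive T] (X : T) {J : Type w}
    {N : J → T} (c : Cofan N) (hc : IsColimit c) [DecidableEq J] :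
    Function.Injective
      (DirectSum.toAddMonoid fun j => (Preadditive.rightComp X (c.inj j) : (X ⟶ N j) →+ _)) := by
  rw [injective_iff_map_eq_zero]
  intro x hx
  refine DFinsupp.ext fun l => ?_
  let p : c.pt ⟶ N l := Cofan.IsColimit.desc hc fun j =>
    if h : j = l then eqToHom (by rw [h]) else 0
  have key : (Preadditive.rightComp X p).comp
      (DirectSum.toAddMonoid fun j => (Preadditive.rightComp X (c.inj j) : (X ⟶ N j) →+ _)) =
      DFinsupp.evalAddMonoidHom l := by
    refine DirectSum.addHom_ext fun j y => ?_
    have e : c.inj j ≫ p = if h : j = l then eqToHom (by rw [h]) else 0 :=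
      Cofan.IsColimit.fac hc _ j
    rw [AddMonoidHom.comp_apply, DirectSum.toAddMonoid_of]
    change (y ≫ c.inj j) ≫ p = (DFinsupp.single j y : Π₀ j, (X ⟶ N j)) l
    rw [Category.assoc, e]
    split_ifs with h
    · subst h; simp
    · rw [DFinsupp.single_eq_of_ne (Ne.symm h), comp_zero]
  have := DFunLike.congr_fun key x
  rw [AddMonoidHom.comp_apply, hx, map_zero] at this
  exact this.symm

lemma IsCompactObject.of_iso {T : Type*} [Category* T] [Preadditive T] {X Y : T} (e : X ≅ Y)
    (hX : IsCompactObject.{w} X) : IsCompactObject.{w} Y := by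
  classical
  rintro J N c ⟨hc⟩
  refine ⟨?_, fun y => ?_⟩
  · convert IsCompactObject.injective Y c hc
  obtain ⟨x, hx⟩ := (hX J N c ⟨hc⟩).2 (e.hom ≫ y)
  refine ⟨DirectSum.map (fun j => (Preadditive.leftComp (N j) e.inv)) x, ?_⟩
  have key : (DirectSum.toAddMonoid fun j =>
        (Preadditive.rightComp Y (c.inj j) : (Y ⟶ N j) →+ _)).comp
      (DirectSum.map fun j => (Preadditive.leftComp (N j) e.inv)) =
      (Preadditive.leftComp c.pt e.inv).comp
      (DirectSum.toAddMonoid fun j => (Preadditive.rightComp X (c.inj j) : (X ⟶ N j) →+ _)) := by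
    refine DirectSum.addHom_ext fun j z => ?_
    simp [Preadditive.leftComp, Preadditive.rightComp]
  have h := DFunLike.congr_fun key x
  rw [AddMonoidHom.comp_apply, AddMonoidHom.comp_apply] at h
  convert h using 1
  · rw [hx]
    simp [Preadditive.leftComp]

namespace DGMod

variable {k : Type u} [Field k] {A : DGCat.{u} k}

open GHom

/-! ### Morphisms in the derived category -/

lemma toDerived_map_eq {M N : DGMod A} {f g : M ⟶ N} (s : GHom M N (-1))
    (hs : D (show -1 + 1 = 0 by omega) s = ofHom f - ofHom g) :
    (toDerived A).map f = (toDerived A).map g :=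
  congrArg (acyclicConeW A).Q.map ((toHo_map_eq_iff f g).2 ((nonempty_homotopy_iff f g).2 ⟨s, hs⟩))

lemma isIso_toDerived_map {M N : DGMod A} {f : M ⟶ N} (hf : IsQuasiIso f) :
    IsIso ((toDerived A).map f) :=
  Localization.inverts (acyclicConeW A).Q (acyclicConeW A) _ (acyclicConeW_map hf)

lemma exists_toDerived_obj_eq (Z : Derived A) : ∃ M, (toDerived A).obj M = Z := by
  obtain ⟨⟨M⟩, rfl⟩ := (Localization.Construction.objEquiv (acyclicConeW A)).surjective Z
  exact ⟨M, rfl⟩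

/-- By the calculus of fractions a morphism is `P → Y ← N` with the second arrow a
quasi-isomorphism; the first arrow lifts along the second up to homotopy because `P` is
h-projective. -/
lemma HProjective.toDerived_map_surjective {P N : DGMod A} (hP : P.HProjective)
    (t : (toDerived A).obj P ⟶ (toDerived A).obj N) : ∃ f, (toDerived A).map f = t := by
  obtain ⟨φ, hφ⟩ := Localization.exists_leftFraction (acyclicConeW A).Q (acyclicConeW A) t
  obtain ⟨f, _, ⟨s, rfl, hs⟩⟩ := φ
  rename_i Y
  obtain ⟨Y⟩ := Y
  obtain ⟨f, rfl⟩ := (toHo A).map_surjective f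
  obtain ⟨g, e, hg, h⟩ := hP.exists_lift ((isQuasiIso_iff_acyclic_cone s).2 hs)
    (show -1 + 1 = 0 by omega) (zero_add 1) (ofHom f) (D_ofHom f _)
  refine ⟨toHom g hg, ?_⟩
  have := isIso_toDerived_map ((isQuasiIso_iff_acyclic_cone s).2 hs)
  rw [← cancel_mono ((toDerived A).map s), ← Functor.map_comp]
  refine Eq.trans (Eq.symm ?_) (Eq.trans (MorphismProperty.LeftFraction.map_comp_map_s
    ⟨(toHo A).map f, (toHo A).map s, s, rfl, hs⟩ (acyclicConeW A).Q
    (Localization.inverts _ _)).symm (congrArg (· ≫ _) hφ.symm))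
  exact toDerived_map_eq e (by rw [h, ofHom_comp, ofHom_toHom]; abel)

/-- Morphisms equal in the localization become homotopic after composition with a quasi-isomorphism
`s`. For h-projective source, the composition of `f - g` with `s` being a boundary forces `f - g` to
be one. -/
lemma HProjective.exists_homotopy {P N : DGMod A} (hP : P.HProjective) {f g : P ⟶ N}
    (h : (toDerived A).map f = (toDerived A).map g) :
    ∃ s : GHom P N (-1), D (show -1 + 1 = 0 by omega) s = ofHom f - ofHom g := by
  obtain ⟨⟨Y⟩, _, ⟨s, rfl, hs⟩, h⟩ := (MorphismProperty.map_eq_iff_postcomp (acyclicConeW A).Q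
    (acyclicConeW A) ((toHo A).map f) ((toHo A).map g)).1 h
  have h₁ : (toHo A).map (f ≫ s) = (toHo A).map (g ≫ s) := by
    rw [Functor.map_comp, Functor.map_comp]; exact h
  obtain ⟨e, he⟩ := (nonempty_homotopy_iff _ _).1 ((toHo_map_eq_iff _ _).1 h₁)
  refine hP.exists_D_eq_of_comp ((isQuasiIso_iff_acyclic_cone s).2 hs) _ (zero_add 1) _
    (by rw [map_sub, D_ofHom, D_ofHom, sub_zero]) e ?_
  rw [he, ofHom_comp, ofHom_comp, map_sub, LinearMap.sub_apply]

/-! ### Direct sums in the derived category -/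

/-- The direct sum as a cofan in the derived category. -/
noncomputable def dsumCofan {J : Type u} (N : J → DGMod A) :
    Cofan fun j => (toDerived A).obj (N j) :=
  Cofan.mk ((toDerived A).obj (dsum N)) fun j => (toDerived A).map (dsumInj N j)

/-- Direct sums of dg modules are coproducts in the derived category. -/
lemma nonempty_isColimit_dsumCofan {J : Type u} (N : J → DGMod A)
    (R : ∀ j, HProjResolution (N j)) : Nonempty (IsColimit (dsumCofan N)) := by
  -- The summands are replaced by resolutions. The sum of the resolutions is again h-projective, so
  -- morphisms out of it in the derived category are homotopy classes, and these are determined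
  -- componentwise.
  let P (j : J) := (R j).P
  have hπ : D (zero_add 1) (dsumMap fun j => ofHom (R j).π) = 0 :=
    D_dsumMap_eq_zero _ fun j => D_ofHom _ _
  let p : dsum P ⟶ dsum N := toHom _ hπ
  have hp : IsQuasiIso p := isQuasiIso_dsumMap (fun j => (R j).isQuasiIso) (ofHom_toHom _ _)
  have hiP (j : J) : dsumInj P j ≫ p = (R j).π ≫ dsumInj N j := by
    apply ofHom_injective
    rw [ofHom_comp, ofHom_toHom, inj_dsumMap, ofHom_comp]
  have := isIso_toDerived_map hp
  have (j : J) := isIso_toDerived_map (R j).isQuasiIso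
  have ex (Z : Derived A) (t : ∀ j, (toDerived A).obj (N j) ⟶ Z) :
      ∃ u : (toDerived A).obj (dsum N) ⟶ Z, ∀ j, (toDerived A).map (dsumInj N j) ≫ u = t j := by
    obtain ⟨Z, rfl⟩ := exists_toDerived_obj_eq Z
    have (j : J) := (R j).hProjective.toDerived_map_surjective ((toDerived A).map (R j).π ≫ t j)
    choose g hg using this
    have hd : D (zero_add 1) (dsumDesc fun j => ofHom (g j)) = 0 :=
      D_dsumDesc_eq_zero _ fun j => D_ofHom _ _
    let d : dsum P ⟶ Z := toHom _ hd
    have hd' (j : J) : dsumInj P j ≫ d = g j := by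
      apply ofHom_injective
      rw [ofHom_comp, ofHom_toHom, inj_dsumDesc]
    refine ⟨inv ((toDerived A).map p) ≫ (toDerived A).map d, fun j => ?_⟩
    rw [← cancel_epi ((toDerived A).map (R j).π), ← hg, ← hd', ← Functor.map_comp_assoc, ← hiP]
    simp
  have un (Z : Derived A) (u v : (toDerived A).obj (dsum N) ⟶ Z)
      (huv : ∀ j, (toDerived A).map (dsumInj N j) ≫ u = (toDerived A).map (dsumInj N j) ≫ v) :
      u = v := by
    obtain ⟨Z, rfl⟩ := exists_toDerived_obj_eq Z
    have hP : (dsum P).HProjective := HProjective.dsum fun j => (R j).hProjective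
    rw [← cancel_epi ((toDerived A).map p)]
    obtain ⟨f, hf⟩ := hP.toDerived_map_surjective ((toDerived A).map p ≫ u)
    obtain ⟨g, hg⟩ := hP.toDerived_map_surjective ((toDerived A).map p ≫ v)
    have (j : J) : (toDerived A).map (dsumInj P j ≫ f) = (toDerived A).map (dsumInj P j ≫ g) := by
      rw [Functor.map_comp, Functor.map_comp, hf, hg, ← Functor.map_comp_assoc,
        ← Functor.map_comp_assoc, hiP, Functor.map_comp_assoc, Functor.map_comp_assoc]
      exact congrArg _ (huv j)
    choose s hs using fun j => (R j).hProjective.exists_homotopy (this j)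
    rw [← hf, ← hg]
    -- Homotopies chosen on the summands assemble to one homotopy on the direct sum.
    refine toDerived_map_eq (dsumDesc s) (dsum_hom_ext fun j => ?_)
    rw [comp_inj_D, inj_dsumDesc, hs, ofHom_comp, ofHom_comp, map_sub]
  choose u hu using ex
  exact ⟨Cofan.IsColimit.mk _ (fun s => u s.pt s.inj) (fun s j => hu _ _ j)
    fun s m hm => un _ _ _ fun j => (hm j).trans (hu _ _ j).symm⟩

/-! ### Perfect h-projective dg modules -/

lemma perfect_iff_of_isQuasiIso {M N : DGMod A} {f : M ⟶ N} (hf : IsQuasiIso f) :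
    M.Perfect ↔ N.Perfect := by
  have := isIso_toDerived_map hf
  exact ⟨fun h => IsCompactObject.of_iso (asIso ((toDerived A).map f)) h,
    fun h => IsCompactObject.of_iso (asIso ((toDerived A).map f)).symm h⟩

/-- Compactness in the derived category writes the class of `f : P ⟶ dsum N` as a finite sum through
summands; as `P` is h-projective, each term is an actual morphism and the equality is a homotopy.
The resolutions `R` enter only to know that `dsum` is the coproduct in the derived category. -/
lemma Perfect.cpt {P : DGMod A} (hP : P.HProjective) (R : ∀ N : DGMod A, HProjResolution N)
    (h : P.Perfect) : P.Cpt := by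
  classical
  have key (J : Type u) (N : J → DGMod A) (f : P ⟶ dsum N) :
      ∃ s : GHom P (dsum N) (-1), ofHom f - D (show -1 + 1 = 0 by omega) s ∈
        (smallIdeal N).mem P 0 := by
    obtain ⟨x, hx⟩ := (h J _ (dsumCofan N) (nonempty_isColimit_dsumCofan N fun j => R _)).2
      ((toDerived A).map f)
    -- Induction on the element of the direct sum of morphism groups produces a representative of
    -- the class of `f` with values in a finite subsum.
    have : ∃ g : P ⟶ dsum N, ofHom g ∈ (smallIdeal N).mem P 0 ∧
        (toDerived A).map g = (toDerived A).map f := by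
      rw [← hx]
      clear hx
      induction x using DirectSum.induction_on with
      | zero => exact ⟨0, by rw [ofHom_zero]; exact zero_mem _, by simp; rfl⟩
      | of j t =>
        obtain ⟨g, hg⟩ := hP.toDerived_map_surjective t
        refine ⟨g ≫ dsumInj N j, ⟨{j}, fun X i i' h x l hl => ?_⟩, ?_⟩
        · obtain rfl : i = i' := by omega
          exact DFinsupp.single_eq_of_ne (by simpa using hl)
        · rw [DirectSum.toAddMonoid_of, Functor.map_comp, hg]
          rfl
      | add x y hx hy =>
        obtain ⟨g, hg, hg'⟩ := hx
        obtain ⟨e, he, he'⟩ := hy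
        exact ⟨g + e, by rw [ofHom_add]; exact add_mem hg he,
          by rw [Functor.map_add, hg', he', map_add]; rfl⟩
    obtain ⟨g, hg, hgf⟩ := this
    obtain ⟨s, hs⟩ := hP.exists_homotopy hgf.symm
    exact ⟨s, by rw [hs, sub_sub_cancel]; exact hg⟩
  refine cpt_of_closed fun J N n n' n'' h h' f hf => ?_
  have hn : n' + -n' = 0 := by omega
  -- The previous step covers degree zero. A closed morphism of degree `n'` is moved there by
  -- shifting each summand by `n'`; `U` and `V` are the closed identifications with the sum of the
  -- shifts.
  let U := dsumMap fun j => up (N j) hn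
  let V := dsumMap fun j => down (N j) n'
  have hU : D rfl U = 0 := D_dsumMap_eq_zero _ fun j => D_up _ _ _
  have hV : D rfl V = 0 := D_dsumMap_eq_zero _ fun j => D_down _ _
  have hUV : comp (show -n' + n' = 0 by omega) U V = GHom.id _ := by
    rw [dsumMap_comp, ← dsumMap_id]
    congr 1
    funext j
    exact up_down (N j) hn
  obtain ⟨s, hs⟩ := key J (fun j => (N j).shift n') (toHom (comp hn f U) (by
    rw [D_comp_of_closed_right _ h' _ _ hU, hf]; simp))
  rw [ofHom_toHom] at hs
  obtain ⟨c, hc⟩ := exists_units_smul n'.negOnePow (comp (show -1 + n' = n by omega) s V)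
  refine ⟨c, ?_⟩
  have := comp_dsumMap_mem (zero_add n') hs fun j => down (N j) n'
  rw [map_sub, LinearMap.sub_apply, comp_assoc hn _ (show -n' + n' = 0 by omega) (add_zero n')] at this
  change comp (add_zero n') f (comp _ U V) - comp _ _ V ∈ _ at this
  rw [hUV, comp_id] at this
  have e := D_comp_of_closed_right (show -1 + n' = n by omega) (show -1 + 1 = 0 by omega) h s hV
  rw [← hc, D_units_smul] at e
  rwa [smul_left_cancel _ e]

/-- Any coproduct in the derived category is isomorphic to the direct sum of dg modules representing
its terms. A morphism to it is represented by some `f : P ⟶ dsum N`, and `Cpt` makes `f` homotopic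
to a finite sum through summands. -/
lemma Cpt.perfect {P : DGMod A} (hP : P.HProjective) (R : ∀ N : DGMod A, HProjResolution N)
    (h : P.Cpt) : P.Perfect := by
  classical
  rintro J N' c ⟨hc⟩
  refine ⟨?_, fun t => ?_⟩
  · convert IsCompactObject.injective _ c hc
  choose N hN using fun j => exists_toDerived_obj_eq (N' j)
  obtain rfl : (fun j => (toDerived A).obj (N j)) = N' := funext hN
  obtain ⟨hd⟩ := nonempty_isColimit_dsumCofan N fun j => R _
  let e : (toDerived A).obj (dsum N) ≅ c.pt := hd.coconePointUniqueUpToIso hc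
  have he (j : J) : (toDerived A).map (dsumInj N j) ≫ e.hom = c.inj j :=
    hd.comp_coconePointUniqueUpToIso_hom hc ⟨j⟩
  obtain ⟨f, hf⟩ := hP.toDerived_map_surjective (N := dsum N) (t ≫ e.inv)
  -- A homotopy `s`, of degree `-1`, after which `f - D s` has values in the finite subsum over `F`.
  obtain ⟨s, F, hs⟩ := h J N (show -1 + 1 = 0 by omega) (zero_add 1) (ofHom f)
    (by rw [D_ofHom]; exact zero_mem _)
  have hs' := eq_sum_of_forall_notMem hs
  have hd0 : D (zero_add 1) (ofHom f - D (show -1 + 1 = 0 by omega) s) = 0 := by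
    rw [map_sub, D_D, D_ofHom, sub_zero]
  have e₁ : (toDerived A).map f =
      (toDerived A).map (∑ j ∈ F, toHom _ hd0 ≫ dsumProj N j ≫ dsumInj N j) := by
    refine toDerived_map_eq s ?_
    have : ofHom (∑ j ∈ F, toHom _ hd0 ≫ dsumProj N j ≫ dsumInj N j) =
        ofHom f - D (show -1 + 1 = 0 by omega) s := by
      refine Eq.trans ?_ hs'.symm
      rw [ofHom_sum]
      refine Finset.sum_congr rfl fun j _ => ?_
      rw [ofHom_comp, ofHom_comp, ofHom_toHom, comp_assoc _ _ (zero_add 0) (zero_add 0)]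
    rw [this, sub_sub_cancel]
  refine ⟨∑ j ∈ F, DirectSum.of (fun j => (toDerived A).obj P ⟶ (toDerived A).obj (N j)) j
    ((toDerived A).map (toHom _ hd0 ≫ dsumProj N j)), ?_⟩
  have e₂ : t = (toDerived A).map f ≫ e.hom := by rw [hf]; simp
  rw [e₂, e₁, map_sum, Functor.map_sum, Preadditive.sum_comp]
  refine Finset.sum_congr rfl fun j _ => ?_
  refine (DirectSum.toAddMonoid_of _ _ _).trans ?_
  simp only [Preadditive.rightComp, AddMonoidHom.mk'_apply]
  rw [← he, ← Functor.map_comp_assoc, Category.assoc]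

end DGMod

end DG

/-! ### The tensor-Hom adjunction and compactness of tensor products -/

namespace DG

open DGMod GHom

namespace DGBimod

variable {k : Type u} [Field k] {A B : DGCat.{u} k} (φ : DGBimod B A)

/-! ### The adjunction between tensor product and graded morphisms -/

/-- The left action of an element of `B`. -/
def leftMul {Y Y' : B.Obj} {p : ℤ} : B.Hom Y Y' p →ₗ[k] GHom (φ.right Y) (φ.right Y') p where
  toFun b :=
    { app := fun X i j h => φ.lact (show p + i = j by omega) b
      app_act := fun h hi h' x a => (φ.lact_ract _ _ hi _ b x a).symm }
  map_add' _ _ := by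
    ext X i j h x; exact LinearMap.map_add₂ (φ.lact (show p + i = j by omega)) _ _ _
  map_smul' _ _ := by
    ext X i j h x; exact LinearMap.map_smul₂ (φ.lact (show p + i = j by omega)) _ _ _

lemma D_leftMul {Y Y' : B.Obj} {p p' : ℤ} (h : p + 1 = p') (b : B.Hom Y Y' p) :
    D h (φ.leftMul b) = φ.leftMul (B.d Y Y' h b) := by
  ext X i j e x
  rw [D_app h _ X e rfl (show i + p + 1 = j by omega)]
  refine sub_eq_of_eq_add ?_
  exact φ.d_lact (show p + i = i + p by omega) h rfl (by omega) b x

lemma leftMul_one (Y : B.Obj) : φ.leftMul (B.one Y) = GHom.id (φ.right Y) := by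
  ext X i j e x
  obtain rfl : i = j := by omega
  exact φ.one_lact x

lemma leftMul_comp {Y Y' Y'' : B.Obj} {p q r : ℤ} (h : q + p = r) (h' : p + q = r)
    (g : B.Hom Y' Y'' q) (f : B.Hom Y Y' p) :
    φ.leftMul (B.comp h g f) = comp h' (φ.leftMul f) (φ.leftMul g) := by
  ext X i j e x
  rw [GHom.comp_app _ _ _ X e rfl]
  exact φ.lact_lact h (by omega) (by omega) (by omega) g f x

/-- The right dg `B`-module of graded morphisms from `φ` to `N`. -/
@[reducible]
def homMod (N : DGMod A) : DGMod B where
  obj Y n := ModuleCat.of k (GHom (φ.right Y) N n)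
  d Y m n h := D h
  d_d Y l m n h h' f := D_D h h' f
  act {X Y i j n} h := (GHom.comp (show j + i = n by omega)).flip.compl₂ φ.leftMul
  act_one {X n} f := by
    simp only [LinearMap.compl₂_apply, LinearMap.flip_apply, leftMul_one]
    exact id_comp f
  act_act {X Y Z i j l ij jl n} h₁ h₂ h₃ h₄ x g f := by
    simp only [LinearMap.compl₂_apply, LinearMap.flip_apply]
    rw [φ.leftMul_comp h₃ (show l + j = jl by omega), comp_assoc]
  d_act {X Y i i' j j' n n'} h hi hj hn x f := by
    simp only [LinearMap.compl₂_apply, LinearMap.flip_apply]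
    rw [D_comp _ hj hi hn, D_leftMul]

lemma homMod_act (N : DGMod A) {X Y : B.Obj} {i j n : ℤ} (h : i + j = n)
    (f : GHom (φ.right Y) N i) (b : B.Hom X Y j) :
    (φ.homMod N).act h f b = GHom.comp (show j + i = n by omega) (φ.leftMul b) f := rfl

/-- The graded morphism `x ↦ m ⊗ x`. -/
noncomputable def tmkHom (P : DGMod B) {Y : B.Obj} {i : ℤ} :
    P.obj Y i →ₗ[k] GHom (φ.right Y) (φ.tensor P) i where
  toFun m :=
    { app := fun X p q h => φ.tmk P X (show i + p = q by omega) m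
      app_act := fun {_ _ p q s p' q'} h hi h' x a => (φ.tensorAct_tmk P
        (show q + s = q' by omega) (show i + p = q by omega) hi m x a).symm }
  map_add' _ _ := by
    ext X p q h x; exact LinearMap.map_add₂ (φ.tmk P X (show i + p = q by omega)) _ _ _
  map_smul' _ _ := by
    ext X p q h x; exact LinearMap.map_smul₂ (φ.tmk P X (show i + p = q by omega)) _ _ _

lemma D_tmkHom (P : DGMod B) {Y : B.Obj} {i i' : ℤ} (h : i + 1 = i') (m : P.obj Y i) :
    D h (φ.tmkHom P m) = φ.tmkHom P (P.d Y h m) := by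
  ext X p q e x
  rw [D_app h _ X e rfl (show p + i + 1 = q by omega)]
  refine sub_eq_of_eq_add ?_
  exact φ.tensorD_tmk P X (show i + p = p + i by omega) (show p + i + 1 = q by omega) h rfl m x

lemma leftMul_comp_tmkHom (P : DGMod B) {Y Y' : B.Obj} {i p r : ℤ} (h : p + i = r)
    (h' : i + p = r) (b : B.Hom Y Y' p) (m : P.obj Y' i) :
    comp h (φ.leftMul b) (φ.tmkHom P m) = φ.tmkHom P (P.act h' m b) := by
  ext X s t e x
  rw [GHom.comp_app _ _ _ X e rfl]
  exact (φ.tmk_act P X h' (show r + s = t by omega) (show p + s = s + p by omega)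
    (show i + (s + p) = t by omega) m b x).symm

variable {φ}

lemma tensor_ghom_ext {P : DGMod B} {N : DGMod A} {n : ℤ} {f g : GHom (φ.tensor P) N n}
    (H : ∀ (Y : B.Obj) (i : ℤ) (m : P.obj Y i),
      comp rfl (φ.tmkHom P m) f = comp rfl (φ.tmkHom P m) g) : f = g := by
  ext X p q h z
  refine LinearMap.congr_fun (φ.tensor_hom_ext (f := f.app X h) (g := g.app X h)
    fun Y i j e m x => ?_) z
  have := congrArg (fun s => s.app X (show j + (i + n) = q by omega) x) (H Y i m)
  exact ((GHom.comp_app _ _ _ X _ (show j + i = p by omega) _).symm.trans this).trans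
    (GHom.comp_app _ _ _ X _ (show j + i = p by omega) _)

variable (φ)

/-- A graded morphism out of a tensor product as a graded morphism to `homMod`. -/
noncomputable def curry {P : DGMod B} {N : DGMod A} {n : ℤ} (f : GHom (φ.tensor P) N n) :
    GHom P (φ.homMod N) n where
  app Y i j h := (GHom.comp h).flip f ∘ₗ φ.tmkHom P
  app_act {X Y i j p i' j'} h hi h' x a := by
    rw [homMod_act]
    simp only [LinearMap.comp_apply, LinearMap.flip_apply]
    rw [← φ.leftMul_comp_tmkHom P (show p + i = i' by omega) hi, comp_assoc]

lemma curry_app {P : DGMod B} {N : DGMod A} {n : ℤ} (f : GHom (φ.tensor P) N n) (Y : B.Obj)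
    {i j : ℤ} (h : i + n = j) (m : P.obj Y i) :
    (φ.curry f).app Y h m = GHom.comp h (φ.tmkHom P m) f := rfl

/-- Both sides compare by the Leibniz rule and `d (m ⊗ x) = d m ⊗ x ± m ⊗ d x`. With `curry_uncurry`
and `curry_injective` this makes currying an isomorphism of complexes, so primitives can be sought
on either side of the adjunction. -/
lemma D_curry {P : DGMod B} {N : DGMod A} {n n' : ℤ} (hn : n + 1 = n')
    (f : GHom (φ.tensor P) N n) : D hn (φ.curry f) = φ.curry (D hn f) := by
  refine GHom.ext fun Y i j h m => ?_
  rw [D_app hn _ Y h rfl (show i + n + 1 = j by omega), curry_app, curry_app, curry_app]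
  refine sub_eq_of_eq_add ?_
  refine (D_comp rfl rfl hn (show i + n + 1 = j by omega) _ f).trans ?_
  rw [D_tmkHom]

lemma curry_injective {P : DGMod B} {N : DGMod A} {n : ℤ} :
    Function.Injective (φ.curry : GHom (φ.tensor P) N n → _) := by
  intro f g h
  refine tensor_ghom_ext fun Y i m => ?_
  exact congrArg (fun s => s.app Y rfl m) h

/-- The bilinear maps `(m, x) ↦ g(m)(x)`. -/
noncomputable def uncurryBilin {P : DGMod B} {N : DGMod A} {n : ℤ} (g : GHom P (φ.homMod N) n)
    (X : A.Obj) {i j : ℤ} (h : i + n = j) (Y : B.Obj) (p q : ℤ) (e : p + q = i) :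
    P.obj Y p →ₗ[k] φ.obj X Y q →ₗ[k] N.obj X j :=
  LinearMap.mk₂ k
    (fun m x => GHom.app (g.app Y (rfl : p + n = _) m) X (show q + (p + n) = j by omega) x)
    (fun _ _ _ => by rw [map_add]; rfl) (fun _ _ _ => by rw [map_smul]; rfl)
    (fun _ _ _ => map_add _ _ _) (fun _ _ _ => map_smul _ _ _)

lemma uncurryBilin_apply {P : DGMod B} {N : DGMod A} {n : ℤ} (g : GHom P (φ.homMod N) n)
    (X : A.Obj) {i j : ℤ} (h : i + n = j) (Y : B.Obj) {p q l : ℤ} (e : p + q = i) (e' : p + n = l)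
    (m : P.obj Y p) (x : φ.obj X Y q) : φ.uncurryBilin g X h Y p q e m x =
      GHom.app (g.app Y e' m) X (show q + l = j by omega) x := by
  subst e'; rfl

/-- The components of the graded morphism out of a tensor product given by a graded morphism to
`homMod`. -/
noncomputable def uncurryApp {P : DGMod B} {N : DGMod A} {n : ℤ} (g : GHom P (φ.homMod N) n)
    (X : A.Obj) {i j : ℤ} (h : i + n = j) : φ.Tensor P X i →ₗ[k] N.obj X j :=
  φ.tensorLift (φ.uncurryBilin g X h) (by
    intro Y Y' p q l pq ql h₁ h₂ h₃ h₄ m b x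
    refine (congrArg (fun s => GHom.app s X (show l + (pq + n) = j by omega) x)
      (g.app_act rfl h₁ rfl m b)).trans ?_
    exact GHom.comp_app (M := φ.right Y) (show q + (p + n) = pq + n by omega) _ _ X
      (show l + (pq + n) = j by omega) (show l + q = ql by omega) x)

lemma uncurryApp_tmk {P : DGMod B} {N : DGMod A} {n : ℤ} (g : GHom P (φ.homMod N) n) (X : A.Obj)
    {Y : B.Obj} {i j p q : ℤ} (h : i + n = j) (e : p + q = i) (m : P.obj Y p) (x : φ.obj X Y q) :
    φ.uncurryApp g X h (φ.tmk P X e m x) = φ.uncurryBilin g X h Y p q e m x :=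
  φ.tensorLift_tmk (φ.uncurryBilin g X h) _ e m x

/-- The graded morphism out of a tensor product given by a graded morphism to `homMod`. -/
noncomputable def uncurry {P : DGMod B} {N : DGMod A} {n : ℤ} (g : GHom P (φ.homMod N) n) :
    GHom (φ.tensor P) N n where
  app X i j h := φ.uncurryApp g X h
  app_act {X Y i j p i' j'} h hi h' z a := by
    refine LinearMap.congr_fun (φ.tensor_hom_ext
      (f := φ.uncurryApp g X h' ∘ₗ (φ.tensorAct P hi).flip a)
      (g := (N.act (show j + p = j' by omega)).flip a ∘ₗ φ.uncurryApp g Y h)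
      fun Y' s t e m y => ?_) z
    simp only [LinearMap.comp_apply, LinearMap.flip_apply]
    rw [φ.tensorAct_tmk P hi e rfl, uncurryApp_tmk, uncurryApp_tmk]
    exact GHom.app_act (M := φ.right Y') _ _ _ _ _ _

lemma uncurry_app_tmk {P : DGMod B} {N : DGMod A} {n : ℤ} (g : GHom P (φ.homMod N) n) (X : A.Obj)
    {Y : B.Obj} {i j p q l : ℤ} (h : i + n = j) (e : p + q = i) (m : P.obj Y p) (x : φ.obj X Y q)
    (e' : p + n = l) :
    (φ.uncurry g).app X h (φ.tmk P X e m x : φ.Tensor P X i) =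
      GHom.app (g.app Y e' m) X (show q + l = j by omega) x :=
  (φ.uncurryApp_tmk g X h e m x).trans (φ.uncurryBilin_apply g X h Y e e' m x)

@[simp]
lemma curry_uncurry {P : DGMod B} {N : DGMod A} {n : ℤ} (g : GHom P (φ.homMod N) n) :
    φ.curry (φ.uncurry g) = g := by
  refine GHom.ext fun Y i j h m => ?_
  refine GHom.ext fun X p q e x => ?_
  rw [curry_app, GHom.comp_app _ _ _ X e rfl]
  exact φ.uncurry_app_tmk g X (show p + i + n = q by omega) (show i + p = p + i by omega) m x h

lemma D_uncurry {P : DGMod B} {N : DGMod A} {n n' : ℤ} (hn : n + 1 = n')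
    (g : GHom P (φ.homMod N) n) : D hn (φ.uncurry g) = φ.uncurry (D hn g) :=
  φ.curry_injective (by rw [← D_curry, curry_uncurry, curry_uncurry])

lemma curry_sub {P : DGMod B} {N : DGMod A} {n : ℤ} (f g : GHom (φ.tensor P) N n) :
    φ.curry (f - g) = φ.curry f - φ.curry g := by
  refine GHom.ext fun Y i j h m => ?_
  exact map_sub (GHom.comp h (φ.tmkHom P m)) f g

/-- The tensor product of h-projective dg modules is h-projective. -/
lemma hProjective_tensor {P : DGMod B} (hP : P.HProjective)
    (hφ : ∀ Y, (φ.right Y).HProjective) : (φ.tensor P).HProjective := by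
  refine hProjective_of_exists_D_eq fun N hN n n' n'' h h' f hf => ?_
  -- Acyclicity of `homMod N` at `Y` is exactly h-projectivity of `φ(-, Y)` tested on `N`, in all
  -- degrees.
  have : (φ.homMod N).Acyclic := fun Y l m n h h' g hg => (hφ Y).exists_D_eq hN h h' g hg
  obtain ⟨g, hg⟩ := hP.exists_D_eq this h h' (φ.curry f) (by
    rw [D_curry, hf]
    refine GHom.ext fun Y i j h m => ?_
    exact map_zero (GHom.comp h (φ.tmkHom P m)))
  exact ⟨φ.uncurry g, φ.curry_injective (by rw [← D_curry, curry_uncurry, hg])⟩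

/-- The composition with a graded morphism as a graded morphism of modules of graded morphisms. -/
@[simps]
def homModMap {N N' : DGMod A} {n : ℤ} (g : GHom N N' n) :
    GHom (φ.homMod N) (φ.homMod N') n where
  app _ _ _ h := (GHom.comp h).flip g
  app_act {_ _ i l p i' l'} h hi h' x a := comp_assoc
    (show p + i = i' by omega) h' h (show p + l = l' by omega) (φ.leftMul a) x g

lemma D_homModMap {N N' : DGMod A} {n n' : ℤ} (hn : n + 1 = n') (g : GHom N N' n) :
    D hn (φ.homModMap g) = φ.homModMap (D hn g) := by
  refine GHom.ext fun Y i j h f => ?_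
  rw [D_app hn _ Y h rfl (show i + n + 1 = j by omega)]
  exact sub_eq_of_eq_add (D_comp rfl rfl hn (show i + n + 1 = j by omega) f g)

/-- The comparison map from the direct sum of the modules of graded morphisms. -/
noncomputable def homModDsum {J : Type u} (N : J → DGMod A) :
    GHom (dsum fun j => φ.homMod (N j)) (φ.homMod (dsum N)) 0 :=
  dsumDesc fun j => φ.homModMap (ofHom (dsumInj N j))

lemma D_homModDsum {J : Type u} (N : J → DGMod A) : D (zero_add 1) (φ.homModDsum N) = 0 :=
  D_dsumDesc_eq_zero _ fun j => by
    rw [D_homModMap, D_ofHom]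
    exact GHom.ext fun Y i l h f => map_zero (GHom.comp h f)

lemma homModDsum_apply {J : Type u} (N : J → DGMod A) (Y : B.Obj) {i : ℤ} (h : i + 0 = i)
    (x : Π₀ j, GHom (φ.right Y) (N j) i) (X : A.Obj) {p q : ℤ} (e : p + i = q)
    (z : (φ.right Y).obj X p) (j : J) :
    (GHom.app ((φ.homModDsum N).app Y h x : GHom (φ.right Y) (dsum N) i) X e z :
      Π₀ j, (N j).obj X q) j = (x j).app X e z := by
  classical
  refine LinearMap.congr_fun (DFinsupp.lhom_ext
    (φ := DFinsupp.lapply j ∘ₗ (eval X e z : GHom (φ.right Y) (dsum N) i →ₗ[k] _) ∘ₗ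
      (φ.homModDsum N).app Y h)
    (ψ := eval X e z ∘ₗ DFinsupp.lapply j) fun l y => ?_) x
  have h₁ : (φ.homModDsum N).app Y h (DFinsupp.single l y : Π₀ j, GHom (φ.right Y) (N j) i) =
    GHom.comp h y (ofHom (dsumInj N l)) :=
    dsumDesc_single (N := fun j => φ.homMod (N j)) (fun j => φ.homModMap (ofHom (dsumInj N j))) Y h l y
  simp only [LinearMap.comp_apply, h₁]
  change (GHom.app (GHom.comp h y (ofHom (dsumInj N l))) X e z : Π₀ j, (N j).obj X q) j =
    GHom.app ((DFinsupp.single l y : Π₀ j, GHom (φ.right Y) (N j) i) j) X e z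
  rw [GHom.comp_app _ _ _ X e e]
  rw [ofHom_app, dsumInj_app]
  by_cases hj : j = l
  · subst hj
    exact (DFinsupp.single_eq_same (β := fun j => (N j).obj X q)).trans
      (congrArg (fun s : GHom (φ.right Y) (N j) i => s.app X e z)
        (DFinsupp.single_eq_same (β := fun j => GHom (φ.right Y) (N j) i)).symm)
  · exact (DFinsupp.single_eq_of_ne (β := fun j => (N j).obj X q) hj).trans
      (congrArg (fun s : GHom (φ.right Y) (N j) i => s.app X e z)
        (DFinsupp.single_eq_of_ne (β := fun j => GHom (φ.right Y) (N j) i) hj).symm)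

/-- Surjectivity on cohomology is the condition `Cpt` for `φ(-, Y)`: a closed morphism to the sum
is, up to a boundary, supported on finitely many summands. Injectivity is formal. -/
lemma isQuasiIso_homModDsum {J : Type u} (N : J → DGMod A) (hφ : ∀ Y, (φ.right Y).Cpt) :
    IsQuasiIso (toHom (φ.homModDsum N) (φ.D_homModDsum N)) := by
  classical
  intro Y l m n h h'
  refine ⟨fun x hx ⟨y, hy⟩ => ?_, fun y hy => ?_⟩
  · change GHom (φ.right Y) (dsum N) l at y
    change Π₀ j, GHom (φ.right Y) (N j) m at x
    -- Each coordinate of `y` is a primitive of the corresponding coordinate of `x`; keeping only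
    -- those in the finite support of `x` gives an element of the direct sum.
    let z (j : J) : GHom (φ.right Y) (N j) l := GHom.comp (add_zero l) y (ofHom (dsumProj N j))
    have hz (j : J) : D h (z j) = x j := by
      refine (D_comp_of_closed_right _ h h y (D_ofHom _ _)).trans ?_
      change D h y = _ at hy
      rw [hy]
      ext X p q e t
      rw [Int.negOnePow_zero, one_smul, GHom.comp_app _ _ _ X e e]
      exact φ.homModDsum_apply N Y (add_zero m) x X e t j
    refine ⟨(DFinsupp.mk (DFinsupp.support x) fun j => z j : Π₀ j, GHom (φ.right Y) (N j) l), ?_⟩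
    refine DFinsupp.ext fun j => ?_
    rw [dsum_d_apply, DFinsupp.mk_apply]
    split_ifs with hj
    · exact hz j
    · rw [map_zero, DFinsupp.notMem_support_iff.1 hj]
  · change GHom (φ.right Y) (dsum N) m at y
    change D h' y = 0 at hy
    obtain ⟨g, F, hg⟩ := hφ Y J N h h' y (by rw [hy]; exact zero_mem _)
    let x (j : J) : GHom (φ.right Y) (N j) m :=
      GHom.comp (add_zero m) (y - D h g) (ofHom (dsumProj N j))
    have hx (j : J) : D h' (x j) = 0 := by
      refine (D_comp_of_closed_right _ h' h' _ (D_ofHom _ _)).trans ?_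
      rw [map_sub, D_D, hy]; simp
    refine ⟨(DFinsupp.mk F fun j => x j : Π₀ j, GHom (φ.right Y) (N j) m), g, ?_, ?_⟩
    · refine DFinsupp.ext fun j => ?_
      rw [dsum_d_apply, DFinsupp.mk_apply]
      split_ifs with hj
      · exact hx j
      · exact map_zero _
    · change y = (φ.homModDsum N).app Y (add_zero m) _ + D h g
      rw [← sub_eq_iff_eq_add]
      refine GHom.ext fun X p q e t => ?_
      refine DFinsupp.ext fun j => ?_
      refine Eq.trans ?_ (φ.homModDsum_apply N Y (add_zero m) _ X e t j).symm
      rw [DFinsupp.mk_apply]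
      split_ifs with hj
      · exact (GHom.comp_app (add_zero m) (y - D h g) (ofHom (dsumProj N j)) X e e t).symm
      · exact hg X p q e t j hj

/-- The tensor product preserves compactness if the right modules of the bimodule are compact. -/
lemma cpt_tensor {P : DGMod B} (hP : P.HProjective) (hP' : P.Cpt)
    (hφ : ∀ Y, (φ.right Y).Cpt) : (φ.tensor P).Cpt := by
  classical
  refine cpt_of_closed fun J N n n' n'' h h' f hf => ?_
  -- Up to the homotopy `e`, the curried morphism lifts from `homMod (dsum N)` to the direct sum of
  -- the `homMod (N j)`, where `Cpt` for `P` applies to the lift `g`.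
  obtain ⟨g, e, hg, hfg⟩ := hP.exists_lift (φ.isQuasiIso_homModDsum N hφ) h h' (φ.curry f)
    (by
      rw [D_curry, hf]
      refine GHom.ext fun Y i j h m => ?_
      exact map_zero (GHom.comp h (φ.tmkHom P m)))
  rw [ofHom_toHom] at hfg
  obtain ⟨s, F, hF⟩ := hP' J _ h h' g (by rw [hg]; exact zero_mem _)
  -- The primitive combines the homotopy `e` of the lift and the homotopy `s` that makes `g`
  -- finitely supported. What remains is, after currying, `g - D s` followed by the comparison map,
  -- so it is supported on `F`.
  refine ⟨φ.uncurry (e + GHom.comp (add_zero n) s (φ.homModDsum N)), F, fun X p q hp z j hj => ?_⟩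
  have key : φ.curry (f - D h (φ.uncurry (e + GHom.comp (add_zero n) s (φ.homModDsum N)))) =
      GHom.comp (add_zero n') (g - D h s) (φ.homModDsum N) := by
    rw [curry_sub, D_uncurry, curry_uncurry, hfg, map_add,
      D_comp_of_closed_right _ h h s (φ.D_homModDsum N), map_sub, LinearMap.sub_apply, Int.negOnePow_zero, one_smul]
    abel
  refine LinearMap.congr_fun (φ.tensor_hom_ext (f := DFinsupp.lapply j ∘ₗ GHom.app
    (f - D h (φ.uncurry (e + GHom.comp (add_zero n) s (φ.homModDsum N)))) X hp) (g := 0)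
    fun Y a b hab m x => ?_) z
  let x' : (φ.right Y).obj X b := x
  have h₁ := congrArg (fun t => GHom.app (t.app Y (rfl : a + n' = _) m : GHom _ _ _) X
    (show b + (a + n') = q by omega) x') key
  have h₂ := (GHom.comp_app (M := φ.right Y) (rfl : a + n' = _) (φ.tmkHom P m)
    (f - D h (φ.uncurry (e + GHom.comp (add_zero n) s (φ.homModDsum N)))) X
    (show b + (a + n') = q by omega) (show b + a = p by omega) x').symm.trans h₁
  refine (congrArg (fun t : Π₀ j, (N j).obj X q => t j) h₂).trans ?_
  have h₃ := GHom.comp_app (add_zero n') (g - D h s) (φ.homModDsum N) Y (rfl : a + n' = _) rfl m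
  have h₄ := hF Y a _ rfl m j hj
  rw [h₃]
  refine (φ.homModDsum_apply N Y (add_zero _) _ X _ x' j).trans ?_
  exact congrArg (fun t : GHom (φ.right Y) (N j) (a + n') => t.app X _ x') h₄

end DGBimod

end DG

/-! ### Representable modules and the adjunction between induction and restriction -/

namespace DG

open DGMod GHom

variable {k : Type u} [Field k]

/-! ### Representable dg modules -/

/-- The Leibniz rule for `1 ∘ 1 = 1` gives `d 1 = d 1 + d 1`. -/
lemma DGCat.d_one (A : DGCat.{u} k) (X : A.Obj) {n : ℤ} (h : 0 + 1 = n) :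
    A.d X X h (A.one X) = 0 := by
  obtain rfl : n = 1 := by omega
  have := A.d_comp (add_zero 0) (zero_add 1) (zero_add 1) (zero_add 1) (A.one X) (A.one X)
  rw [A.one_comp, A.comp_one, Int.negOnePow_zero, one_smul, A.one_comp] at this
  simpa using this

/-- The representable right dg module `A(-, Z)`. -/
@[reducible]
def DGCat.rep (A : DGCat.{u} k) (Z : A.Obj) : DGMod A where
  obj X n := A.Hom X Z n
  d X _ _ h := A.d X Z h
  d_d X _ _ _ h h' x := A.d_d X Z h h' x
  act h := A.comp h
  act_one x := A.comp_one x
  act_act h₁ h₂ h₃ h₄ x g f := A.assoc h₁ h₂ h₃ h₄ x g f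
  d_act h hi hj hn x f := A.d_comp h hi hj hn x f

namespace DGMod

variable {A : DGCat.{u} k}

/-- The graded morphism `a ↦ y · a` given by an element `y`. -/
def yoneda (N : DGMod A) {Z : A.Obj} {n : ℤ} : N.obj Z n →ₗ[k] GHom (A.rep Z) N n where
  toFun y :=
    { app := fun X i j h => N.act (show n + i = j by omega) y
      app_act := fun h hi h' x a => (N.act_act _ _ hi _ y x a).symm }
  map_add' _ _ := by
    ext X i j h x; exact LinearMap.map_add₂ (N.act (show n + i = j by omega)) _ _ _
  map_smul' _ _ := by
    ext X i j h x; exact LinearMap.map_smul₂ (N.act (show n + i = j by omega)) _ _ _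

lemma yoneda_app (N : DGMod A) {Z : A.Obj} {n : ℤ} (y : N.obj Z n) (X : A.Obj) {i j : ℤ}
    (h : i + n = j) (a : A.Hom X Z i) :
    (N.yoneda y).app X h a = N.act (show n + i = j by omega) y a := rfl

lemma D_yoneda (N : DGMod A) {Z : A.Obj} {n n' : ℤ} (h : n + 1 = n') (y : N.obj Z n) :
    D h (N.yoneda y) = N.yoneda (N.d Z h y) := by
  refine GHom.ext fun X i j e a => ?_
  rw [D_app h _ X e rfl (show i + n + 1 = j by omega), yoneda_app, yoneda_app, yoneda_app]
  exact sub_eq_of_eq_add (N.d_act _ h rfl _ y a)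

lemma rep_hom_ext {N : DGMod A} {Z : A.Obj} {n : ℤ} {f g : GHom (A.rep Z) N n}
    (h : f.app Z (zero_add n) (A.one Z) = g.app Z (zero_add n) (A.one Z)) : f = g := by
  refine GHom.ext fun X i j e a => ?_
  have hf := f.app_act (zero_add n) (zero_add i) e (A.one Z) a
  have hg := g.app_act (zero_add n) (zero_add i) e (A.one Z) a
  rw [show (A.rep Z).act (zero_add i) (A.one Z) a = a from A.one_comp a] at hf hg
  rw [hf, hg, h]

/-- By Yoneda the complex of graded morphisms from `A(-, Z)` to `N` is the complex `N(Z)`, which is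
acyclic when `N` is. -/
lemma hProjective_rep (Z : A.Obj) : (A.rep Z).HProjective := by
  refine hProjective_of_exists_D_eq fun N hN n n' n'' h h' f hf => ?_
  have e : N.d Z h' (f.app Z (zero_add n') (A.one Z)) = 0 := by
    have h₁ : D h' f = N.yoneda (N.d Z h' (f.app Z (zero_add n') (A.one Z))) := by
      rw [← D_yoneda]
      congr 1
      refine rep_hom_ext ?_
      rw [yoneda_app, N.act_one]
    rw [hf] at h₁
    have := congrArg (fun t => t.app Z (zero_add n'') (A.one Z)) h₁
    rw [yoneda_app, N.act_one] at this
    exact this.symm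
  obtain ⟨y, hy⟩ := hN Z n n' n'' h h' _ e
  refine ⟨N.yoneda y, rep_hom_ext ?_⟩
  rw [D_yoneda, yoneda_app, N.act_one, hy]

end DGMod

/-! ### Induction along a dg functor -/

namespace DGFunctor

variable {A B : DGCat.{u} k} (F : DGFunctor B A)

/-- The bimodule `A(X, F Y)`. -/
@[reducible]
def bimod : DGBimod B A where
  obj X Y n := A.Hom X (F.obj Y) n
  d X Y _ _ h := A.d X (F.obj Y) h
  d_d X Y _ _ _ h h' x := A.d_d X (F.obj Y) h h' x
  ract h := A.comp h
  ract_one x := A.comp_one x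
  ract_ract h₁ h₂ h₃ h₄ x g f := A.assoc h₁ h₂ h₃ h₄ x g f
  d_ract h hi hj hn x f := A.d_comp h hi hj hn x f
  lact {_ Y Y' i _ _} h := (A.comp h) ∘ₗ F.map Y Y' i
  one_lact x := by simp only [LinearMap.comp_apply, F.map_one]; exact A.one_comp x
  lact_lact h₁ h₂ h₃ h₄ g f x := by
    simp only [LinearMap.comp_apply, F.map_comp]; exact A.assoc h₁ h₂ h₃ h₄ _ _ x
  d_lact h hi hj hn g x := by
    simp only [LinearMap.comp_apply, F.map_d]; exact A.d_comp h hi hj hn _ x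
  lact_ract h₁ h₂ h₃ h₄ g x f := A.assoc h₁ h₂ h₃ h₄ _ x f

/-- The restriction of a graded morphism. -/
def resG {M N : DGMod A} {n : ℤ} : GHom M N n →ₗ[k] GHom (M.res F) (N.res F) n where
  toFun f :=
    { app := fun X _ _ h => f.app (F.obj X) h
      app_act := fun h hi h' x _ => f.app_act h hi h' x _ }
  map_add' _ _ := rfl
  map_smul' _ _ := rfl

lemma D_resG {M N : DGMod A} {n n' : ℤ} (h : n + 1 = n') (f : GHom M N n) :
    D h (F.resG f) = F.resG (D h f) := rfl

lemma resG_comp {M N P : DGMod A} {p q r : ℤ} (h : p + q = r) (f : GHom M N p) (g : GHom N P q) :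
    F.resG (comp h f g) = comp h (F.resG f) (F.resG g) := rfl

lemma resG_id (M : DGMod A) : F.resG (GHom.id M) = GHom.id (M.res F) := by
  refine GHom.ext fun X i j h x => ?_
  obtain rfl : i = j := by omega
  rfl

/-- The induced dg module. -/
noncomputable abbrev ind (P : DGMod B) : DGMod A := F.bimod.tensor P

/-- The right modules of the bimodule `A(X, F Y)` are representable, hence h-projective. -/
lemma hProjective_ind {P : DGMod B} (hP : P.HProjective) : (F.ind P).HProjective :=
  F.bimod.hProjective_tensor hP fun Y => hProjective_rep (F.obj Y)

/-- The graded morphism `x ↦ (a ↦ x · a)`. -/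
def coev (N : DGMod A) : GHom (N.res F) (F.bimod.homMod N) 0 where
  app Y i j h := (N.yoneda : N.obj (F.obj Y) j →ₗ[k] GHom (A.rep (F.obj Y)) N j) ∘ₗ
    (N.res F).cast Y (show i = j by omega)
  app_act {X Y i j p i' j'} h hi h' x a := by
    obtain rfl : i = j := by omega
    obtain rfl : i' = j' := by omega
    refine GHom.ext fun Z s t e c => ?_
    refine Eq.trans ?_ (GHom.comp_app (M := A.rep (F.obj X)) (show p + i = i' by omega)
      (F.bimod.leftMul a) (N.yoneda x) Z e (rfl : s + p = _) c).symm
    exact N.act_act (X := Z) hi (show i' + s = t by omega) (show p + s = s + p by omega)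
      (show i + (s + p) = t by omega) x (F.map _ _ _ a) c

/-- The graded morphism `m ⊗ a ↦ f(m) · a`. -/
noncomputable def adj {P : DGMod B} {N : DGMod A} {n : ℤ} (f : GHom P (N.res F) n) :
    GHom (F.ind P) N n :=
  F.bimod.uncurry (comp (add_zero n) f (F.coev N))

lemma adj_tmk {P : DGMod B} {N : DGMod A} {n : ℤ} (f : GHom P (N.res F) n) (X : A.Obj)
    {Y : B.Obj} {i j p q l : ℤ} (h : i + n = j) (e : p + q = i) (m : P.obj Y p)
    (a : A.Hom X (F.obj Y) q) (e' : p + n = l) :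
    (F.adj f).app X h (F.bimod.tmk P X e m a) =
      N.act (show l + q = j by omega) (f.app Y e' m) a := by
  refine (F.bimod.uncurry_app_tmk _ X h e m a e').trans ?_
  rw [GHom.comp_app (add_zero n) f (F.coev N) Y e' e' m]
  rfl

/-- The graded morphism `m ↦ m ⊗ 1`. -/
noncomputable def unit (P : DGMod B) : GHom P ((F.ind P).res F) 0 where
  app Y i j h := (F.bimod.tmk P (F.obj Y) (show i + 0 = j from h)).flip (A.one (F.obj Y))
  app_act {X Y i j p i' j'} h hi h' x b := by
    refine (F.bimod.tmk_act P (F.obj X) hi h' (show p + 0 = p by omega) (show i + p = j' by omega)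
      x b (A.one _)).trans ?_
    refine Eq.trans ?_ (F.bimod.tensorAct_tmk P (show j + p = j' by omega) h (zero_add p) x
      (A.one _) (F.map _ _ _ b)).symm
    refine congrArg (F.bimod.tmk P (F.obj X) (show i + p = j' by omega) x) ?_
    exact (A.comp_one _).trans (A.one_comp _).symm

lemma unit_app (P : DGMod B) (Y : B.Obj) {i j : ℤ} (h : i + 0 = j) (m : P.obj Y i) :
    (F.unit P).app Y h m = F.bimod.tmk P (F.obj Y) h m (A.one (F.obj Y)) := rfl

lemma unit_adj {P : DGMod B} {N : DGMod A} {n : ℤ} (f : GHom P (N.res F) n) :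
    comp (zero_add n) (F.unit P) (F.resG (F.adj f)) = f := by
  refine GHom.ext fun Y i j h m => ?_
  rw [GHom.comp_app _ _ _ Y h (add_zero i)]
  refine (F.adj_tmk f (F.obj Y) h (add_zero i) m (A.one _) h).trans ?_
  exact N.act_one _

/-- The elements `m ⊗ 1` generate the induced module, because `m ⊗ a = (m ⊗ 1) · a`. -/
lemma ind_hom_ext {P : DGMod B} {N : DGMod A} {n : ℤ} {f g : GHom (F.ind P) N n}
    (H : comp (zero_add n) (F.unit P) (F.resG f) = comp (zero_add n) (F.unit P) (F.resG g)) :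
    f = g := by
  refine GHom.ext fun X i j h z => ?_
  refine LinearMap.congr_fun (F.bimod.tensor_hom_ext (f := f.app X h) (g := g.app X h)
    fun Y p q e m a => ?_) z
  let z : (F.ind P).obj (F.obj Y) p := F.bimod.tmk P (F.obj Y) (add_zero p) m (A.one _)
  have e₁ : F.bimod.tmk P X e m a = (F.ind P).act e z a :=
    (congrArg _ (A.one_comp a).symm).trans
      (F.bimod.tensorAct_tmk P e (add_zero p) (zero_add q) m (A.one _) a).symm
  have e₂ := congrArg (fun t => t.app Y (rfl : p + n = _) m) H
  simp only [GHom.comp_app (zero_add n) _ _ Y (rfl : p + n = _) (add_zero p)] at e₂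
  refine (congrArg (f.app X h) e₁).trans (Eq.trans ?_ (congrArg (g.app X h) e₁).symm)
  refine (f.app_act rfl e h z a).trans (Eq.trans ?_ (g.app_act rfl e h z a).symm)
  exact congrArg (fun t => N.act (show p + n + q = j by omega) t a) e₂

lemma D_unit (P : DGMod B) {n : ℤ} (h : 0 + 1 = n) : D h (F.unit P) = 0 := by
  obtain rfl : n = 1 := by omega
  refine GHom.ext fun Y i j e m => ?_
  rw [D_app h _ Y e rfl (show i + 1 = j by omega), unit_app]
  refine sub_eq_of_eq_add ?_
  rw [GHom.zero_app, zero_add, Int.negOnePow_zero, one_smul, unit_app]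
  refine (F.bimod.tensorD_tmk P (F.obj Y) (add_zero i) (show i + 1 = j by omega) rfl (zero_add 1)
    m _).trans ?_
  refine (congrArg (fun t => _ + i.negOnePow • F.bimod.tmk P (F.obj Y) (show i + 1 = j by omega) m t)
    (A.d_one (F.obj Y) (zero_add 1))).trans ?_
  rw [map_zero, smul_zero, add_zero]

lemma D_unit_comp {P : DGMod B} {N : DGMod B} {n n' : ℤ} (h : n + 1 = n')
    (f : GHom ((F.ind P).res F) N n) :
    D h (comp (zero_add n) (F.unit P) f) = comp (zero_add n') (F.unit P) (D h f) :=
  D_comp_of_closed_left _ h h (F.D_unit P rfl) f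

lemma D_adj {P : DGMod B} {N : DGMod A} {n n' : ℤ} (h : n + 1 = n') (f : GHom P (N.res F) n) :
    D h (F.adj f) = F.adj (D h f) :=
  F.ind_hom_ext (by rw [unit_adj, ← D_resG, ← D_unit_comp, unit_adj])

lemma adj_add {P : DGMod B} {N : DGMod A} {n : ℤ} (f g : GHom P (N.res F) n) :
    F.adj (f + g) = F.adj f + F.adj g :=
  F.ind_hom_ext (by rw [map_add, map_add, unit_adj, unit_adj, unit_adj])

lemma adj_smul {P : DGMod B} {N : DGMod A} {n : ℤ} (c : k) (f : GHom P (N.res F) n) :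
    F.adj (c • f) = c • F.adj f :=
  F.ind_hom_ext (by rw [map_smul, map_smul, unit_adj, unit_adj])

end DGFunctor

end DG

/-! ### Free dg modules over a field and the bar differentials -/

namespace DG

open DGMod GHom

variable {k : Type u} [Field k]

namespace DGFunctor

variable {A B : DGCat.{u} k} (F : DGFunctor B A)

/-- The morphism induced by a graded morphism. -/
noncomputable def indMap {P P' : DGMod B} {n : ℤ} : GHom P P' n →ₗ[k] GHom (F.ind P) (F.ind P') n where
  toFun f := F.adj (comp (add_zero n) f (F.unit P'))
  map_add' f g := by rw [map_add, LinearMap.add_apply, adj_add]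
  map_smul' c f := by rw [map_smul, LinearMap.smul_apply, adj_smul]; rfl

lemma unit_indMap {P P' : DGMod B} {n : ℤ} (f : GHom P P' n) :
    comp (zero_add n) (F.unit P) (F.resG (F.indMap f)) = comp (add_zero n) f (F.unit P') :=
  F.unit_adj _

lemma D_indMap {P P' : DGMod B} {n n' : ℤ} (h : n + 1 = n') (f : GHom P P' n) :
    D h (F.indMap f) = F.indMap (D h f) := by
  refine (F.D_adj h _).trans (congrArg F.adj ?_)
  rw [D_comp_of_closed_right _ h h _ (F.D_unit P' rfl), Int.negOnePow_zero, one_smul]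

lemma indMap_comp {P P' P'' : DGMod B} {p q r : ℤ} (h : p + q = r) (f : GHom P P' p)
    (g : GHom P' P'' q) : F.indMap (comp h f g) = comp h (F.indMap f) (F.indMap g) :=
  F.ind_hom_ext (by
    rw [unit_indMap, resG_comp, ← comp_assoc (zero_add p) h h (zero_add r), unit_indMap,
      comp_assoc (add_zero p) h (zero_add q) h, unit_indMap, comp_assoc h _ (add_zero q) h])

/-- The counit `m ⊗ a ↦ m · a`. -/
noncomputable def counit (N : DGMod A) : GHom (F.ind (N.res F)) N 0 := F.adj (GHom.id _)

lemma unit_counit (N : DGMod A) :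
    comp (zero_add 0) (F.unit (N.res F)) (F.resG (F.counit N)) = GHom.id _ := F.unit_adj _

lemma D_counit (N : DGMod A) {n : ℤ} (h : 0 + 1 = n) : D h (F.counit N) = 0 := by
  refine (F.D_adj h _).trans ?_
  rw [D_ofHom]
  exact F.ind_hom_ext (by rw [unit_adj, map_zero, map_zero])

lemma indMap_counit {M N : DGMod A} {n : ℤ} (f : GHom M N n) :
    comp (add_zero n) (F.indMap (F.resG f)) (F.counit N) = comp (zero_add n) (F.counit M) f :=
  F.ind_hom_ext (by
    rw [resG_comp, ← comp_assoc (zero_add n) (add_zero n) (add_zero n) (zero_add n), unit_indMap,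
      comp_assoc (add_zero n) (add_zero n) (add_zero 0) (add_zero n), unit_counit, comp_id,
      resG_comp, ← comp_assoc (zero_add 0) (zero_add n) (zero_add n) (zero_add n), unit_counit,
      id_comp])

lemma indMap_id (P : DGMod B) : F.indMap (GHom.id P) = GHom.id (F.ind P) :=
  F.ind_hom_ext (by rw [unit_indMap, id_comp, resG_id, comp_id])

end DGFunctor

/-! ### Discrete dg categories -/

namespace DGCat

variable (A : DGCat.{u} k)

/-- The hom-spaces of the discrete dg category on the objects of `A`. -/
def discHom (X Y : A.Obj) (n : ℤ) : Submodule k k where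
  carrier := {c | ¬ (X = Y ∧ n = 0) → c = 0}
  add_mem' {a b} ha hb h := by rw [ha h, hb h, add_zero]
  zero_mem' _ := rfl
  smul_mem' c x hx h := by rw [hx h, smul_zero]

/-- The dg category with the objects of `A` whose only morphisms are the multiples of
identities. -/
@[reducible]
def disc : DGCat.{u} k where
  Obj := A.Obj
  Hom X Y n := ModuleCat.of k (A.discHom X Y n)
  d _ _ _ _ _ := 0
  d_d _ _ _ _ _ _ _ _ := rfl
  one X := ⟨1, fun h => (h ⟨rfl, rfl⟩).elim⟩
  comp {X Y Z i j n} h := LinearMap.mk₂ k (fun c c' => (⟨c.1 * c'.1, fun h' => by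
      by_contra hc
      obtain ⟨rfl, rfl⟩ := not_imp_comm.1 c.2 (left_ne_zero_of_mul hc)
      obtain ⟨rfl, rfl⟩ := not_imp_comm.1 c'.2 (right_ne_zero_of_mul hc)
      exact h' ⟨rfl, by omega⟩⟩ : A.discHom X Z n))
    (fun _ _ _ => Subtype.ext (add_mul _ _ _)) (fun _ _ _ => Subtype.ext (mul_assoc _ _ _))
    (fun _ _ _ => Subtype.ext (mul_add _ _ _)) (fun _ _ _ => Subtype.ext (mul_left_comm _ _ _))
  one_comp _ := Subtype.ext (one_mul _)
  comp_one _ := Subtype.ext (mul_one _)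
  assoc _ _ _ _ _ _ _ := Subtype.ext (mul_assoc _ _ _)
  d_comp _ _ _ _ g f := Subtype.ext
    (show 0 = 0 * f.1 + _ • (g.1 * 0) by rw [zero_mul, mul_zero, smul_zero, add_zero])

lemma disc_cases {X Y : A.Obj} {n : ℤ} (c : A.disc.Hom X Y n) :
    c = 0 ∨ ∃ (e : X = Y) (e' : n = 0) (a : k), c = a • (e ▸ e' ▸ A.disc.one X) := by
  by_cases h : X = Y ∧ n = 0
  · obtain ⟨rfl, rfl⟩ := h
    exact Or.inr ⟨rfl, rfl, c.1, Subtype.ext (mul_one c.1).symm⟩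
  · exact Or.inl (Subtype.ext (c.2 h))

open Classical in
/-- The image of a morphism of the discrete dg category. -/
noncomputable def discMap (X Y : A.Obj) (n : ℤ) : A.disc.Hom X Y n →ₗ[k] A.Hom X Y n :=
  if h : X = Y ∧ n = 0 then
    (LinearMap.toSpanSingleton k (A.Hom X Y n) (h.1 ▸ h.2 ▸ A.one X)).comp (A.discHom X Y n).subtype
  else 0

lemma discMap_one (X : A.Obj) : A.discMap X X 0 (A.disc.one X) = A.one X := by
  rw [discMap, dif_pos ⟨rfl, rfl⟩]
  exact one_smul k _

/-- The functor from the discrete dg category. -/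
noncomputable def discIncl : DGFunctor A.disc A where
  obj X := X
  map := A.discMap
  map_d {X Y m n} h f := by
    obtain rfl | ⟨e, rfl, a, rfl⟩ := A.disc_cases f
    · simp
    · change A.Obj at X Y
      subst e
      refine (map_zero _).trans ?_
      refine Eq.trans ?_ (congrArg (A.d X X h) (map_smul (A.discMap X X 0) a _)).symm
      refine Eq.trans ?_ (map_smul (A.d X X h) a _).symm
      refine Eq.trans ?_ (congrArg (fun t => a • A.d X X h t) (A.discMap_one X)).symm
      rw [A.d_one, smul_zero]
  map_one X := A.discMap_one X
  map_comp {X Y Z i j n} h g f := by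
    obtain rfl | ⟨e, rfl, a, rfl⟩ := A.disc_cases g
    · simp only [map_zero, LinearMap.zero_apply]
    obtain rfl | ⟨e', rfl, b, rfl⟩ := A.disc_cases f
    · simp only [map_zero]
    obtain rfl : n = 0 := by omega
    change A.Obj at X Y Z
    subst e' e
    have h₁ : A.disc.comp h (a • A.disc.one X) (b • A.disc.one X) = (a * b) • A.disc.one X :=
      Subtype.ext (show (a * 1) * (b * 1) = a * b * 1 by ring)
    have h₂ (c : k) : A.discMap X X 0 (c • A.disc.one X) = c • A.one X :=
      (map_smul _ _ _).trans (congrArg (c • ·) (A.discMap_one X))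
    refine (congrArg (A.discMap X X 0) h₁).trans ((h₂ _).trans ?_)
    refine Eq.trans ?_ (congrArg₂ (fun s t => A.comp h s t) (h₂ a) (h₂ b)).symm
    simp only [map_smul, LinearMap.smul_apply]
    rw [A.one_comp, smul_smul, mul_comm]

end DGCat

namespace DGMod

variable {A : DGCat.{u} k}

/-- Graded linear maps are graded morphisms over the discrete dg category. -/
def discGHom {M N : DGMod A.disc} {n : ℤ}
    (f : ∀ (X : A.Obj) {i j : ℤ}, i + n = j → (M.obj X i →ₗ[k] N.obj X j)) : GHom M N n where
  app := f
  app_act {X Y i j p i' j'} h hi h' x c := by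
    obtain rfl | ⟨rfl, rfl, a, rfl⟩ := A.disc_cases c
    · simp
    · obtain rfl : i = i' := by omega
      obtain rfl : j = j' := by omega
      simp only [map_smul]
      rw [M.act_one, N.act_one]

/-- Over a field, `d` has a linear section over the cycles, which extends to the whole component. -/
lemma Acyclic.exists_section {M : DGMod A} (hM : M.Acyclic) (X : A.Obj) {l m n : ℤ}
    (h : l + 1 = m) (h' : m + 1 = n) :
    ∃ σ : M.obj X m →ₗ[k] M.obj X l, ∀ z, M.d X h' z = 0 → M.d X h (σ z) = z := by
  let d' : M.obj X l →ₗ[k] LinearMap.ker (M.d X h') :=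
    (M.d X h).codRestrict _ fun x => M.d_d X h h' x
  obtain ⟨σ, hσ⟩ := d'.exists_rightInverse_of_surjective (LinearMap.range_eq_top.2 fun z => by
    obtain ⟨y, hy⟩ := hM X l m n h h' z.1 z.2
    exact ⟨y, Subtype.ext hy⟩)
  obtain ⟨τ, hτ⟩ := σ.exists_extend
  refine ⟨τ, fun z hz => ?_⟩
  have h₁ := LinearMap.congr_fun hτ ⟨z, hz⟩
  have h₂ := congrArg Subtype.val (LinearMap.congr_fun hσ ⟨z, hz⟩)
  refine (congrArg (M.d X h) h₁).trans h₂

lemma Acyclic.exists_contraction {N : DGMod A.disc} (hN : N.Acyclic) :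
    ∃ t : GHom N N (-1), D (show -1 + 1 = 0 by omega) t = GHom.id N := by
  choose σ hσ using fun (X : A.disc.Obj) {l m n : ℤ} (h : l + 1 = m) (h' : m + 1 = n) =>
    hN.exists_section X h h'
  -- The contraction is `t x = σ (x - σ (d x))`: the element `x - σ (d x)` is a cycle, so `d (t x) =
  -- x - σ (d x)`, while `t (d x) = σ (d x)`.
  refine ⟨discGHom fun X i j h => σ X (show j + 1 = i by omega) rfl ∘ₗ
    (LinearMap.id - σ X rfl rfl ∘ₗ N.d X rfl), ?_⟩
  refine GHom.ext fun X i j h x => ?_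
  obtain rfl : i = j := by omega
  rw [D_app _ _ X h rfl (show i - 1 + 1 = i by omega)]
  change N.d X _ (σ X _ rfl (x - σ X rfl rfl (N.d X rfl x))) - (-1 : ℤ).negOnePow •
    (σ X _ rfl (N.d X rfl x - σ X rfl rfl (N.d X rfl (N.d X rfl x)))) = x
  rw [N.d_d, map_zero, sub_zero, hσ, Int.negOnePow_neg, Int.negOnePow_one, Units.neg_smul,
    one_smul, sub_neg_eq_add]
  · exact sub_add_cancel (x : N.obj X i) (σ X rfl rfl (N.d X rfl x) : N.obj X i)
  · rw [map_sub, hσ, sub_self]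
    exact N.d_d X _ _ x

/-- Over the discrete category acyclic modules are contractible, and composing a closed morphism
with a contraction `t` of its target gives a primitive. -/
lemma hProjective_disc (P : DGMod A.disc) : P.HProjective := by
  refine hProjective_of_exists_D_eq fun N hN n n' n'' h h' f hf => ?_
  obtain ⟨t, ht⟩ := hN.exists_contraction
  refine ⟨comp (show n' + -1 = n by omega) f t, ?_⟩
  rw [D_comp _ h' (show -1 + 1 = 0 by omega) h, ht, hf, comp_id]
  simp

/-! ### Iterated free dg modules -/

/-- The restriction to the discrete dg category. -/
noncomputable abbrev und (N : DGMod A) : DGMod A.disc := N.res A.discIncl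

/-- The restriction of a graded morphism to the discrete dg category. -/
noncomputable abbrev undG {M N : DGMod A} {n : ℤ} : GHom M N n →ₗ[k] GHom M.und N.und n :=
  A.discIncl.resG

/-- The free dg module on the complexes underlying a dg module. -/
noncomputable def free (N : DGMod A) : DGMod A := A.discIncl.ind N.und

lemma hProjective_free (N : DGMod A) : N.free.HProjective :=
  A.discIncl.hProjective_ind (hProjective_disc N.und)

/-- The morphism of free dg modules induced by a graded morphism. -/
noncomputable def freeMap {M N : DGMod A} {n : ℤ} : GHom M N n →ₗ[k] GHom M.free N.free n :=
  A.discIncl.indMap ∘ₗ A.discIncl.resG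

/-- The action morphism of a free dg module. -/
noncomputable def freeCounit (N : DGMod A) : GHom N.free N 0 := A.discIncl.counit N

/-- The inclusion of generators of a free dg module. -/
noncomputable def freeUnit (N : DGMod A) : GHom N.und N.free.und 0 := A.discIncl.unit N.und

section

variable {M N P : DGMod A}

lemma D_freeMap {n n' : ℤ} (h : n + 1 = n') (f : GHom M N n) :
    D h (freeMap f) = freeMap (D h f) :=
  A.discIncl.D_indMap h (A.discIncl.resG f)

lemma freeMap_comp {p q r : ℤ} (h : p + q = r) (f : GHom M N p) (g : GHom N P q) :
    freeMap (comp h f g) = comp h (freeMap f) (freeMap g) :=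
  A.discIncl.indMap_comp h (A.discIncl.resG f) (A.discIncl.resG g)

lemma freeMap_id : freeMap (GHom.id M) = GHom.id M.free :=
  (congrArg A.discIncl.indMap (A.discIncl.resG_id M)).trans (A.discIncl.indMap_id _)

lemma D_freeCounit (N : DGMod A) {n : ℤ} (h : 0 + 1 = n) : D h N.freeCounit = 0 :=
  A.discIncl.D_counit N h

lemma D_freeUnit (N : DGMod A) {n : ℤ} (h : 0 + 1 = n) : D h N.freeUnit = 0 :=
  A.discIncl.D_unit N.und h

lemma freeMap_freeCounit {n : ℤ} (f : GHom M N n) :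
    comp (add_zero n) (freeMap f) N.freeCounit = comp (zero_add n) M.freeCounit f :=
  A.discIncl.indMap_counit f

lemma freeUnit_freeCounit (N : DGMod A) :
    comp (zero_add 0) N.freeUnit (undG N.freeCounit) = GHom.id N.und :=
  A.discIncl.unit_counit N

lemma freeUnit_freeMap {n : ℤ} (f : GHom M N n) :
    comp (zero_add n) M.freeUnit (undG (freeMap f)) = comp (add_zero n) (undG f) N.freeUnit :=
  A.discIncl.unit_indMap (A.discIncl.resG f)

/-- The iterated free dg modules. -/
noncomputable def iterFree (N : DGMod A) : ℕ → DGMod A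
  | 0 => N
  | n + 1 => (N.iterFree n).free

/-- The differentials of the bar resolution. -/
noncomputable def barD (N : DGMod A) : ∀ n : ℕ, GHom (N.iterFree n).free (N.iterFree n) 0
  | 0 => N.freeCounit
  -- Unrolled, this recursion is the usual alternating sum of the face maps of the simplicial bar
  -- construction, the outermost counit having sign `+`.
  | n + 1 => (N.iterFree n).free.freeCounit - freeMap (N.barD n)

lemma D_barD (N : DGMod A) (n : ℕ) {m : ℤ} (h : 0 + 1 = m) : D h (N.barD n) = 0 := by
  induction n with
  | zero => exact D_freeCounit N h
  | succ n ih =>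
    refine (map_sub (D h) (N.iterFree n).free.freeCounit (freeMap (N.barD n))).trans ?_
    rw [D_freeCounit, D_freeMap, ih, map_zero, sub_zero]
    rfl

/-- Naturality of the counit exchanges its composition with `f`. The identity drives the induction
for `barD_barD`: for `f` a bar differential, `N.freeCounit - f` is zero or `freeMap` of the previous
differential. -/
lemma freeCounit_sub_freeMap_comp (f : GHom N.free N 0) :
    comp (zero_add 0) (N.free.freeCounit - freeMap f) f =
      comp (zero_add 0) (freeMap f) (N.freeCounit - f) := by
  rw [LinearMap.map_sub₂, map_sub, freeMap_freeCounit]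

lemma barD_barD (N : DGMod A) (n : ℕ) :
    comp (M := (N.iterFree n).free.free) (N := (N.iterFree n).free) (zero_add 0)
      (N.barD (n + 1)) (N.barD n) = 0 := by
  induction n with
  | zero =>
    refine (freeCounit_sub_freeMap_comp N.freeCounit).trans ?_
    rw [sub_self, map_zero]
    rfl
  | succ n ih =>
    refine (freeCounit_sub_freeMap_comp (N.barD (n + 1))).trans ?_
    refine (congrArg (comp (zero_add 0) (freeMap (N.barD (n + 1))))
      (sub_sub_cancel (N.iterFree n).free.freeCounit (freeMap (N.barD n)))).trans ?_
    exact (freeMap_comp (zero_add 0) (N.barD (n + 1)) (N.barD n)).symm.trans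
      ((congrArg freeMap ih).trans (map_zero _))

/-- The morphism of iterated free dg modules induced by a graded morphism. -/
noncomputable def iterFreeMap {p : ℤ} :
    ∀ n : ℕ, GHom M N p →ₗ[k] GHom (M.iterFree n) (N.iterFree n) p
  | 0 => LinearMap.id
  | n + 1 => freeMap ∘ₗ iterFreeMap n

lemma D_iterFreeMap {p p' : ℤ} (h : p + 1 = p') (f : GHom M N p) (n : ℕ) :
    D h (iterFreeMap n f) = iterFreeMap n (D h f) := by
  induction n with
  | zero => rfl
  | succ n ih => exact (D_freeMap h (iterFreeMap n f)).trans (congrArg freeMap ih)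

lemma iterFreeMap_comp {p q r : ℤ} (h : p + q = r) (f : GHom M N p) (g : GHom N P q) (n : ℕ) :
    iterFreeMap n (comp h f g) = comp h (iterFreeMap n f) (iterFreeMap n g) := by
  induction n with
  | zero => rfl
  | succ n ih =>
    exact (congrArg freeMap ih).trans (freeMap_comp h (iterFreeMap n f) (iterFreeMap n g))

lemma iterFreeMap_id (n : ℕ) : iterFreeMap n (GHom.id M) = GHom.id (M.iterFree n) := by
  induction n with
  | zero => rfl
  | succ n ih => exact (congrArg freeMap ih).trans freeMap_id

lemma iterFreeMap_barD {p : ℤ} (f : GHom M N p) (n : ℕ) :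
    comp (M := (M.iterFree n).free) (N := (N.iterFree n).free) (add_zero p)
      (freeMap (iterFreeMap n f)) (N.barD n) =
      comp (zero_add p) (M.barD n) (iterFreeMap n f) := by
  induction n with
  | zero => exact freeMap_freeCounit f
  | succ n ih =>
    refine (map_sub (comp (add_zero p) (freeMap (freeMap (iterFreeMap n f))))
      (N.iterFree n).free.freeCounit (freeMap (N.barD n))).trans ?_
    refine Eq.trans ?_ (LinearMap.map_sub₂ (comp (zero_add p)) (M.iterFree n).free.freeCounit
      (freeMap (M.barD n)) (freeMap (iterFreeMap n f))).symm
    refine congrArg₂ (· - ·) (freeMap_freeCounit (freeMap (iterFreeMap n f))) ?_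
    refine (freeMap_comp (add_zero p) (freeMap (iterFreeMap n f)) (N.barD n)).symm.trans ?_
    exact (congrArg freeMap ih).trans
      (freeMap_comp (zero_add p) (M.barD n) (iterFreeMap n f))

lemma freeUnit_barD_zero (N : DGMod A) :
    comp (zero_add 0) N.freeUnit (undG (N.barD 0)) = GHom.id N.und :=
  freeUnit_freeCounit N

/-- The relation of an extra degeneracy: inserting a unit contracts the augmented bar complex. The
unit is linear only over the discrete category, so this holds after restriction to it. -/
lemma freeUnit_barD (N : DGMod A) (n : ℕ) :
    comp (zero_add 0) (N.iterFree n).free.freeUnit (undG (N.barD (n + 1))) =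
      GHom.id (N.iterFree n).free.und -
        comp (zero_add 0) (undG (N.barD n)) (N.iterFree n).freeUnit := by
  refine (congrArg (comp (zero_add 0) (N.iterFree n).free.freeUnit)
    (map_sub undG (N.iterFree n).free.freeCounit (freeMap (N.barD n)))).trans ?_
  rw [map_sub, freeUnit_freeCounit, freeUnit_freeMap]

end

end DGMod

end DG

/-! ### Twisted differentials and totalizations of complexes of dg modules -/

namespace DG

open DGMod GHom

variable {k : Type u} [Field k]

lemma exists_dependent_seq {X : ℕ → Type*} (R : ∀ n, X n → X (n + 1) → Prop) (x₀ : X 0)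
    (step : ∀ n x, ∃ y, R n x y) : ∃ x : ∀ n, X n, x 0 = x₀ ∧ ∀ n, R n (x n) (x (n + 1)) := by
  choose s hs using step
  exact ⟨fun n => Nat.rec x₀ s n, rfl, fun n => hs n _⟩

namespace DGMod

variable {A : DGCat.{u} k}

/-! ### Twisted dg modules -/

/-- The dg module with differential `d + q`. -/
@[reducible]
def twist (M : DGMod A) (q : GHom M M 1)
    (hq : D (show (1 : ℤ) + 1 = 2 by omega) q + comp (show (1 : ℤ) + 1 = 2 by omega) q q = 0) :
    DGMod A where
  obj := M.obj
  d X m n h := M.d X h + q.app X h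
  d_d X l m n h h' x := by
    -- As `q` has degree one, `D q = d q + q d`, so the hypothesis is the Maurer-Cartan form of `(d
    -- + q) ^ 2 = 0`.
    have := congrArg (fun f => f.app X (show l + 2 = n by omega) x) hq
    simp only [GHom.add_app, GHom.zero_app] at this
    rw [D_app _ q X _ h h', GHom.comp_app _ q q X _ h, Int.negOnePow_one] at this
    simp only [LinearMap.add_apply, map_add, M.d_d, zero_add]
    rw [← this, Units.neg_smul, one_smul, sub_neg_eq_add]
    abel
  act := M.act
  act_one := M.act_one
  act_act := M.act_act
  d_act h hi hj hn x f := by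
    simp only [LinearMap.add_apply, map_add]
    rw [M.d_act h hi hj hn, q.app_act hi h hn]
    abel

section

variable {M : DGMod A} {q : GHom M M 1}
    (hq : D (show (1 : ℤ) + 1 = 2 by omega) q + comp (show (1 : ℤ) + 1 = 2 by omega) q q = 0)

/-- The identity as a graded morphism from a dg module to its twist. -/
def toTwist : GHom M (twist M q hq) 0 where
  app X i j h := M.cast X (show i = j by omega)
  app_act _ _ _ _ _ := (M.cast_act _ _ _ _).trans (M.act_cast _ _ _ _).symm

lemma D_toTwist : D (zero_add 1) (toTwist hq) = comp (add_zero 1) q (toTwist hq) := by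
  refine GHom.ext fun X i j h x => ?_
  obtain rfl : i + 1 = j := h
  rw [D_app _ _ X rfl rfl rfl, GHom.comp_app _ _ _ X rfl rfl]
  change M.d X _ x + q.app X _ x - (0 : ℤ).negOnePow • M.d X _ x = q.app X _ x
  simp

end

/-! ### Totalizations -/

variable (A) in
/-- A complex of dg modules with closed differentials of degree zero. -/
structure ModComplex where
  L : ℕ → DGMod A
  δ : ∀ n, GHom (L (n + 1)) (L n) 0
  D_δ : ∀ n, D (zero_add 1) (δ n) = 0
  δ_δ : ∀ n, comp (zero_add 0) (δ (n + 1)) (δ n) = 0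

namespace ModComplex

variable (C : ModComplex A)

/-- The shifts of the terms of the complex. -/
@[reducible]
def shifts (j : ULift.{u} ℕ) : DGMod A := shift (C.L j.down) j.down

/-- The inclusion of a term in the direct sum of the shifts. -/
noncomputable def preIncl (n : ℕ) : GHom (C.L n) (dsum C.shifts) (-n) :=
  comp (add_zero (-(n : ℤ))) (up (C.L n) (show (n : ℤ) + -n = 0 by omega))
    (ofHom (dsumInj C.shifts ⟨n⟩))

lemma D_preIncl (n : ℕ) {m : ℤ} (h : -(n : ℤ) + 1 = m) : D h (C.preIncl n) = 0 := by
  refine (D_comp_of_closed_right _ h h _ (D_ofHom _ _)).trans ?_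
  rw [D_up]; simp

lemma inj_eq (n : ℕ) : ofHom (dsumInj C.shifts ⟨n⟩) =
    comp (show (n : ℤ) + -n = 0 by omega) (down (C.L n) n) (C.preIncl n) := by
  rw [preIncl, ← comp_assoc (show (n : ℤ) + -n = 0 by omega) (add_zero 0), down_up, id_comp]

lemma preIncl_hom_ext {E : DGMod A} {p : ℤ} {f g : GHom (dsum C.shifts) E p}
    (H : ∀ n, comp rfl (C.preIncl n) f = comp rfl (C.preIncl n) g) : f = g := by
  refine dsum_hom_ext fun ⟨n⟩ => ?_
  rw [inj_eq, comp_assoc _ (zero_add p) rfl (show (n : ℤ) + (-n + p) = p by omega),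
    comp_assoc _ (zero_add p) rfl (show (n : ℤ) + (-n + p) = p by omega), H]

/-- The components of the differential of the totalization. -/
noncomputable def twistComp : ∀ n : ℕ, GHom (shift (C.L n) n) (dsum C.shifts) 1
  | 0 => 0
  | n + 1 => comp (show ((n + 1 : ℕ) : ℤ) + -n = 1 by omega) (down (C.L (n + 1)) _)
      (comp (zero_add (-(n : ℤ))) (C.δ n) (C.preIncl n))

/-- The twist of the differential of the totalization. -/
noncomputable def twistMap : GHom (dsum C.shifts) (dsum C.shifts) 1 :=
  dsumDesc fun j => C.twistComp j.down

lemma inj_twistMap (n : ℕ) :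
    comp (zero_add 1) (ofHom (dsumInj C.shifts ⟨n⟩)) C.twistMap = C.twistComp n :=
  inj_dsumDesc (N := C.shifts) (fun j : ULift.{u} ℕ => C.twistComp j.down) ⟨n⟩

lemma preIncl_twistMap_zero {r : ℤ} (h : -((0 : ℕ) : ℤ) + 1 = r) :
    comp h (C.preIncl 0) C.twistMap = 0 := by
  rw [preIncl, comp_assoc (add_zero _) h (zero_add 1) h, inj_twistMap]
  exact map_zero _

lemma preIncl_twistMap_succ (n : ℕ) {r : ℤ} (h : -((n + 1 : ℕ) : ℤ) + 1 = r) :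
    comp h (C.preIncl (n + 1)) C.twistMap =
      comp (show 0 + -(n : ℤ) = r by omega) (C.δ n) (C.preIncl n) := by
  obtain rfl : -(n : ℤ) = r := by omega
  rw [preIncl, comp_assoc (add_zero _) h (zero_add 1) h, inj_twistMap]
  change comp h _ (comp _ _ _) = _
  rw [← comp_assoc (show -((n + 1 : ℕ) : ℤ) + (n + 1 : ℕ) = 0 by omega) (zero_add _), up_down,
    id_comp]

/-- The two summands vanish separately: the twist is closed because the `δ` are, and its square is
zero because `δ ∘ δ = 0`. The indices `0` and `1` stand apart, since there two steps down leave the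
complex. -/
lemma twist_condition : D (show (1 : ℤ) + 1 = 2 by omega) C.twistMap +
    comp (show (1 : ℤ) + 1 = 2 by omega) C.twistMap C.twistMap = 0 := by
  have h₁ : D (show (1 : ℤ) + 1 = 2 by omega) C.twistMap = 0 := by
    refine D_dsumDesc_eq_zero _ fun ⟨n⟩ => ?_
    cases n with
    | zero => exact map_zero _
    | succ n =>
      refine (D_comp_of_closed_left _ (show -(n : ℤ) + 1 = -n + 1 from rfl) _ (D_down _ rfl) _).trans ?_
      rw [D_comp_of_closed_left _ rfl _ (C.D_δ n), D_preIncl]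
      simp
  rw [h₁, zero_add]
  refine C.preIncl_hom_ext fun n => ?_
  rw [map_zero]
  match n with
  | 0 =>
    rw [← comp_assoc rfl (show -((0 : ℕ) : ℤ) + 1 + 1 = -((0 : ℕ) : ℤ) + 2 by omega),
      preIncl_twistMap_zero]
    simp
  | 1 =>
    rw [← comp_assoc rfl (show -((1 : ℕ) : ℤ) + 1 + 1 = -((1 : ℕ) : ℤ) + 2 by omega),
      C.preIncl_twistMap_succ 0, comp_assoc _ _ rfl
        (show 0 + (-((0 : ℕ) : ℤ) + 1) = -((1 : ℕ) : ℤ) + 2 by omega),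
      preIncl_twistMap_zero]
    simp
  | n + 1 + 1 =>
    rw [← comp_assoc rfl (show -((n + 1 + 1 : ℕ) : ℤ) + 1 + 1 = -((n + 1 + 1 : ℕ) : ℤ) + 2 by omega),
      C.preIncl_twistMap_succ (n + 1), comp_assoc _ _ rfl
        (show 0 + (-((n + 1 : ℕ) : ℤ) + 1) = -((n + 1 + 1 : ℕ) : ℤ) + 2 by omega),
      C.preIncl_twistMap_succ n, ← comp_assoc (zero_add 0)
        (show 0 + -(n : ℤ) = -((n + 1 + 1 : ℕ) : ℤ) + 2 by omega), C.δ_δ]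
    simp

/-- The totalization. -/
@[reducible]
noncomputable def tot : DGMod A := twist (dsum C.shifts) C.twistMap C.twist_condition

/-- The inclusion of a term in the totalization. -/
noncomputable def ι (n : ℕ) : GHom (C.L n) C.tot (-n) :=
  comp (add_zero (-(n : ℤ))) (C.preIncl n) (toTwist C.twist_condition)

lemma D_ι_zero {r : ℤ} (h : -((0 : ℕ) : ℤ) + 1 = r) : D h (C.ι 0) = 0 := by
  refine (D_comp_of_closed_left _ (zero_add 1) h (C.D_preIncl 0 rfl) _).trans ?_
  rw [D_toTwist, ← comp_assoc h (add_zero _), preIncl_twistMap_zero]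
  simp

lemma D_ι_succ (n : ℕ) {r : ℤ} (h : -((n + 1 : ℕ) : ℤ) + 1 = r) :
    D h (C.ι (n + 1)) = comp (show 0 + -(n : ℤ) = r by omega) (C.δ n) (C.ι n) := by
  refine (D_comp_of_closed_left _ (zero_add 1) h (C.D_preIncl (n + 1) rfl) _).trans ?_
  rw [D_toTwist, ← comp_assoc h (add_zero _), preIncl_twistMap_succ, ι,
    comp_assoc _ (add_zero r) (add_zero _)]

lemma single_eq_ι (X : A.Obj) (i : ℤ) (n : ℕ) (x : (C.L n).obj X (i + n)) :
    (DFinsupp.single ⟨n⟩ x : Π₀ j, (C.shifts j).obj X i) =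
      (C.ι n).app X (show i + n + -n = i by omega) x := by
  rw [ι, GHom.comp_app _ _ _ X _ (show i + n + -n = i by omega), preIncl,
    GHom.comp_app _ _ _ X _ (show i + n + -n = i by omega)]
  classical
  change _ = (dsumInj C.shifts ⟨n⟩).app X i x
  rw [dsumInj_app]
  congr
  exact Subsingleton.elim _ _

lemma tot_linear_ext {V : Type*} [AddCommGroup V] [Module k V] {X : A.Obj} {i : ℤ}
    {f g : C.tot.obj X i →ₗ[k] V}
    (H : ∀ (n : ℕ) (m : ℤ) (h : m + -n = i) (x : (C.L n).obj X m),
      f ((C.ι n).app X h x) = g ((C.ι n).app X h x)) : f = g := by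
  refine DFinsupp.lhom_ext fun ⟨n⟩ x => ?_
  have := H n (i + n) (by omega) x
  rw [← single_eq_ι] at this
  exact this

/-- The linear map out of the totalization given by its components. -/
noncomputable def totLift {V : Type*} [AddCommGroup V] [Module k V] {X : A.Obj} {i : ℤ}
    (f : ∀ (n : ℕ) (m : ℤ), m + -n = i → ((C.L n).obj X m →ₗ[k] V)) : C.tot.obj X i →ₗ[k] V :=
  DFinsupp.lsum (R := k) (M := fun j => (C.shifts j).obj X i) ℕ
    fun j => f j.down (i + j.down) (by omega)

lemma totLift_ι {V : Type*} [AddCommGroup V] [Module k V] {X : A.Obj} {i : ℤ}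
    (f : ∀ (n : ℕ) (m : ℤ), m + -n = i → ((C.L n).obj X m →ₗ[k] V)) {n : ℕ} {m : ℤ}
    (h : m + -n = i) (x : (C.L n).obj X m) :
    C.totLift f ((C.ι n).app X h x) = f n m h x := by
  obtain rfl : m = i + n := by omega
  rw [← single_eq_ι]
  exact DFinsupp.lsum_single ℕ (fun j : ULift.{u} ℕ => f j.down (i + j.down) (by omega)) ⟨n⟩ x

lemma tot_hom_ext {E : DGMod A} {p : ℤ} {f g : GHom C.tot E p}
    (H : ∀ n, comp rfl (C.ι n) f = comp rfl (C.ι n) g) : f = g := by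
  refine GHom.ext fun X i j h x => LinearMap.congr_fun (C.tot_linear_ext fun n m e y => ?_) x
  have := congrArg (fun t => t.app X (show m + (-n + p) = j by omega) y) (H n)
  rw [GHom.comp_app _ _ _ X _ e, GHom.comp_app _ _ _ X _ e] at this
  exact this

/-- The graded morphism out of the totalization given by its components. -/
noncomputable def desc {E : DGMod A} {p : ℤ} (f : ∀ n : ℕ, GHom (C.L n) E (-n + p)) :
    GHom C.tot E p where
  app X i j h := C.totLift fun n m e => (f n).app X (by omega)
  app_act {X Y i j s i' j'} h hi h' x a := by
    refine LinearMap.congr_fun (C.tot_linear_ext 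
      (f := C.totLift (fun n m e => (f n).app X (show m + (-n + p) = j' by omega)) ∘ₗ
        (C.tot.act hi).flip a)
      (g := (E.act (show j + s = j' by omega)).flip a ∘ₗ
        C.totLift (fun n m e => (f n).app Y (show m + (-n + p) = j by omega))) fun n m e y => ?_) x
    have h₁ := (C.ι n).app_act e (show m + s = m + s from rfl) (show m + s + -n = i' by omega) y a
    simp only [LinearMap.comp_apply, LinearMap.flip_apply]
    rw [← h₁, totLift_ι, totLift_ι]
    exact (f n).app_act _ _ _ _ _

lemma ι_desc {E : DGMod A} {p : ℤ} (f : ∀ n : ℕ, GHom (C.L n) E (-n + p)) (n : ℕ) :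
    comp rfl (C.ι n) (C.desc f) = f n := by
  refine GHom.ext fun X i j h x => ?_
  rw [GHom.comp_app _ _ _ X _ rfl]
  exact C.totLift_ι _ _ _

lemma D_ι_zero_comp {E : DGMod A} {p p' q q' : ℤ} (f : GHom C.tot E p) (hp : p + 1 = p')
    (hq : -((0 : ℕ) : ℤ) + p = q) (hq' : q + 1 = q') :
    D hq' (comp hq (C.ι 0) f) = comp (by omega) (C.ι 0) (D hp f) := by
  rw [D_comp hq rfl hp hq', D_ι_zero]
  simp

lemma D_ι_succ_comp {E : DGMod A} {p p' q q' s : ℤ} (n : ℕ) (f : GHom C.tot E p)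
    (hp : p + 1 = p') (hq : -((n + 1 : ℕ) : ℤ) + p = q) (hq' : q + 1 = q')
    (hs : -(n : ℤ) + p = s) :
    D hq' (comp hq (C.ι (n + 1)) f) = comp (by omega) (C.ι (n + 1)) (D hp f) +
      p.negOnePow • comp (show 0 + s = q' by omega) (C.δ n) (comp hs (C.ι n) f) := by
  rw [D_comp hq rfl hp hq', D_ι_succ,
    comp_assoc _ _ hs (show 0 + s = q' by omega)]

/-- A primitive on a direct sum is a family of components, built by recursion on the index: the
component on `L (n + 1)` must have differential equal to that of `f` corrected by `δ` followed by
the component on `L n`. Nothing has to converge. -/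
lemma hProjective_tot (hC : ∀ n, (C.L n).HProjective) : C.tot.HProjective := by
  refine hProjective_of_exists_D_eq fun E hE m m' m'' h h' f hf => ?_
  -- The invariant is the equation for the `j`-th component precomposed with `δ j`. The correction
  -- term from index `j - 1` then drops out by `δ ∘ δ = 0`, so the invariant does not mention
  -- earlier components, yet it suffices to make the next right-hand side closed.
  let X (j : ℕ) := { g : GHom (C.L j) E (-j + m) //
    ∀ (r : ℤ) (hr : -(j : ℤ) + m' = r),
      comp (zero_add r) (C.δ j) (D (show -(j : ℤ) + m + 1 = r by omega) g) =
        comp (zero_add r) (C.δ j) (comp hr (C.ι j) f) }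
  obtain ⟨g₀, hg₀⟩ := (hC 0).exists_D_eq hE
    (show -((0 : ℕ) : ℤ) + m + 1 = -((0 : ℕ) : ℤ) + m' by omega)
    (show -((0 : ℕ) : ℤ) + m' + 1 = -((0 : ℕ) : ℤ) + m'' by omega) (comp rfl (C.ι 0) f) (by
      rw [D_ι_zero_comp _ _ h', hf, map_zero])
  have hm : m'.negOnePow = - m.negOnePow := by rw [← h, Int.negOnePow_succ]
  have step (n : ℕ) (x : X n) : ∃ y : X (n + 1),
      D (show -((n + 1 : ℕ) : ℤ) + m + 1 = -((n + 1 : ℕ) : ℤ) + m' by omega) y.1 =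
      comp rfl (C.ι (n + 1)) f + m.negOnePow •
        comp (show 0 + (-(n : ℤ) + m) = -((n + 1 : ℕ) : ℤ) + m' by omega) (C.δ n) x.1 := by
    obtain ⟨y, hy⟩ := (hC (n + 1)).exists_D_eq hE
      (show -((n + 1 : ℕ) : ℤ) + m + 1 = -((n + 1 : ℕ) : ℤ) + m' by omega)
      (show -((n + 1 : ℕ) : ℤ) + m' + 1 = -((n + 1 : ℕ) : ℤ) + m'' by omega)
      (comp rfl (C.ι (n + 1)) f + m.negOnePow •
        comp (show 0 + (-(n : ℤ) + m) = -((n + 1 : ℕ) : ℤ) + m' by omega) (C.δ n) x.1) (by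
        have hr : -(n : ℤ) + m' = -((n + 1 : ℕ) : ℤ) + m'' := by omega
        rw [map_add, D_units_smul, C.D_ι_succ_comp n f h' rfl _ hr, hf, map_zero, zero_add,
          D_comp_of_closed_left _ (show -(n : ℤ) + m + 1 = -((n + 1 : ℕ) : ℤ) + m'' by omega)
            _ (C.D_δ n), x.2 _ hr, hm, Units.neg_smul, neg_add_cancel])
    refine ⟨⟨y, fun r hr => ?_⟩, hy⟩
    obtain rfl := hr
    rw [hy, map_add, comp_units_smul, ← comp_assoc (zero_add 0) (by omega) _ (by omega), C.δ_δ]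
    simp
  obtain ⟨x, hx₀, hx⟩ := exists_dependent_seq (X := X) _
    ⟨g₀, fun r hr => by obtain rfl := hr; rw [hg₀]⟩ step
  have hx₀' : (x 0).1 = g₀ := congrArg Subtype.val hx₀
  refine ⟨C.desc fun n => (x n).1, C.tot_hom_ext fun n => ?_⟩
  cases n with
  | zero =>
    have := C.D_ι_zero_comp (C.desc fun n => (x n).1) h rfl
      (show -((0 : ℕ) : ℤ) + m + 1 = -((0 : ℕ) : ℤ) + m' by omega)
    rw [ι_desc, hx₀', hg₀] at this
    exact this.symm
  | succ n =>
    have := C.D_ι_succ_comp n (C.desc fun n => (x n).1) h rfl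
      (show -((n + 1 : ℕ) : ℤ) + m + 1 = -((n + 1 : ℕ) : ℤ) + m' by omega) rfl
    rw [ι_desc, ι_desc, hx n] at this
    exact (add_right_cancel this).symm

end ModComplex

end DGMod

end DG

/-! ### The bar resolution, its functoriality and its contraction -/

namespace DG

open DGMod GHom

variable {k : Type u} [Field k]

namespace DGMod

variable {A : DGCat.{u} k}

/-- `η` and `H` exhibit `f` as a homotopy equivalence of complexes at each object; neither has to
respect the action of `A`. -/
lemma isQuasiIso_of_contraction {M N : DGMod A} (f : M ⟶ N)
    (η : ∀ (X : A.Obj) (n : ℤ), N.obj X n →ₗ[k] M.obj X n)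
    (H : ∀ (X : A.Obj) {m n : ℤ}, m + 1 = n → (M.obj X n →ₗ[k] M.obj X m))
    (hη : ∀ (X : A.Obj) {m n : ℤ} (h : m + 1 = n) (y : N.obj X m),
      M.d X h (η X m y) = η X n (N.d X h y))
    (hf : ∀ (X : A.Obj) (n : ℤ) (y : N.obj X n), f.app X n (η X n y) = y)
    (hH : ∀ (X : A.Obj) {l m n : ℤ} (h : l + 1 = m) (h' : m + 1 = n) (x : M.obj X m),
      M.d X h (H X h x) + H X h' (M.d X h' x) = x - η X m (f.app X m x)) : IsQuasiIso f := by
  intro X l m n h h'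
  refine ⟨fun x hx ⟨y, hy⟩ => ⟨H X h x + η X l y, ?_⟩, fun y hy => ⟨η X m y, 0, ?_, ?_⟩⟩
  · have := hH X h h' x
    rw [hx, map_zero, add_zero] at this
    rw [map_add, this, hη, hy, sub_add_cancel]
  · rw [hη, hy, map_zero]
  · rw [hf, map_zero, add_zero]

/-! ### The bar resolution -/

/-- The inclusion of generators of a free dg module. -/
noncomputable def freeSec (N : DGMod A) (X : A.Obj) (m : ℤ) : N.obj X m →ₗ[k] N.free.obj X m :=
  N.freeUnit.app X (add_zero m)

lemma d_freeSec (N : DGMod A) (X : A.Obj) {m n : ℤ} (h : m + 1 = n) (x : N.obj X m) :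
    N.free.d X h (N.freeSec X m x) = N.freeSec X n (N.d X h x) := by
  have := congrArg (fun f => f.app X (show m + 1 = n from h) x) (N.D_freeUnit (zero_add 1))
  have e := D_app (zero_add 1) N.freeUnit X (show m + 1 = n from h) h h x
  rw [Int.negOnePow_zero, one_smul] at e
  exact sub_eq_zero.1 (e.symm.trans this)

lemma barD_zero_freeSec (N : DGMod A) (X : A.Obj) (m : ℤ) (x : N.obj X m) :
    (N.barD 0).app X (add_zero m) (N.freeSec X m x) = x := by
  have := congrArg (fun f => f.app X (add_zero m) x) N.freeUnit_barD_zero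
  exact (GHom.comp_app (zero_add 0) N.freeUnit (undG (N.barD 0)) X (add_zero m) (add_zero m)
    x).symm.trans this

lemma barD_succ_freeSec (N : DGMod A) (n : ℕ) (X : A.Obj) (m : ℤ)
    (x : (N.iterFree n).free.obj X m) :
    (N.barD (n + 1)).app X (add_zero m) ((N.iterFree n).free.freeSec X m x) =
      x - (N.iterFree n).freeSec X m ((N.barD n).app X (add_zero m) x) := by
  have := congrArg (fun f => f.app X (add_zero m) x) (N.freeUnit_barD n)
  refine (GHom.comp_app (zero_add 0) (N.iterFree n).free.freeUnit (undG (N.barD (n + 1))) X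
    (add_zero m) (add_zero m) x).symm.trans (this.trans ?_)
  exact congrArg (x - ·) (GHom.comp_app (zero_add 0) (undG (N.barD n)) (N.iterFree n).freeUnit X
    (add_zero m) (add_zero m) x)

lemma freeMap_freeSec {M N : DGMod A} {p : ℤ} (f : GHom M N p) (X : A.Obj) {m n : ℤ}
    (h : m + p = n) (x : M.obj X m) :
    (freeMap f).app X h (M.freeSec X m x) = N.freeSec X n (f.app X h x) := by
  have := congrArg (fun f => f.app X h x) (freeUnit_freeMap f)
  refine (GHom.comp_app (zero_add p) M.freeUnit (undG (freeMap f)) X h (add_zero m)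
    x).symm.trans (this.trans ?_)
  exact GHom.comp_app (add_zero p) (undG f) N.freeUnit X h h x

/-- The terms of the bar resolution. -/
noncomputable def barTerm (N : DGMod A) (n : ℕ) : DGMod A := (N.iterFree n).free

/-- The augmentation of the bar complex. -/
noncomputable def barε (N : DGMod A) : GHom (N.barTerm 0) N 0 := N.barD 0

/-- The differentials of the bar complex. -/
noncomputable def barδ (N : DGMod A) (n : ℕ) : GHom (N.barTerm (n + 1)) (N.barTerm n) 0 :=
  N.barD (n + 1)

lemma D_barε (N : DGMod A) {m : ℤ} (h : 0 + 1 = m) : D h N.barε = 0 := N.D_barD 0 h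

lemma barδ_barε (N : DGMod A) : comp (zero_add 0) (N.barδ 0) N.barε = 0 := N.barD_barD 0

/-- The bar complex. -/
@[simps]
noncomputable def barComplex (N : DGMod A) : ModComplex A where
  L := N.barTerm
  δ := N.barδ
  D_δ n := N.D_barD (n + 1) _
  δ_δ n := N.barD_barD (n + 1)

/-- The extra degeneracy on the module. -/
noncomputable def barSec₀ (N : DGMod A) (X : A.Obj) (m : ℤ) :
    N.obj X m →ₗ[k] (N.barTerm 0).obj X m := N.freeSec X m

/-- The extra degeneracies of the bar complex. -/
noncomputable def barSec (N : DGMod A) (n : ℕ) (X : A.Obj) (m : ℤ) :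
    (N.barTerm n).obj X m →ₗ[k] (N.barTerm (n + 1)).obj X m := (N.iterFree n).free.freeSec X m

section

variable (N : DGMod A) (X : A.Obj) {m n : ℤ}

lemma d_barSec₀ (h : m + 1 = n) (x : N.obj X m) :
    (N.barTerm 0).d X h (N.barSec₀ X m x) = N.barSec₀ X n (N.d X h x) := N.d_freeSec X h x

lemma d_barSec (i : ℕ) (h : m + 1 = n) (x : (N.barTerm i).obj X m) :
    (N.barTerm (i + 1)).d X h (N.barSec i X m x) = N.barSec i X n ((N.barTerm i).d X h x) :=
  (N.iterFree i).free.d_freeSec X h x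

lemma barε_barSec₀ (x : N.obj X m) : N.barε.app X (add_zero m) (N.barSec₀ X m x) = x :=
  N.barD_zero_freeSec X m x

lemma barδ_barSec_zero (x : (N.barTerm 0).obj X m) :
    (N.barδ 0).app X (add_zero m) (N.barSec 0 X m x) =
      x - N.barSec₀ X m (N.barε.app X (add_zero m) x) := N.barD_succ_freeSec 0 X m x

lemma barδ_barSec_succ (i : ℕ) (x : (N.barTerm (i + 1)).obj X m) :
    (N.barδ (i + 1)).app X (add_zero m) (N.barSec (i + 1) X m x) =
      x - N.barSec i X m ((N.barδ i).app X (add_zero m) x) := N.barD_succ_freeSec (i + 1) X m x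

end

section

variable {M N P : DGMod A}

/-- The morphisms of bar complexes induced by a graded morphism. -/
noncomputable def barTermMap {p : ℤ} (n : ℕ) :
    GHom M N p →ₗ[k] GHom (M.barTerm n) (N.barTerm n) p := freeMap ∘ₗ iterFreeMap n

lemma D_barTermMap {p p' : ℤ} (h : p + 1 = p') (f : GHom M N p) (n : ℕ) :
    D h (barTermMap n f) = barTermMap n (D h f) := D_iterFreeMap h f (n + 1)

lemma barTermMap_comp {p q r : ℤ} (h : p + q = r) (f : GHom M N p) (g : GHom N P q) (n : ℕ) :
    barTermMap n (comp h f g) = comp h (barTermMap n f) (barTermMap n g) :=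
  iterFreeMap_comp h f g (n + 1)

lemma barTermMap_id (n : ℕ) : barTermMap n (GHom.id M) = GHom.id (M.barTerm n) :=
  iterFreeMap_id (n + 1)

lemma barTermMap_barε {p : ℤ} (f : GHom M N p) :
    comp (add_zero p) (barTermMap 0 f) N.barε = comp (zero_add p) M.barε f := iterFreeMap_barD f 0

lemma barTermMap_barδ {p : ℤ} (f : GHom M N p) (n : ℕ) :
    comp (add_zero p) (barTermMap (n + 1) f) (N.barδ n) =
      comp (zero_add p) (M.barδ n) (barTermMap n f) := iterFreeMap_barD f (n + 1)

lemma barTermMap_barSec₀ {p : ℤ} (f : GHom M N p) (X : A.Obj) {m n : ℤ} (h : m + p = n)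
    (x : M.obj X m) :
    (barTermMap 0 f).app X h (M.barSec₀ X m x) = N.barSec₀ X n (f.app X h x) :=
  freeMap_freeSec f X h x

lemma barTermMap_barSec {p : ℤ} (f : GHom M N p) (i : ℕ) (X : A.Obj) {m n : ℤ} (h : m + p = n)
    (x : (M.barTerm i).obj X m) :
    (barTermMap (i + 1) f).app X h (M.barSec i X m x) =
      N.barSec i X n ((barTermMap i f).app X h x) :=
  freeMap_freeSec (barTermMap i f) X h x

end

/-- The bar resolution. -/
noncomputable def bar (N : DGMod A) : DGMod A := N.barComplex.tot

lemma hProjective_bar (N : DGMod A) : N.bar.HProjective :=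
  N.barComplex.hProjective_tot fun n => (N.iterFree n).hProjective_free

/-- The inclusion of a term in the bar resolution. -/
noncomputable def barι (N : DGMod A) (n : ℕ) : GHom (N.barTerm n) N.bar (-n) :=
  N.barComplex.ι n

lemma bar_hom_ext {N E : DGMod A} {p : ℤ} {f g : GHom N.bar E p}
    (H : ∀ n, comp rfl (N.barι n) f = comp rfl (N.barι n) g) : f = g :=
  N.barComplex.tot_hom_ext H

/-- The graded morphism out of the bar resolution given by its components. -/
noncomputable def barDesc {N E : DGMod A} {p : ℤ} (f : ∀ n : ℕ, GHom (N.barTerm n) E (-n + p)) :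
    GHom N.bar E p := N.barComplex.desc f

lemma barι_barDesc {N E : DGMod A} {p : ℤ} (f : ∀ n : ℕ, GHom (N.barTerm n) E (-n + p)) (n : ℕ) :
    comp rfl (N.barι n) (barDesc f) = f n := N.barComplex.ι_desc f n

lemma D_barι_zero (N : DGMod A) {r : ℤ} (h : -((0 : ℕ) : ℤ) + 1 = r) : D h (N.barι 0) = 0 :=
  N.barComplex.D_ι_zero h

lemma D_barι_succ (N : DGMod A) (n : ℕ) {r : ℤ} (h : -((n + 1 : ℕ) : ℤ) + 1 = r) :
    D h (N.barι (n + 1)) = comp (show 0 + -(n : ℤ) = r by omega) (N.barδ n) (N.barι n) :=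
  N.barComplex.D_ι_succ n h

lemma D_barι_zero_comp {N E : DGMod A} {p p' q q' : ℤ} (f : GHom N.bar E p) (hp : p + 1 = p')
    (hq : -((0 : ℕ) : ℤ) + p = q) (hq' : q + 1 = q') :
    D hq' (comp hq (N.barι 0) f) = comp (by omega) (N.barι 0) (D hp f) :=
  N.barComplex.D_ι_zero_comp f hp hq hq'

lemma D_barι_succ_comp {N E : DGMod A} {p p' q q' s : ℤ} (n : ℕ) (f : GHom N.bar E p)
    (hp : p + 1 = p') (hq : -((n + 1 : ℕ) : ℤ) + p = q) (hq' : q + 1 = q')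
    (hs : -(n : ℤ) + p = s) :
    D hq' (comp hq (N.barι (n + 1)) f) = comp (by omega) (N.barι (n + 1)) (D hp f) +
      p.negOnePow • comp (show 0 + s = q' by omega) (N.barδ n) (comp hs (N.barι n) f) :=
  N.barComplex.D_ι_succ_comp n f hp hq hq' hs

/-- The components of the augmentation of the bar resolution. -/
noncomputable def barAugComp (N : DGMod A) : ∀ n : ℕ, GHom (N.barTerm n) N (-n + 0)
  | 0 => comp (show 0 + 0 = -((0 : ℕ) : ℤ) + 0 by omega) N.barε (GHom.id N)
  | _ + 1 => 0

/-- The augmentation of the bar resolution. -/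
noncomputable def barAug (N : DGMod A) : GHom N.bar N 0 := barDesc N.barAugComp

lemma barι_zero_barAug (N : DGMod A) {r : ℤ} (h : -((0 : ℕ) : ℤ) + 0 = r) :
    comp h (N.barι 0) N.barAug = comp (show 0 + 0 = r by omega) N.barε (GHom.id N) := by
  obtain rfl := h
  exact barι_barDesc _ 0

lemma barι_succ_barAug (N : DGMod A) (n : ℕ) {r : ℤ} (h : -((n + 1 : ℕ) : ℤ) + 0 = r) :
    comp h (N.barι (n + 1)) N.barAug = 0 := by
  obtain rfl := h
  exact barι_barDesc _ (n + 1)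

lemma D_barAug (N : DGMod A) : D (zero_add 1) N.barAug = 0 := by
  refine bar_hom_ext fun n => ?_
  rw [map_zero]
  cases n with
  | zero =>
    rw [← D_barι_zero_comp N.barAug (zero_add 1) rfl (show -((0 : ℕ) : ℤ) + 0 + 1 = _ by omega),
      barι_zero_barAug, D_comp_of_closed_left _ (zero_add 1) _ (N.D_barε rfl), D_ofHom, map_zero]
  | succ n =>
    have h₁ := D_barι_succ_comp n N.barAug (zero_add 1) rfl
      (show -((n + 1 : ℕ) : ℤ) + 0 + 1 = -((n + 1 : ℕ) : ℤ) + 1 by omega) rfl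
    rw [barι_succ_barAug, map_zero] at h₁
    refine (add_eq_zero_iff_eq_neg.1 h₁.symm).trans ?_
    rw [neg_eq_zero, Int.negOnePow_zero, one_smul]
    cases n with
    | zero =>
      rw [barι_zero_barAug, ← comp_assoc (zero_add 0)
        (show 0 + 0 = -((0 + 1 : ℕ) : ℤ) + 1 by omega), barδ_barε]
      simp
    | succ n => rw [barι_succ_barAug, map_zero]

section

variable {M N P : DGMod A}

/-- The components of the morphism of bar resolutions induced by a graded morphism. -/
noncomputable def barMapComp {p : ℤ} (n : ℕ) : GHom M N p →ₗ[k] GHom (M.barTerm n) N.bar (-n + p) :=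
  -- Koszul sign for moving a morphism of degree `p` past the inclusion of the `n`-th term, which
  -- has degree `-n`.
  ((n * p).negOnePow : ℤ) •
    ((comp (show p + -(n : ℤ) = -n + p by omega)).flip (N.barι n) ∘ₗ barTermMap n)

/-- The morphism of bar resolutions induced by a graded morphism. -/
noncomputable def barMap {p : ℤ} : GHom M N p →ₗ[k] GHom M.bar N.bar p where
  toFun f := barDesc fun n => barMapComp n f
  map_add' f g := bar_hom_ext fun n => by
    rw [map_add, barι_barDesc, barι_barDesc, barι_barDesc, map_add]
  map_smul' c f := bar_hom_ext fun n => by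
    rw [map_smul, barι_barDesc, barι_barDesc, map_smul, RingHom.id_apply]

lemma barι_barMap {p r : ℤ} (f : GHom M N p) (n : ℕ) (h : -(n : ℤ) + p = r) :
    comp h (M.barι n) (barMap f) = (n * p).negOnePow •
      comp (show p + -(n : ℤ) = r by omega) (barTermMap n f) (N.barι n) := by
  obtain rfl := h
  exact barι_barDesc _ n

/-- With the sign `(-1) ^ (n p)` the two terms containing `δ` cancel, and differentiating past `barι
n` turns `(-1) ^ (n p)` into `(-1) ^ (n (p + 1))`. Together with `barMap_comp` and `barMap_id` this
makes the bar resolution a dg functor, as needed to resolve a bimodule. -/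
lemma D_barMap {p p' : ℤ} (h : p + 1 = p') (f : GHom M N p) :
    D h (barMap f) = barMap (D h f) := by
  refine bar_hom_ext fun n => ?_
  rw [barι_barMap]
  cases n with
  | zero =>
    rw [← D_barι_zero_comp (barMap f) h rfl (show -((0 : ℕ) : ℤ) + p + 1 = _ by omega),
      barι_barMap, D_units_smul, D_comp _ h rfl, D_barι_zero, map_zero, zero_add, D_barTermMap]
    simp
  | succ n =>
    have h₁ := D_barι_succ_comp n (barMap f) h rfl
      (show -((n + 1 : ℕ) : ℤ) + p + 1 = -((n + 1 : ℕ) : ℤ) + p' by omega) rfl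
    rw [barι_barMap, barι_barMap, D_units_smul, D_comp _ h rfl _ _ (N.barι (n + 1)), D_barι_succ,
      D_barTermMap, comp_units_smul, smul_add,
      ← comp_assoc (zero_add p) (show p + -(n : ℤ) = -((n + 1 : ℕ) : ℤ) + p' by omega)
        (show p + -(n : ℤ) = -n + p by omega) (show 0 + (-(n : ℤ) + p) = -((n + 1 : ℕ) : ℤ) + p' by omega),
      ← barTermMap_barδ,
      comp_assoc (add_zero p) (show p + -(n : ℤ) = -((n + 1 : ℕ) : ℤ) + p' by omega)
        (zero_add (-(n : ℤ)))
        (show p + -(n : ℤ) = -((n + 1 : ℕ) : ℤ) + p' by omega), smul_smul, smul_smul,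
      ← Int.negOnePow_add, ← Int.negOnePow_add] at h₁
    have e₁ : p + (n : ℤ) * p = ((n + 1 : ℕ) : ℤ) * p := by push_cast; ring
    have e₂ : (((n + 1 : ℕ) : ℤ) * p + -((n + 1 : ℕ) : ℤ)).negOnePow =
        (((n + 1 : ℕ) : ℤ) * p').negOnePow := by
      rw [← h, mul_add, mul_one, Int.negOnePow_add, Int.negOnePow_neg, ← Int.negOnePow_add]
    rw [e₁, e₂] at h₁
    exact (add_right_cancel ((add_comm _ _).trans h₁)).symm

lemma barMap_comp {p q r : ℤ} (h : p + q = r) (f : GHom M N p) (g : GHom N P q) :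
    barMap (comp h f g) = comp h (barMap f) (barMap g) := by
  refine bar_hom_ext fun n => ?_
  rw [barι_barMap, ← comp_assoc rfl (show -(n : ℤ) + p + q = -n + r by omega), barι_barMap,
    units_smul_comp, comp_assoc _ _ (show -(n : ℤ) + q = -n + q from rfl)
      (show p + (-(n : ℤ) + q) = -n + r by omega), barι_barMap,
    comp_units_smul, smul_smul, barTermMap_comp,
    comp_assoc h _ (show q + -(n : ℤ) = -n + q by omega)
      (show p + (-(n : ℤ) + q) = -n + r by omega), ← Int.negOnePow_add, ← mul_add, h]

lemma barMap_id (M : DGMod A) : barMap (GHom.id M) = GHom.id M.bar := by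
  refine bar_hom_ext fun n => ?_
  rw [barι_barMap, barTermMap_id, mul_zero, Int.negOnePow_zero, one_smul]
  refine GHom.ext fun X i j e x => ?_
  rw [GHom.comp_app _ _ _ X e (add_zero i),
    GHom.comp_app _ _ _ X e (show i + -(n : ℤ) = j by omega)]
  rfl

lemma barMap_barAug {p : ℤ} (f : GHom M N p) :
    comp (add_zero p) (barMap f) N.barAug = comp (zero_add p) M.barAug f := by
  refine bar_hom_ext fun n => ?_
  rw [← comp_assoc rfl (show -(n : ℤ) + p + 0 = -n + p by omega), barι_barMap, units_smul_comp,
    comp_assoc _ _ rfl (show p + (-(n : ℤ) + 0) = -n + p by omega),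
    ← comp_assoc rfl (show -(n : ℤ) + 0 + p = -n + p by omega)]
  cases n with
  | zero =>
    rw [barι_zero_barAug, barι_zero_barAug,
      comp_assoc _ _ (zero_add p) (show 0 + p = -((0 : ℕ) : ℤ) + p by omega), id_comp,
      ← comp_assoc (add_zero p) (show p + 0 = -((0 : ℕ) : ℤ) + p by omega), barTermMap_barε,
      comp_assoc (zero_add p) _ (add_zero p) (show 0 + p = -((0 : ℕ) : ℤ) + p by omega), comp_id]
    simp
  | succ n => rw [barι_succ_barAug, barι_succ_barAug]; simp

end

/-- The augmentation of the bar resolution as a morphism. -/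
noncomputable def barπ (N : DGMod A) : N.bar ⟶ N := toHom N.barAug N.D_barAug

lemma bar_linear_ext {N : DGMod A} {V : Type*} [AddCommGroup V] [Module k V] {X : A.Obj} {i : ℤ}
    {f g : N.bar.obj X i →ₗ[k] V}
    (H : ∀ (n : ℕ) (m : ℤ) (h : m + -n = i) (x : (N.barTerm n).obj X m),
      f ((N.barι n).app X h x) = g ((N.barι n).app X h x)) : f = g :=
  N.barComplex.tot_linear_ext H

section

variable (N : DGMod A) (X : A.Obj)

/-- The section of the augmentation of the bar resolution. -/
noncomputable def barη (m : ℤ) : N.obj X m →ₗ[k] N.bar.obj X m :=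
  (N.barι 0).app X (show m + -((0 : ℕ) : ℤ) = m by omega) ∘ₗ N.barSec₀ X m

/-- The contraction of the bar resolution. -/
noncomputable def barH {m n : ℤ} (h : m + 1 = n) : N.bar.obj X n →ₗ[k] N.bar.obj X m :=
  N.barComplex.totLift fun i j e =>
    (N.barι (i + 1)).app X (show j + -((i + 1 : ℕ) : ℤ) = m by omega) ∘ₗ N.barSec i X j

lemma barH_ι {m n : ℤ} (h : m + 1 = n) {i : ℕ} {j : ℤ} (e : j + -(i : ℤ) = n)
    (x : (N.barTerm i).obj X j) : N.barH X h ((N.barι i).app X e x) =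
      (N.barι (i + 1)).app X (show j + -((i + 1 : ℕ) : ℤ) = m by omega) (N.barSec i X j x) :=
  N.barComplex.totLift_ι _ e x

lemma d_barι_zero {m n j j' : ℤ} (h : m + 1 = n) (e : j + -((0 : ℕ) : ℤ) = m) (hj : j + 1 = j')
    (x : (N.barTerm 0).obj X j) : N.bar.d X h ((N.barι 0).app X e x) =
      (N.barι 0).app X (show j' + -((0 : ℕ) : ℤ) = n by omega) ((N.barTerm 0).d X hj x) := by
  have h₁ := congrArg (fun f => f.app X (show j + (-((0 : ℕ) : ℤ) + 1) = n by omega) x)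
    (N.D_barι_zero rfl)
  have h₂ := D_app rfl (N.barι 0) X (show j + (-((0 : ℕ) : ℤ) + 1) = n by omega) hj h x
  have h₃ := sub_eq_zero.1 (h₂.symm.trans h₁)
  rw [h₃]
  simp

lemma d_barι_succ {m n j j' : ℤ} (i : ℕ) (h : m + 1 = n) (e : j + -((i + 1 : ℕ) : ℤ) = m)
    (hj : j + 1 = j') (x : (N.barTerm (i + 1)).obj X j) :
    N.bar.d X h ((N.barι (i + 1)).app X e x) =
      (N.barι i).app X (show j + -(i : ℤ) = n by omega) ((N.barδ i).app X (add_zero j) x) +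
      ((i + 1 : ℕ) : ℤ).negOnePow • (N.barι (i + 1)).app X
        (show j' + -((i + 1 : ℕ) : ℤ) = n by omega) ((N.barTerm (i + 1)).d X hj x) := by
  have h₁ := congrArg (fun f => f.app X (show j + (-((i + 1 : ℕ) : ℤ) + 1) = n by omega) x)
    (N.D_barι_succ i rfl)
  have h₂ := D_app rfl (N.barι (i + 1)) X (show j + (-((i + 1 : ℕ) : ℤ) + 1) = n by omega) hj h x
  have h₃ := sub_eq_iff_eq_add.1 (h₂.symm.trans h₁)
  rw [h₃, GHom.comp_app _ _ _ X _ (add_zero j), Int.negOnePow_neg]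

lemma d_barη {m n : ℤ} (h : m + 1 = n) (y : N.obj X m) :
    N.bar.d X h (N.barη X m y) = N.barη X n (N.d X h y) := by
  refine (N.d_barι_zero X h (show m + -((0 : ℕ) : ℤ) = m by omega) h _).trans ?_
  rw [d_barSec₀]
  rfl

lemma barAug_barι_zero {m n : ℤ} (e : m + -((0 : ℕ) : ℤ) = n) (x : (N.barTerm 0).obj X m) :
    N.barAug.app X (add_zero n) ((N.barι 0).app X e x) =
      N.barε.app X (show m + 0 = n by omega) x := by
  have := congrArg (fun f => f.app X (show m + (-((0 : ℕ) : ℤ) + 0) = n by omega) x)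
    (N.barι_zero_barAug rfl)
  refine (GHom.comp_app _ _ _ X _ e x).symm.trans (this.trans ?_)
  refine (GHom.comp_app _ _ _ X _ (add_zero m) x).trans ?_
  obtain rfl : m = n := by omega
  rfl

lemma barAug_barι_succ {m n : ℤ} (i : ℕ) (e : m + -((i + 1 : ℕ) : ℤ) = n)
    (x : (N.barTerm (i + 1)).obj X m) :
    N.barAug.app X (add_zero n) ((N.barι (i + 1)).app X e x) = 0 := by
  have := congrArg (fun f => f.app X (show m + (-((i + 1 : ℕ) : ℤ) + 0) = n by omega) x)
    (N.barι_succ_barAug i rfl)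
  exact (GHom.comp_app _ _ _ X _ e x).symm.trans this

lemma barπ_barη (m : ℤ) (y : N.obj X m) : N.barπ.app X m (N.barη X m y) = y :=
  (N.barAug_barι_zero X (show m + -((0 : ℕ) : ℤ) = m by omega) _).trans (N.barε_barSec₀ X y)

/-- By the extra degeneracy relations, the terms in `δ` leave the identity minus the section of the
augmentation. The terms in the internal differential cancel, since they carry `(-1) ^ (i + 1)` and
`(-1) ^ i`. -/
lemma d_barH {l m n : ℤ} (h : l + 1 = m) (h' : m + 1 = n) (x : N.bar.obj X m) :
    N.bar.d X h (N.barH X h x) + N.barH X h' (N.bar.d X h' x) =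
      x - N.barη X m (N.barπ.app X m x) := by
  refine LinearMap.congr_fun (bar_linear_ext (f := N.bar.d X h ∘ₗ N.barH X h +
    N.barH X h' ∘ₗ N.bar.d X h') (g := LinearMap.id - N.barη X m ∘ₗ N.barπ.app X m)
    fun i j e y => ?_) x
  simp only [LinearMap.add_apply, LinearMap.comp_apply, LinearMap.sub_apply, LinearMap.id_apply]
  have hπ := toHom_app N.barAug N.D_barAug X m ((N.barι i).app X e y)
  rw [barH_ι, d_barι_succ N X i h _ rfl, d_barSec]
  cases i with
  | zero =>
    rw [d_barι_zero N X h' e rfl, barH_ι, barδ_barSec_zero, map_sub]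
    have h₁ : N.barη X m (N.barπ.app X m ((N.barι 0).app X e y)) =
        (N.barι 0).app X e (N.barSec₀ X j (N.barε.app X (add_zero j) y)) := by
      obtain rfl : j = m := by omega
      exact congrArg (N.barη X j) (N.barAug_barι_zero X e y)
    rw [h₁]
    simp
  | succ i =>
    rw [d_barι_succ N X i h' e rfl, map_add, map_units_smul, barH_ι, barH_ι, barδ_barSec_succ,
      map_sub]
    have h₁ : N.barη X m (N.barπ.app X m ((N.barι (i + 1)).app X e y)) = 0 :=
      (congrArg (N.barη X m) (N.barAug_barι_succ X i e y)).trans (map_zero _)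
    have h₂ : ((i + 1 + 1 : ℕ) : ℤ).negOnePow = - ((i + 1 : ℕ) : ℤ).negOnePow := by
      rw [Nat.cast_succ, Int.negOnePow_succ]
    rw [h₁, h₂, Units.neg_smul]
    abel

lemma isQuasiIso_barπ : IsQuasiIso N.barπ :=
  isQuasiIso_of_contraction N.barπ N.barη N.barH (fun X _ _ h y => N.d_barη X h y)
    (fun X n y => N.barπ_barη X n y) fun X _ _ _ h h' x => N.d_barH X h h' x

/-- The bar resolution is an h-projective resolution. -/
noncomputable def barResolution : HProjResolution N where
  P := N.bar
  π := N.barπ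
  hProjective := N.hProjective_bar
  isQuasiIso := N.isQuasiIso_barπ

variable {N}

lemma barMap_barη {M : DGMod A} {p : ℤ} (f : GHom M N p) {m n : ℤ} (h : m + p = n) (x : M.obj X m) :
    (barMap f).app X h (M.barη X m x) = N.barη X n (f.app X h x) := by
  have := congrArg (fun g => g.app X (show m + (-((0 : ℕ) : ℤ) + p) = n by omega) (M.barSec₀ X m x))
    (barι_barMap f 0 rfl)
  refine (GHom.comp_app _ _ _ X _ (show m + -((0 : ℕ) : ℤ) = m by omega) _).symm.trans
    (this.trans ?_)
  simp only [GHom.units_smul_app]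
  rw [GHom.comp_app _ _ _ X _ h, barTermMap_barSec₀]
  simp [barη]

/-- The contraction has degree `-1`, whence the sign `(-1) ^ p`. Naturality in this graded sense is
what lets the contraction descend to tensor products over `B`. -/
lemma barMap_barH {M : DGMod A} {p : ℤ} (f : GHom M N p) {m m' n n' : ℤ} (h : m + 1 = n)
    (h' : m' + 1 = n') (hp : m + p = m') (x : M.bar.obj X n) :
    N.barH X h' ((barMap f).app X (show n + p = n' by omega) x) =
      p.negOnePow • (barMap f).app X hp (M.barH X h x) := by
  refine LinearMap.congr_fun (bar_linear_ext (f := N.barH X h' ∘ₗ (barMap f).app X _)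
    (g := p.negOnePow • ((barMap f).app X hp ∘ₗ M.barH X h)) fun i j e y => ?_) x
  simp only [LinearMap.smul_apply, LinearMap.comp_apply]
  have key (i : ℕ) {j n n' : ℤ} (e : j + -(i : ℤ) = n) (hn : n + p = n')
      (y : (M.barTerm i).obj X j) : (barMap f).app X hn ((M.barι i).app X e y) =
      (i * p).negOnePow • (N.barι i).app X (show j + p + -(i : ℤ) = n' by omega)
        ((barTermMap i f).app X rfl y) := by
    have := congrArg (fun g => g.app X (show j + (-(i : ℤ) + p) = n' by omega) y)
      (barι_barMap f i rfl)
    refine (GHom.comp_app _ _ _ X _ e _).symm.trans (this.trans ?_)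
    simp only [GHom.units_smul_app]
    rw [GHom.comp_app _ _ _ X _ rfl]
  have hs : (p + ((i + 1 : ℕ) : ℤ) * p).negOnePow = (i * p).negOnePow := by
    rw [show p + ((i + 1 : ℕ) : ℤ) * p = i * p + (p + p) by push_cast; ring, Int.negOnePow_add,
      Int.negOnePow_add p p, Int.units_mul_self, mul_one]
  rw [key, map_units_smul, barH_ι, barH_ι, key, barTermMap_barSec, smul_smul,
    ← Int.negOnePow_add, hs]

end

end DGMod

end DG

/-! ### Perfect modules: cones and derived tensor products -/

namespace DG

open DGMod GHom

variable {k : Type u} [Field k]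

namespace DGMod

variable {A : DGCat.{u} k}

/-! ### Perfect dg modules and cones -/

lemma perfect_iff_cpt {P : DGMod A} (hP : P.HProjective) : P.Perfect ↔ P.Cpt :=
  ⟨Perfect.cpt hP barResolution, Cpt.perfect hP barResolution⟩

lemma HProjResolution.perfect_iff {N : DGMod A} (R : HProjResolution N) : N.Perfect ↔ R.P.Cpt :=
  (perfect_iff_of_isQuasiIso R.isQuasiIso).symm.trans (perfect_iff_cpt R.hProjective)

/-- The morphism of cones induced by a commutative square. -/
def coneMap {M N M' N' : DGMod A} {f : M ⟶ N} {f' : M' ⟶ N'} (p : M ⟶ M') (q : N ⟶ N')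
    (w : f ≫ q = p ≫ f') : cone f ⟶ cone f' where
  app X n := LinearMap.prodMap (p.app X (n + 1)) (q.app X n)
  app_d {X m n} h x := by
    subst h
    obtain ⟨x, y⟩ := x
    have h₁ : q.app X _ (f.app X _ x) = f'.app X _ (p.app X _ x) :=
      congrArg (fun g => Hom.app g X _ x) w
    refine Prod.ext (show p.app X _ (-M.d X rfl x) = -M'.d X rfl (p.app X _ x) by
      rw [map_neg, p.app_d]) ?_
    change q.app X _ (f.app X _ x + N.d X rfl y) = f'.app X _ (p.app X _ x) + N'.d X rfl (q.app X _ y)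
    rw [map_add, h₁, q.app_d]
  app_act h x a := Prod.ext (p.app_act _ x.1 a) (q.app_act h x.2 a)

/-- The five lemma for the cohomology sequences of the two cones, carried out on elements. Since the
square commutes strictly, the component on the shift of `M` is corrected first, then the one on `N`.
-/
lemma isQuasiIso_coneMap {M N M' N' : DGMod A} {f : M ⟶ N} {f' : M' ⟶ N'} {p : M ⟶ M'}
    {q : N ⟶ N'} (w : f ≫ q = p ≫ f') (hp : IsQuasiIso p) (hq : IsQuasiIso q) :
    IsQuasiIso (coneMap p q w) := by
  have hw (X : A.Obj) (n : ℤ) (x : M.obj X n) :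
      q.app X n (f.app X n x) = f'.app X n (p.app X n x) := congrArg (fun g => Hom.app g X n x) w
  rintro X l m n rfl rfl
  constructor
  · rintro ⟨x, y⟩ hxy ⟨⟨x', y'⟩, h⟩
    have h₁ : M.d X rfl x = 0 := neg_eq_zero.1 (congrArg Prod.fst hxy)
    have h₂ : f.app X _ x + N.d X rfl y = 0 := congrArg Prod.snd hxy
    have h₃ : - M'.d X rfl x' = p.app X _ x := congrArg Prod.fst h
    have h₄ : f'.app X _ x' + N'.d X rfl y' = q.app X _ y := congrArg Prod.snd h
    obtain ⟨z, hz⟩ := (hp X (l + 1) (l + 1 + 1) _ rfl rfl).1 x h₁ ⟨-x', by rw [map_neg, h₃]⟩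
    obtain ⟨z', t, hz', ht⟩ := (hp X l (l + 1) (l + 1 + 1) rfl rfl).2 (x' + p.app X _ z) (by
      rw [map_add, ← p.app_d, hz, ← h₃, add_neg_cancel])
    obtain ⟨v, hv⟩ := (hq X l (l + 1) (l + 1 + 1) rfl rfl).1 (y + f.app X _ z - f.app X _ z') (by
        rw [map_sub, map_add, ← f.app_d, ← f.app_d, hz, hz', map_zero, sub_zero]
        exact (add_comm _ _).trans h₂)
      ⟨y' + f'.app X _ t, by
        rw [map_add, map_sub, map_add, hw, hw, ← h₄, ← f'.app_d, add_right_comm, ← map_add, ht,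
          map_add]
        abel⟩
    refine ⟨((z' - z : M.obj X (l + 1)), v), Prod.ext (show -M.d X rfl (z' - z) = x by
      rw [map_sub, hz', hz, zero_sub, neg_neg]) (show f.app X _ (z' - z) + N.d X rfl v = y by
      rw [hv, map_sub]; abel)⟩
  · rintro ⟨x, y⟩ hxy
    have h₁ : M'.d X rfl x = 0 := neg_eq_zero.1 (congrArg Prod.fst hxy)
    have h₂ : f'.app X _ x + N'.d X rfl y = 0 := congrArg Prod.snd hxy
    obtain ⟨z, t, hz, hx⟩ := (hp X (l + 1) (l + 1 + 1) _ rfl rfl).2 x h₁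
    obtain ⟨v, hv⟩ := (hq X (l + 1) (l + 1 + 1) _ rfl rfl).1 (-f.app X _ z) (by
        rw [map_neg, ← f.app_d, hz, map_zero, neg_zero])
      ⟨y + f'.app X _ t, by
        rw [map_neg, hw, map_add, ← f'.app_d, eq_sub_of_add_eq hx.symm, map_sub]
        rw [eq_neg_of_add_eq_zero_right h₂]
        abel⟩
    obtain ⟨s, r, hs, hr⟩ := (hq X l (l + 1) (l + 1 + 1) rfl rfl).2
      (y + f'.app X _ t - q.app X _ v) (by
        rw [map_sub, map_add, ← q.app_d, hv, map_neg, hw, ← f'.app_d, eq_sub_of_add_eq hx.symm,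
          map_sub, eq_neg_of_add_eq_zero_right h₂]
        abel)
    refine ⟨((z : M.obj X (l + 1 + 1)), (v + s : N.obj X (l + 1))),
      ((-t : M'.obj X (l + 1)), (r : N'.obj X l)), Prod.ext (show -M.d X rfl z = 0 by
        rw [hz, neg_zero]) (show f.app X _ z + N.d X rfl (v + s) = 0 by
        rw [map_add, hv, hs]; abel), Prod.ext
      (show x = p.app X _ z + -M'.d X rfl (-t) by rw [map_neg, neg_neg]; exact hx)
      (show y = q.app X _ (v + s) + (f'.app X _ (-t) + N'.d X rfl r) by
        rw [map_add, map_neg, eq_sub_of_add_eq' hr.symm]; abel)⟩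

/-- The morphism of bar resolutions induced by a morphism. -/
noncomputable def barHom {M N : DGMod A} (f : M ⟶ N) : M.bar ⟶ N.bar :=
  toHom (barMap (ofHom f)) (by rw [D_barMap, D_ofHom, map_zero])

lemma barHom_barπ {M N : DGMod A} (f : M ⟶ N) : barHom f ≫ N.barπ = M.barπ ≫ f := by
  apply ofHom_injective
  rw [ofHom_comp, ofHom_comp, barHom, ofHom_toHom, barπ, ofHom_toHom, barπ, ofHom_toHom]
  exact barMap_barAug (ofHom f)

/-- If the source of a morphism is perfect, its cone is perfect if and only if its target is. -/
lemma perfect_cone_iff {M N : DGMod A} (f : M ⟶ N) (hM : M.Perfect) :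
    (cone f).Perfect ↔ N.Perfect := by
  -- Replacing `f` by the induced morphism of bar resolutions makes source, target and cone
  -- h-projective; the cone is then a graded split extension, to which the two-out-of-three lemmas
  -- for `Perp` apply.
  have hM := M.barResolution.perfect_iff.1 hM
  have hc : (cone (barHom f)).HProjective :=
    .middle (coneSplit _) M.hProjective_bar N.hProjective_bar
  rw [← perfect_iff_of_isQuasiIso (isQuasiIso_coneMap (barHom_barπ f) M.isQuasiIso_barπ
    N.isQuasiIso_barπ), perfect_iff_cpt hc, N.barResolution.perfect_iff]
  exact ⟨fun h J E => (coneSplit (barHom f)).perp_right (hM J E) (h J E),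
    fun h J E => (coneSplit (barHom f)).perp_middle (hM J E) (h J E)⟩

end DGMod

namespace DGBimod

variable {A B : DGCat.{u} k}

/-! ### Graded maps of bimodules -/

section

variable {φ ψ : DGBimod B A}

/-- The linear map `m ⊗ x ↦ (-1) ^ (p |m|) m ⊗ u x` for a graded linear map `u` of degree `p`
which commutes with the left action. -/
noncomputable def tensorRightApp (P : DGMod B) (X : A.Obj) {p : ℤ}
    (u : ∀ (Y : B.Obj) {i j : ℤ}, i + p = j → (φ.obj X Y i →ₗ[k] ψ.obj X Y j))
    (hu : ∀ {Y Y' : B.Obj} {i j j' l l' : ℤ} (h : i + j = l) (hj : j + p = j') (hl : l + p = l')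
      (b : B.Hom Y Y' i) (x : φ.obj X Y j), u Y' hl (φ.lact h b x) =
        (p * i).negOnePow • ψ.lact (show i + j' = l' by omega) b (u Y hj x))
    {n n' : ℤ} (hn : n + p = n') : φ.Tensor P X n →ₗ[k] ψ.Tensor P X n' :=
  φ.tensorLift (fun Y i j e => ((p * i).negOnePow : ℤ) •
    (ψ.tmk P X (show i + (j + p) = n' by omega)).compl₂ (u Y rfl)) (by
      intro Y Y' i j l ij jl h₁ h₂ h₃ h₄ m b x
      have h₅ := hu h₃ (rfl : l + p = _) (rfl : jl + p = _) b x
      have h₆ := ψ.tmk_act P X h₁ (show ij + (l + p) = n' by omega)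
        (show j + (l + p) = jl + p by omega) (show i + (jl + p) = n' by omega) m b (u Y rfl x)
      simp only [LinearMap.smul_apply, LinearMap.compl₂_apply, h₅, h₆, map_units_smul]
      rw [← Units.smul_def, ← Units.smul_def, smul_smul, ← Int.negOnePow_add, ← mul_add, h₁])

lemma tensorRightApp_tmk (P : DGMod B) (X : A.Obj) {p : ℤ}
    (u : ∀ (Y : B.Obj) {i j : ℤ}, i + p = j → (φ.obj X Y i →ₗ[k] ψ.obj X Y j)) (hu)
    {n n' : ℤ} (hn : n + p = n') {Y : B.Obj} {i j j' : ℤ} (e : i + j = n) (hj : j + p = j')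
    (m : P.obj Y i) (x : φ.obj X Y j) :
    tensorRightApp P X u hu hn (φ.tmk P X e m x) =
      (p * i).negOnePow • ψ.tmk P X (show i + j' = n' by omega) m (u Y hj x) := by
  subst hj
  rw [tensorRightApp, tensorLift_tmk]
  rfl

end

variable (φ : DGBimod B A)

/-- The bimodule of bar resolutions. -/
@[reducible]
noncomputable def bar : DGBimod B A where
  obj X Y n := (φ.right Y).bar.obj X n
  d X Y _ _ h := (φ.right Y).bar.d X h
  d_d X Y _ _ _ h h' x := (φ.right Y).bar.d_d X h h' x
  ract {_ _ Y _ _ _} h := (φ.right Y).bar.act h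
  ract_one {_ Y _} x := (φ.right Y).bar.act_one x
  ract_ract {_ _ _ Y _ _ _ _ _ _} h₁ h₂ h₃ h₄ x g f := (φ.right Y).bar.act_act h₁ h₂ h₃ h₄ x g f
  d_ract {_ _ Y _ _ _ _ _ _} h hi hj hn x f := (φ.right Y).bar.d_act h hi hj hn x f
  -- An element `b` of `B` acts by the bar functor applied to left multiplication by `b`; the
  -- bimodule axioms are the dg functoriality of `barMap`.
  lact {X Y Y' i j n} h := LinearMap.mk₂ k
    (fun b x => (barMap (φ.leftMul b)).app X (show j + i = n by omega) x)
    (fun _ _ _ => by rw [map_add, map_add]; rfl) (fun _ _ _ => by rw [map_smul, map_smul]; rfl)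
    (fun _ _ _ => map_add _ _ _) (fun _ _ _ => map_smul _ _ _)
  one_lact {X Y n} x := by
    simp only [LinearMap.mk₂_apply]
    rw [φ.leftMul_one, barMap_id]
    rfl
  lact_lact {X Y Y' Y'' i j l ij jl n} h₁ h₂ h₃ h₄ g f x := by
    simp only [LinearMap.mk₂_apply]
    rw [φ.leftMul_comp h₁ (show j + i = ij by omega), barMap_comp]
    exact GHom.comp_app _ _ _ X _ _ x
  d_lact {X Y Y' i i' j j' n n'} h hi hj hn g x := by
    simp only [LinearMap.mk₂_apply]
    rw [← φ.D_leftMul hi, ← D_barMap,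
      D_app hi _ X (show j + i' = n' by omega) hj hn, sub_add_cancel]
  lact_ract {X X' Y Y' i j l ij jl n} h₁ h₂ h₃ h₄ g x f := by
    simp only [LinearMap.mk₂_apply]
    exact ((barMap (φ.leftMul g)).app_act (show j + i = ij by omega) h₃ (show jl + i = n by omega) x f).symm

lemma hProjective_bar_right (Y : B.Obj) : (φ.bar.right Y).HProjective :=
  (φ.right Y).hProjective_bar

section

variable (X : A.Obj) (Y : B.Obj)

/-- The components of the augmentation of the bimodule of bar resolutions. -/
noncomputable def augApp (n : ℤ) : φ.bar.obj X Y n →ₗ[k] φ.obj X Y n := (φ.right Y).barπ.app X n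

/-- The section of the augmentation. -/
noncomputable def sectionApp (n : ℤ) : φ.obj X Y n →ₗ[k] φ.bar.obj X Y n := (φ.right Y).barη X n

/-- The contraction of the augmentation. -/
noncomputable def contractionApp {m n : ℤ} (h : m + 1 = n) :
    φ.bar.obj X Y n →ₗ[k] φ.bar.obj X Y m := (φ.right Y).barH X h

variable {X Y}

lemma augApp_d {m n : ℤ} (h : m + 1 = n) (x : φ.bar.obj X Y m) :
    φ.augApp X Y n (φ.bar.d X Y h x) = φ.d X Y h (φ.augApp X Y m x) :=
  (φ.right Y).barπ.app_d h x

lemma augApp_ract {X' : A.Obj} {i j n : ℤ} (h : i + j = n) (x : φ.bar.obj X' Y i)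
    (a : A.Hom X X' j) :
    φ.augApp X Y n (φ.bar.ract h x a) = φ.ract h (φ.augApp X' Y i x) a :=
  (φ.right Y).barπ.app_act h x a

lemma d_sectionApp {m n : ℤ} (h : m + 1 = n) (x : φ.obj X Y m) :
    φ.bar.d X Y h (φ.sectionApp X Y m x) = φ.sectionApp X Y n (φ.d X Y h x) :=
  (φ.right Y).d_barη X h x

lemma augApp_sectionApp (n : ℤ) (x : φ.obj X Y n) : φ.augApp X Y n (φ.sectionApp X Y n x) = x :=
  (φ.right Y).barπ_barη X n x

lemma d_contractionApp {l m n : ℤ} (h : l + 1 = m) (h' : m + 1 = n) (x : φ.bar.obj X Y m) :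
    φ.bar.d X Y h (φ.contractionApp X Y h x) + φ.contractionApp X Y h' (φ.bar.d X Y h' x) =
      x - φ.sectionApp X Y m (φ.augApp X Y m x) :=
  (φ.right Y).d_barH X h h' x

end

/-- The augmentation `P ⊗ φ.bar ⟶ P ⊗ φ`. -/
noncomputable def tensorBarπApp (P : DGMod B) (X : A.Obj) (n : ℤ) :
    φ.bar.Tensor P X n →ₗ[k] φ.Tensor P X n :=
  tensorRightApp (φ := φ.bar) (ψ := φ) P X (p := 0)
    (fun Y _ _ h => (φ.right Y).barAug.app X h) (by
      intro Y Y' i j j' l l' h hj hl b x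
      obtain rfl : j = j' := by omega
      obtain rfl : l = l' := by omega
      have := congrArg (fun f => f.app X (show j + i = l by omega) x) (barMap_barAug (φ.leftMul b))
      rw [zero_mul, Int.negOnePow_zero, one_smul]
      refine (GHom.comp_app (add_zero i) (barMap (φ.leftMul b)) (φ.right Y').barAug X
        (show j + i = l by omega) (show j + i = l by omega) x).symm.trans (this.trans ?_)
      exact GHom.comp_app (zero_add i) (φ.right Y).barAug (φ.leftMul b) X
        (show j + i = l by omega) hj x) (add_zero n)

lemma tensorBarπApp_tmk (P : DGMod B) (X : A.Obj) {n i j : ℤ} {Y : B.Obj} (e : i + j = n)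
    (m : P.obj Y i) (x : φ.bar.obj X Y j) :
    φ.tensorBarπApp P X n (φ.bar.tmk P X e m x) =
      φ.tmk P X e m (φ.augApp X Y j x) := by
  refine (tensorRightApp_tmk (φ := φ.bar) (ψ := φ) P X _ _ (add_zero n) e (add_zero j) m x).trans ?_
  rw [zero_mul, Int.negOnePow_zero, one_smul]
  rfl

/-- The section of the augmentation `P ⊗ φ.bar ⟶ P ⊗ φ`. -/
noncomputable def tensorBarη (P : DGMod B) (X : A.Obj) (n : ℤ) :
    φ.Tensor P X n →ₗ[k] φ.bar.Tensor P X n :=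
  tensorRightApp (φ := φ) (ψ := φ.bar) P X (p := 0)
    (fun Y i j h => (φ.right Y).bar.cast X (show i = j by omega) ∘ₗ (φ.right Y).barη X i) (by
      intro Y Y' i j j' l l' h hj hl b x
      obtain rfl : j = j' := by omega
      obtain rfl : l = l' := by omega
      rw [zero_mul, Int.negOnePow_zero, one_smul]
      exact (barMap_barη X (φ.leftMul b) (show j + i = l by omega) x).symm) (add_zero n)

lemma tensorBarη_tmk (P : DGMod B) (X : A.Obj) {n i j : ℤ} {Y : B.Obj} (e : i + j = n)
    (m : P.obj Y i) (x : φ.obj X Y j) :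
    φ.tensorBarη P X n (φ.tmk P X e m x) =
      φ.bar.tmk P X e m (φ.sectionApp X Y j x) := by
  refine (tensorRightApp_tmk (φ := φ) (ψ := φ.bar) P X _ _ (add_zero n) e (add_zero j) m x).trans ?_
  rw [zero_mul, Int.negOnePow_zero, one_smul]
  rfl

/-- The contraction of `P ⊗ φ.bar`. -/
noncomputable def tensorBarH (P : DGMod B) (X : A.Obj) {n n' : ℤ} (h : n' + 1 = n) :
    φ.bar.Tensor P X n →ₗ[k] φ.bar.Tensor P X n' :=
  tensorRightApp (φ := φ.bar) (ψ := φ.bar) P X (p := -1)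
    (fun Y i j h => (φ.right Y).barH X (show j + 1 = i by omega)) (by
      intro Y Y' i j j' l l' h hj hl b x
      rw [neg_one_mul, Int.negOnePow_neg]
      exact barMap_barH X (φ.leftMul b) (show j' + 1 = j by omega) (show l' + 1 = l by omega)
        (show j' + i = l' by omega) x) (show n + -1 = n' by omega)

lemma tensorBarH_tmk (P : DGMod B) (X : A.Obj) {n n' i j j' : ℤ} {Y : B.Obj} (h : n' + 1 = n)
    (e : i + j = n) (hj : j' + 1 = j) (m : P.obj Y i) (x : φ.bar.obj X Y j) :
    φ.tensorBarH P X h (φ.bar.tmk P X e m x) = i.negOnePow •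
      φ.bar.tmk P X (show i + j' = n' by omega) m (φ.contractionApp X Y hj x) := by
  refine (tensorRightApp_tmk (φ := φ.bar) (ψ := φ.bar) P X _ _ _ e (show j + -1 = j' by omega)
    m x).trans ?_
  rw [neg_one_mul, Int.negOnePow_neg]
  rfl

/-- The augmentation `P ⊗ φ.bar ⟶ P ⊗ φ`. -/
noncomputable def tensorBarπ (P : DGMod B) : φ.bar.tensor P ⟶ φ.tensor P where
  app X n := φ.tensorBarπApp P X n
  app_d {X m n} h z := by
    change φ.tensorBarπApp P X n (φ.bar.tensorD P X h z) =
      φ.tensorD P X h (φ.tensorBarπApp P X m z)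
    induction z using φ.bar.tensor_induction with
    | zero => simp
    | add z z' h h' => simp only [map_add, h, h']
    | tmk W p q e x y =>
      rw [φ.bar.tensorD_tmk P X e h rfl rfl, map_add, map_units_smul, tensorBarπApp_tmk,
        tensorBarπApp_tmk, tensorBarπApp_tmk, φ.tensorD_tmk P X e h rfl rfl, augApp_d]
  app_act {X Y i j n} h z a := by
    change φ.tensorBarπApp P X n (φ.bar.tensorAct P h z a) =
      φ.tensorAct P h (φ.tensorBarπApp P Y i z) a
    induction z using φ.bar.tensor_induction with
    | zero => simp
    | add z z' h h' => simp only [map_add, LinearMap.add_apply, h, h']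
    | tmk W p q e x y =>
      rw [φ.bar.tensorAct_tmk P h e rfl, tensorBarπApp_tmk, tensorBarπApp_tmk,
        φ.tensorAct_tmk P h e rfl, augApp_ract]

/-- The section and the contraction of `φ.bar → φ` are compatible with the left action up to Koszul
sign, so they pass to `P ⊗ -` for arbitrary `P`. No flatness of `P` is used. -/
lemma isQuasiIso_tensorBarπ (P : DGMod B) : IsQuasiIso (φ.tensorBarπ P) := by
  refine isQuasiIso_of_contraction _ (φ.tensorBarη P) (fun X _ _ h => φ.tensorBarH P X h)
    (fun X m n h y => ?_) (fun X n y => ?_) fun X l m n h h' x => ?_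
  · change φ.bar.tensorD P X h (φ.tensorBarη P X m y) = φ.tensorBarη P X n (φ.tensorD P X h y)
    induction y using φ.tensor_induction with
    | zero => simp
    | add z z' h h' => simp only [map_add, h, h']
    | tmk W p q e x y =>
      rw [tensorBarη_tmk, φ.bar.tensorD_tmk P X e h rfl rfl, φ.tensorD_tmk P X e h rfl rfl, map_add,
        map_units_smul, tensorBarη_tmk, tensorBarη_tmk]
      rw [d_sectionApp]
  · change φ.tensorBarπApp P X n (φ.tensorBarη P X n y) = y
    induction y using φ.tensor_induction with
    | zero => simp
    | add z z' h h' => simp only [map_add, h, h']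
    | tmk W p q e x y => rw [tensorBarη_tmk, tensorBarπApp_tmk, augApp_sectionApp]
  · change φ.bar.tensorD P X h (φ.tensorBarH P X h x) + φ.tensorBarH P X h' (φ.bar.tensorD P X h' x)
      = (show φ.bar.Tensor P X m from x) - φ.tensorBarη P X m (φ.tensorBarπApp P X m x)
    induction x using φ.bar.tensor_induction with
    | zero => simp
    | add z z' h h' =>
      simp only [map_add]
      rw [add_add_add_comm, h, h']
      abel
    | tmk W p q e x y =>
      have h₁ := φ.d_contractionApp (show q - 1 + 1 = q by omega) rfl y
      rw [tensorBarπApp_tmk, tensorBarη_tmk, φ.tensorBarH_tmk P X h e (show q - 1 + 1 = q by omega),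
        map_units_smul, φ.bar.tensorD_tmk P X _ h rfl (show q - 1 + 1 = q by omega),
        φ.bar.tensorD_tmk P X e h' rfl rfl, map_add, map_units_smul,
        φ.tensorBarH_tmk P X h' _ (show q - 1 + 1 = q by omega),
        φ.tensorBarH_tmk P X h' _ rfl, smul_add, smul_smul, smul_smul, Int.units_mul_self, one_smul,
        one_smul, Int.negOnePow_succ, Units.neg_smul]
      have h₂ := congrArg (φ.bar.tmk P X e x) h₁
      rw [map_add, map_sub] at h₂
      rw [← h₂]
      abel

/-- If `φ` is right perfect and `P` is h-projective and perfect, then `P ⊗ φ` is perfect. -/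
lemma RightPerfect.perfect_tensor {φ : DGBimod B A} (hφ : φ.RightPerfect) {P : DGMod B}
    (hP : P.HProjective) (hP' : P.Cpt) : (φ.tensor P).Perfect := by
  -- Right perfection does not make the modules `φ(-, Y)` h-projective, so `φ` is replaced by
  -- `φ.bar`, whose right modules are h-projective and satisfy `Cpt`.
  rw [← perfect_iff_of_isQuasiIso (φ.isQuasiIso_tensorBarπ P),
    perfect_iff_cpt (φ.bar.hProjective_tensor hP φ.hProjective_bar_right)]
  exact φ.bar.cpt_tensor hP hP' fun Y => (φ.right Y).barResolution.perfect_iff.1 (hφ Y)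

end DGBimod

end DG

/-! ### Induction along fully faithful dg functors -/

namespace DG

open DGMod GHom

variable {k : Type u} [Field k]

/-! ### Induction along fully faithful dg functors -/

namespace DGFunctor

variable {A B : DGCat.{u} k} (F : DGFunctor B A)

/-- The restriction of a morphism. -/
def resHom {M N : DGMod A} (f : M ⟶ N) : M.res F ⟶ N.res F where
  app X n := f.app (F.obj X) n
  app_d h x := f.app_d h x
  app_act h x _ := f.app_act h x _

lemma ofHom_resHom {M N : DGMod A} (f : M ⟶ N) : ofHom (F.resHom f) = F.resG (ofHom f) := by
  refine GHom.ext fun X i j h x => ?_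
  obtain rfl : i = j := by omega
  rfl

lemma isQuasiIso_resHom {M N : DGMod A} {f : M ⟶ N} (hf : IsQuasiIso f) :
    IsQuasiIso (F.resHom f) := fun X => hf (F.obj X)

/-- The adjoint morphism sends `m ⊗ a` to `f m · a`, and the action on a direct sum is
coordinatewise, so the same finite set of summands works. -/
lemma adj_mem_smallIdeal {P : DGMod B} {J : Type u} {N : J → DGMod A} {n : ℤ}
    {f : GHom P ((dsum N).res F) n} (hf : f ∈ (smallIdeal fun j => (N j).res F).mem P n) :
    F.adj f ∈ (smallIdeal N).mem (F.ind P) n := by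
  obtain ⟨S, hS⟩ := hf
  refine ⟨S, fun X i i' h z j hj => ?_⟩
  induction z using F.bimod.tensor_induction with
  | zero =>
    exact congrArg (fun t : Π₀ j, (N j).obj X i' => t j) (map_zero ((F.adj f).app X h))
  | add z z' h₁ h₂ =>
    refine (congrArg (fun t : Π₀ j, (N j).obj X i' => t j)
      (map_add ((F.adj f).app X h) z z')).trans ?_
    refine (DFinsupp.add_apply (β := fun j => (N j).obj X i') _ _ j).trans ?_
    exact (congrArg₂ (· + ·) h₁ h₂).trans (add_zero _)
  | tmk Y p q e m a =>
    refine (congrArg (fun t : Π₀ j, (N j).obj X i' => t j) (F.adj_tmk f X h e m a rfl)).trans ?_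
    refine (dsum_act_apply _ _ _ _).trans ?_
    refine (congrArg (fun t => (N j).act (show p + n + q = i' by omega) t a)
      (hS Y p (p + n) rfl m j hj)).trans ?_
    exact LinearMap.map_zero₂ _ _

lemma adj_sub {P : DGMod B} {N : DGMod A} {n : ℤ} (f g : GHom P (N.res F) n) :
    F.adj (f - g) = F.adj f - F.adj g :=
  F.ind_hom_ext (by rw [map_sub, map_sub, unit_adj, unit_adj, unit_adj])

lemma adj_unit {P : DGMod B} {N : DGMod A} {n : ℤ} (f : GHom (F.ind P) N n) :
    F.adj (comp (zero_add n) (F.unit P) (F.resG f)) = f :=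
  F.ind_hom_ext (by rw [unit_adj])

/-- Restriction, the right adjoint of induction, commutes with direct sums; a primitive modulo the
ideal found on `P` is carried back by adjunction. -/
lemma cpt_ind {P : DGMod B} (hP : P.Cpt) : (F.ind P).Cpt := by
  refine cpt_of_closed fun J N n n' n'' h h' f hf => ?_
  obtain ⟨g, hg⟩ := hP J (fun j => (N j).res F) h h'
    (comp (zero_add n') (F.unit P) (F.resG f)) (by
      have : D h' (comp (zero_add n') (F.unit P) (F.resG f)) = 0 := by
        rw [D_comp_of_closed_left _ h' h' (F.D_unit P rfl), D_resG, hf, map_zero, map_zero]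
      exact this ▸ zero_mem _)
  refine ⟨F.adj g, ?_⟩
  -- The restriction of `dsum N` and the direct sum of the restrictions agree by definition.
  let g' : GHom P ((dsum N).res F) n := g
  have hg' : comp (zero_add n') (F.unit P) (F.resG f) - D h g' ∈
      (smallIdeal fun j => (N j).res F).mem P n' := hg
  have := F.adj_mem_smallIdeal hg'
  rw [adj_sub, adj_unit, ← D_adj] at this
  exact this

/-- All linear maps `F : Hom(X, Y) ⟶ Hom(F X, F Y)` are bijective. -/
def FullyFaithful : Prop := ∀ (X Y : B.Obj) (n : ℤ), Function.Bijective (F.map X Y n)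

variable {F} (hF : F.FullyFaithful)

/-- The bijection on morphisms given by a fully faithful dg functor. -/
noncomputable def FullyFaithful.equiv (X Y : B.Obj) (n : ℤ) :
    B.Hom X Y n ≃ₗ[k] A.Hom (F.obj X) (F.obj Y) n := LinearEquiv.ofBijective _ (hF X Y n)

namespace FullyFaithful

lemma symm_one (X : B.Obj) : (hF.equiv X X 0).symm (A.one (F.obj X)) = B.one X := by
  rw [LinearEquiv.symm_apply_eq]; exact (F.map_one X).symm

lemma map_symm (X Y : B.Obj) (n : ℤ) (a : A.Hom (F.obj X) (F.obj Y) n) :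
    F.map X Y n ((hF.equiv X Y n).symm a) = a := (hF.equiv X Y n).apply_symm_apply a

lemma symm_map_comp {X Y Z : B.Obj} {i j n : ℤ} (h : i + j = n) (b : B.Hom Y Z i)
    (a : A.Hom (F.obj X) (F.obj Y) j) : (hF.equiv X Z n).symm (A.comp h (F.map Y Z i b) a) =
      B.comp h b ((hF.equiv X Y j).symm a) := by
  rw [LinearEquiv.symm_apply_eq]
  exact (congrArg (A.comp h (F.map Y Z i b)) (hF.map_symm X Y j a)).symm.trans
    (F.map_comp h b _).symm

lemma symm_comp_map {X Y Z : B.Obj} {i j n : ℤ} (h : i + j = n) (a : A.Hom (F.obj Y) (F.obj Z) i)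
    (b : B.Hom X Y j) : (hF.equiv X Z n).symm (A.comp h a (F.map X Y j b)) =
      B.comp h ((hF.equiv Y Z i).symm a) b := by
  rw [LinearEquiv.symm_apply_eq]
  exact (congrArg (fun t => A.comp h t (F.map X Y j b)) (hF.map_symm Y Z i a)).symm.trans
    (F.map_comp h _ b).symm

/-- The linear map `m ⊗ F b ↦ m · b`. -/
noncomputable def counitApp (P : DGMod B) (X : B.Obj) (n : ℤ) :
    F.bimod.Tensor P (F.obj X) n →ₗ[k] P.obj X n :=
  F.bimod.tensorLift (fun Y p q e => (P.act e).compl₂ (hF.equiv X Y q).symm.toLinearMap) (by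
    intro Y Y' i j l ij jl h₁ h₂ h₃ h₄ m b x
    refine (P.act_act h₁ h₂ h₃ h₄ m b _).trans ?_
    exact congrArg (P.act h₄ m) (hF.symm_map_comp h₃ b x).symm)

lemma counitApp_tmk (P : DGMod B) (X : B.Obj) {Y : B.Obj} {p q n : ℤ} (e : p + q = n)
    (m : P.obj Y p) (a : A.Hom (F.obj X) (F.obj Y) q) :
    hF.counitApp P X n (F.bimod.tmk P (F.obj X) e m a) = P.act e m ((hF.equiv X Y q).symm a) := by
  exact F.bimod.tensorLift_tmk
    (fun Y p q e => (P.act e).compl₂ (hF.equiv X Y q).symm.toLinearMap) _ e m a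

/-- The graded morphism `m ⊗ F b ↦ m · b`. -/
noncomputable def unitInv (P : DGMod B) : GHom ((F.ind P).res F) P 0 where
  app X i j h := P.cast X (show i = j by omega) ∘ₗ hF.counitApp P X i
  app_act {X Y i j p i' j'} h hi h' z b := by
    obtain rfl : i = j := by omega
    obtain rfl : i' = j' := by omega
    change hF.counitApp P X i' (F.bimod.tensorAct P hi z (F.map X Y p b)) =
      P.act hi (hF.counitApp P Y i z) b
    induction z using F.bimod.tensor_induction with
    | zero => simp
    | add z z' h h' => simp only [map_add, LinearMap.add_apply, h, h']
    | tmk W s t e m a =>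
      rw [F.bimod.tensorAct_tmk P hi e rfl m a]
      refine (hF.counitApp_tmk P X (show s + (t + p) = i' by omega) m
        (A.comp rfl a (F.map X Y p b))).trans ?_
      rw [hF.symm_comp_map]
      refine Eq.trans ?_ (congrArg (fun t => P.act hi t b) (hF.counitApp_tmk P Y e m a).symm)
      exact (P.act_act e hi rfl _ m _ b).symm

lemma unit_unitInv (P : DGMod B) : comp (add_zero 0) (F.unit P) (hF.unitInv P) = GHom.id P := by
  refine GHom.ext fun X i j h x => ?_
  obtain rfl : i = j := by omega
  rw [GHom.comp_app _ _ _ X h (add_zero i)]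
  refine (hF.counitApp_tmk P X (add_zero i) x (A.one _)).trans ?_
  rw [hF.symm_one]
  exact P.act_one x

/-- For `b` a morphism with `F b = a`, one has `(m · b) ⊗ 1 = m ⊗ a`; full faithfulness supplies
`b`. Thus the unit of the adjunction is an isomorphism. -/
lemma unitInv_unit (P : DGMod B) :
    comp (add_zero 0) (hF.unitInv P) (F.unit P) = GHom.id ((F.ind P).res F) := by
  refine GHom.ext fun X i j h z => ?_
  obtain rfl : i = j := by omega
  rw [GHom.comp_app _ _ _ X h (add_zero i)]
  change F.bimod.tmk P (F.obj X) h (hF.counitApp P X i z) (A.one _) = z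
  induction z using F.bimod.tensor_induction with
  | zero => simp
  | add z z' h h' => simp only [map_add, LinearMap.add_apply, h, h']
  | tmk Y p q e m a =>
    rw [hF.counitApp_tmk P X e m a]
    refine (F.bimod.tmk_act P (F.obj X) e h (add_zero q) e m _ (A.one _)).trans ?_
    refine congrArg (F.bimod.tmk P (F.obj X) e m) ?_
    exact (A.comp_one _).trans (hF.map_symm X Y q a)

lemma D_unitInv (P : DGMod B) : D (zero_add 1) (hF.unitInv P) = 0 := by
  have h : comp (zero_add 1) (F.unit P) (D (zero_add 1) (hF.unitInv P)) = 0 := by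
    rw [← D_unit_comp, unit_unitInv, D_ofHom]
  rw [← id_comp (D (zero_add 1) (hF.unitInv P)), ← hF.unitInv_unit,
    comp_assoc (add_zero 0) (zero_add 1) (zero_add 1) (zero_add 1), h, map_zero]

-- Induction reflects `Cpt` along a fully faithful functor: through the unit isomorphisms a morphism
-- from `P` to a sum of the `N j` is the restriction of one from `F.ind P` to the sum of the `F.ind
-- (N j)`, up to these isomorphisms.
include hF in
lemma cpt_of_cpt_ind {P : DGMod B} (hP : (F.ind P).Cpt) : P.Cpt := by
  refine cpt_of_closed fun J N n n' n'' h h' f hf => ?_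
  let U : GHom (dsum N) ((dsum fun j => F.ind (N j)).res F) 0 := dsumMap fun j => F.unit (N j)
  let V : GHom ((dsum fun j => F.ind (N j)).res F) (dsum N) 0 := dsumMap fun j => hF.unitInv (N j)
  have hU : D (zero_add 1) U = 0 := D_dsumMap_eq_zero _ fun j => F.D_unit (N j) _
  have hV : D (zero_add 1) V = 0 := D_dsumMap_eq_zero _ fun j => hF.D_unitInv (N j)
  have hUV : comp (add_zero 0) U V = GHom.id (dsum N) := by
    refine (dsumMap_comp (add_zero 0) (fun j => F.unit (N j)) fun j => hF.unitInv (N j)).trans ?_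
    simp only [unit_unitInv]
    exact dsumMap_id
  obtain ⟨g, S, hS⟩ := hP J (fun j => F.ind (N j)) h h' (F.adj (comp (add_zero n') f U)) (by
    rw [D_adj, D_comp_of_closed_right _ h' h' f hU, hf]
    have : F.adj (comp (add_zero n'') (0 : GHom P (dsum N) n'') U) = 0 :=
      F.ind_hom_ext (by rw [unit_adj, map_zero, map_zero, map_zero, LinearMap.zero_apply])
    rw [Int.negOnePow_zero, one_smul, this]
    exact zero_mem _)
  refine ⟨comp (add_zero n) (comp (zero_add n) (F.unit P) (F.resG g)) V, ?_⟩
  have hg : F.resG (F.adj (comp (add_zero n') f U) - D h g) ∈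
      (smallIdeal fun j => (F.ind (N j)).res F).mem ((F.ind P).res F) n' :=
    ⟨S, fun X i i' h x j hj => hS (F.obj X) i i' h x j hj⟩
  have := comp_dsumMap_mem (add_zero n') ((smallIdeal _).precomp (zero_add n') (F.unit P) _ hg)
    fun j => hF.unitInv (N j)
  refine (congrArg (· ∈ (smallIdeal N).mem P n') ?_).mp this
  change comp (add_zero n') (comp (zero_add n') (F.unit P) (F.resG (_ - _))) V = _
  rw [D_comp_of_closed_right _ h h _ hV, Int.negOnePow_zero, one_smul, D_unit_comp, D_resG, map_sub,
    map_sub, unit_adj, map_sub, LinearMap.sub_apply,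
    comp_assoc (add_zero n') (add_zero n') (add_zero 0) (add_zero n'), hUV, comp_id]

end FullyFaithful

variable (F) in
/-- The morphism `P ⊗ A(-, F) ⟶ N` which corresponds to a morphism `P ⟶ N.res F`. -/
noncomputable def indDesc {P : DGMod B} {N : DGMod A} (g : P ⟶ N.res F) : F.ind P ⟶ N :=
  toHom (F.adj (ofHom g)) (by
    rw [D_adj, D_ofHom]
    exact F.ind_hom_ext (by rw [unit_adj, map_zero, map_zero]))

variable (F) in
lemma indDesc_tmk {P : DGMod B} {N : DGMod A} (g : P ⟶ N.res F) (X : A.Obj) {Y : B.Obj}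
    {p q n : ℤ} (e : p + q = n) (m : P.obj Y p) (a : A.Hom X (F.obj Y) q) :
    (F.indDesc g).app X n (F.bimod.tmk P X e m a) =
      N.act (X := X) (Y := F.obj Y) e (g.app Y p m) a :=
  F.adj_tmk (ofHom g) X (add_zero n) e m a (add_zero p)

-- After restriction, the morphism adjoint to `g` is the inverse of the unit followed by `g`, and
-- the unit is an isomorphism.
include hF in
lemma FullyFaithful.isQuasiIso_resHom_indDesc {P : DGMod B} {N : DGMod A} {g : P ⟶ N.res F}
    (hg : IsQuasiIso g) : IsQuasiIso (F.resHom (F.indDesc g)) := by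
  have e : F.resHom (F.indDesc g) = toHom (hF.unitInv P) (hF.D_unitInv P) ≫ g := by
    apply ofHom_injective
    rw [ofHom_resHom, ofHom_comp, ofHom_toHom, indDesc, ofHom_toHom,
      ← id_comp (F.resG (F.adj (ofHom g))), ← hF.unitInv_unit,
      comp_assoc (add_zero 0) (zero_add 0) (zero_add 0) (zero_add 0), unit_adj]
  rw [e]
  refine IsQuasiIso.comp (isQuasiIso_of_contraction _ (fun X n => (F.unit P).app X (add_zero n))
    (fun _ _ _ _ => 0) (fun X m n h y => ?_) (fun X n y => ?_) fun X l m n h h' x => ?_) hg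
  · have := congrArg (fun f => f.app X (show m + 1 = n from h) y) (F.D_unit P (zero_add 1))
    rw [D_app _ (F.unit P) X _ h h] at this
    rw [Int.negOnePow_zero, one_smul] at this
    exact sub_eq_zero.1 this
  · have := congrArg (fun f => f.app X (add_zero n) y) (hF.unit_unitInv P)
    rw [GHom.comp_app _ _ _ X _ (add_zero n)] at this
    exact this
  · have := congrArg (fun f => f.app X (add_zero m) x) (hF.unitInv_unit P)
    rw [GHom.comp_app _ _ _ X _ (add_zero m)] at this
    rw [LinearMap.zero_apply, LinearMap.zero_apply, map_zero, zero_add]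
    exact (sub_eq_zero.2 this.symm).symm

end DGFunctor

end DG

/-! ### Gluing over the directed dg category -/

namespace DG

open DGMod GHom

variable {k : Type u} [Field k]

namespace DGBimod

variable {A B : DGCat.{u} k} (φ : DGBimod B A)

/-! ### Dg modules over the directed dg category -/

lemma fullyFaithful_inclA : φ.inclA.FullyFaithful := fun _ _ _ => Function.bijective_id

lemma fullyFaithful_inclB : φ.inclB.FullyFaithful := fun _ _ _ => Function.bijective_id

section

variable {φ} {M E : DGMod φ.directed}

lemma ghom_ext_of_subsingleton (hE : ∀ X n, Subsingleton (E.obj (Sum.inl X) n)) {n : ℤ}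
    {f g : GHom M E n} (h : φ.inclB.resG f = φ.inclB.resG g) : f = g := by
  refine GHom.ext fun X i j e x => ?_
  rcases X with X | Y
  · exact (hE X j).elim _ _
  · exact congrArg (fun t => t.app Y e x) h

/-- If `E` vanishes on the objects of `A`, graded morphisms of the restrictions to `B` extend. -/
lemma exists_resG_eq (hE : ∀ X n, Subsingleton (E.obj (Sum.inl X) n)) {n : ℤ}
    (f : GHom (M.res φ.inclB) (E.res φ.inclB) n) : ∃ g : GHom M E n, φ.inclB.resG g = f := by
  refine ⟨⟨fun X => match X with
    | .inl _ => fun _ => 0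
    | .inr Y => fun h => f.app Y h, ?_⟩, rfl⟩
  rintro (X | X) (Y | Y) i j p i' j' h hi h' x a
  · exact (hE X j').elim _ _
  · exact (hE X j').elim _ _
  · obtain rfl : a = 0 := Subsingleton.elim (α := PUnit) a 0
    rw [map_zero, map_zero, map_zero]
  · exact f.app_act h hi h' x a

lemma exists_resG_eq_and_D_eq (hE : ∀ X n, Subsingleton (E.obj (Sum.inl X) n)) {n n' : ℤ}
    (h : n + 1 = n') (f : GHom (M.res φ.inclB) (E.res φ.inclB) n) (hf : D h f = 0) :
    ∃ g : GHom M E n, φ.inclB.resG g = f ∧ D h g = 0 := by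
  obtain ⟨g, hg⟩ := exists_resG_eq hE f
  refine ⟨g, hg, ghom_ext_of_subsingleton hE ?_⟩
  rw [← DGFunctor.D_resG, hg, hf, map_zero]

end

/-- The components of the extension by zero of a dg `B`-module. -/
def extObj (N : DGMod B) : A.Obj ⊕ B.Obj → ℤ → ModuleCat.{u} k
  | .inl _, _ => ModuleCat.of k PUnit
  | .inr Y, n => N.obj Y n

/-- The differentials of the extension by zero. -/
def extD (N : DGMod B) : ∀ (X : A.Obj ⊕ B.Obj) {m n : ℤ}, m + 1 = n →
    (extObj N X m →ₗ[k] extObj N X n)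
  | .inl _, _, _, _ => 0
  | .inr Y, _, _, h => N.d Y h

/-- The action on the extension by zero. -/
def extAct (N : DGMod B) : ∀ (X Y : A.Obj ⊕ B.Obj) {i j n : ℤ}, i + j = n →
    (extObj N Y i →ₗ[k] φ.dirHom X Y j →ₗ[k] extObj N X n)
  | .inr _, .inr _, _, _, _, h => N.act h
  | .inl _, _, _, _, _, _ => 0
  | .inr _, .inl _, _, _, _, _ => 0

/-- The extension by zero of a dg `B`-module. -/
def ext (N : DGMod B) : DGMod φ.directed where
  obj := extObj N
  d := extD N
  d_d := by
    rintro (X | Y) l m n h h' x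
    · rfl
    · exact N.d_d Y h h' x
  act {X Y _ _ _} h := φ.extAct N X Y h
  act_one := by
    rintro (X | Y) n x
    · rfl
    · exact N.act_one x
  act_act := by
    rintro (X | X) (Y | Y) (Z | Z) i j l ij jl n h₁ h₂ h₃ h₄ x g f
    all_goals first
      | rfl
      | exact N.act_act h₁ h₂ h₃ h₄ x g f
      | exact LinearMap.map_zero₂ (N.act h₂) f
      | exact (map_zero (N.act h₄ x)).symm
  d_act := by
    rintro (X | X) (Y | Y) i i' j j' n n' h hi hj hn x f
    · rfl
    · rfl
    · refine (map_zero (N.d X hn)).trans ?_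
      exact ((zero_add _).trans (smul_zero _)).symm
    · exact N.d_act h hi hj hn x f

variable {φ}

/-- Extension by zero is right adjoint to restriction to `B` on graded morphisms, and it preserves
acyclic modules. -/
lemma hProjective_res_inclB {M : DGMod φ.directed} (hM : M.HProjective) :
    (M.res φ.inclB).HProjective := by
  refine hProjective_of_exists_D_eq fun N hN n n' n'' h h' f hf => ?_
  obtain ⟨g, rfl, hg⟩ := exists_resG_eq_and_D_eq (E := φ.ext N)
    (fun _ _ => inferInstanceAs (Subsingleton PUnit)) h' f hf
  have : (φ.ext N).Acyclic := by
    rintro (X | Y) l m n h h' x hx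
    · exact ⟨0, rfl⟩
    · exact hN Y l m n h h' x hx
  obtain ⟨e, rfl⟩ := hM.exists_D_eq this h h' g hg
  exact ⟨φ.inclB.resG e, rfl⟩

/-- Same adjunction as for h-projectivity, now using that a direct sum of extensions by zero
vanishes on `A` and restricts to the direct sum on `B`. -/
lemma cpt_res_inclB {M : DGMod φ.directed} (hM : M.Cpt) : (M.res φ.inclB).Cpt := by
  refine cpt_of_closed fun J N n n' n'' h h' f hf => ?_
  obtain ⟨g, rfl, hg⟩ := exists_resG_eq_and_D_eq (E := dsum fun j => φ.ext (N j))
    (fun X n => (⟨fun x y => DFinsupp.ext fun j => rfl⟩ :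
      Subsingleton (Π₀ j, (φ.ext (N j)).obj (Sum.inl X) n))) h' f hf
  obtain ⟨e, S, hS⟩ := hM J (fun j => φ.ext (N j)) h h' g (hg ▸ zero_mem _)
  exact ⟨φ.inclB.resG e, S, fun Y i i' e x => hS (Sum.inr Y) i i' e x⟩

-- On an object of `A`, the bimodule inducing along `b` is `φ`, so `b_! P` restricts to `P ⊗_B φ`.
-- On generators both morphisms send `m ⊗ x` to `π m · x`.
variable (φ) in
lemma derivedActionMap_eq (M : DGMod φ.directed) (R : HProjResolution (M.res φ.inclB)) :
    φ.derivedActionMap M R = φ.inclA.resHom (φ.inclB.indDesc R.π) := by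
  refine hom_ext fun X n z => ?_
  refine LinearMap.congr_fun (φ.tensor_hom_ext (f := (φ.derivedActionMap M R).app X n)
    (g := (φ.inclA.resHom (φ.inclB.indDesc R.π)).app X n) fun Y i j e m x => ?_) z
  refine Eq.trans ?_ (φ.inclB.indDesc_tmk R.π (Sum.inl X) e m x).symm
  change φ.actionApp M X n (φ.tensorMapApp R.π X n (φ.tmk R.P X e m x)) = _
  rw [φ.tensorMapApp_tmk, φ.actionApp_tmk]
  rfl

/-- The generators `m ⊗ x` have `x` in a hom-complex from `B` to `A`, which is zero. -/
instance subsingleton_ind_inclA (K : DGMod A) (Y : B.Obj) (n : ℤ) :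
    Subsingleton ((φ.inclA.ind K).obj (Sum.inr Y) n) := by
  have h : (LinearMap.id : φ.inclA.bimod.Tensor K (Sum.inr Y) n →ₗ[k] _) = 0 :=
    φ.inclA.bimod.tensor_hom_ext fun X i j e m x => by
      obtain rfl : x = 0 := Subsingleton.elim (α := PUnit) x 0
      rw [map_zero, map_zero, map_zero]
  exact ⟨fun x y => (LinearMap.congr_fun h x).trans (LinearMap.congr_fun h y).symm⟩

/-- A dg module which is acyclic on the objects of `B` is induced from `A`. -/
lemma isQuasiIso_indDesc_inclA {E : DGMod φ.directed} (hE : (E.res φ.inclB).Acyclic)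
    {K : DGMod A} {g : K ⟶ E.res φ.inclA} (hg : IsQuasiIso g) :
    IsQuasiIso (φ.inclA.indDesc g) := by
  rintro (X | Y) l m n h h'
  -- On `A` the claim is full faithfulness of `a`; on `B` the source is zero and the target acyclic
  -- by hypothesis.
  · exact φ.fullyFaithful_inclA.isQuasiIso_resHom_indDesc hg X l m n h h'
  · refine ⟨fun x _ _ => ⟨0, Subsingleton.elim _ _⟩, fun y hy => ?_⟩
    obtain ⟨z, hz⟩ := hE Y l m n h h' y hy
    refine ⟨0, z, map_zero _, ?_⟩
    rw [map_zero, zero_add]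
    exact hz.symm

/-- Such an `E` is quasi-isomorphic to `a_!` of a resolution of `a_* E`, and `a_!` both preserves
and reflects `Cpt`. -/
lemma perfect_iff_of_acyclic_res_inclB {E : DGMod φ.directed} (hE : (E.res φ.inclB).Acyclic) :
    E.Perfect ↔ (E.res φ.inclA).Perfect := by
  let R := (E.res φ.inclA).barResolution
  rw [R.perfect_iff, ← perfect_iff_of_isQuasiIso (isQuasiIso_indDesc_inclA hE R.isQuasiIso),
    perfect_iff_cpt (φ.inclA.hProjective_ind R.hProjective)]
  exact ⟨φ.fullyFaithful_inclA.cpt_of_cpt_ind, φ.inclA.cpt_ind⟩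

/-- The restriction of the bar resolution of `M` is an h-projective resolution of `b_* M`, and
restriction to `B` preserves `Cpt`. -/
lemma perfect_res_inclB {M : DGMod φ.directed} (hM : M.Perfect) : (M.res φ.inclB).Perfect := by
  rw [← perfect_iff_of_isQuasiIso (φ.inclB.isQuasiIso_resHom M.isQuasiIso_barπ),
    perfect_iff_cpt (hProjective_res_inclB M.hProjective_bar)]
  exact cpt_res_inclB (M.barResolution.perfect_iff.1 hM)

/-- If `b_* M` is perfect, then `M` is perfect if and only if the cone of the action morphism
`b_* M ⊗ᴸ_B φ ⟶ a_* M` is perfect. -/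
lemma perfect_iff_perfect_cone {M : DGMod φ.directed} (R : HProjResolution (M.res φ.inclB))
    (hM : (M.res φ.inclB).Perfect) : M.Perfect ↔ (cone (φ.derivedActionMap M R)).Perfect := by
  have h₁ : (φ.inclB.ind R.P).Perfect :=
    (perfect_iff_cpt (φ.inclB.hProjective_ind R.hProjective)).2
      (φ.inclB.cpt_ind (R.perfect_iff.1 hM))
  -- As `b` is fully faithful, `b_! P → M` is a quasi-isomorphism on the objects of `B`, so its cone
  -- is acyclic there.
  have h₂ : ((cone (φ.inclB.indDesc R.π)).res φ.inclB).Acyclic :=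
    (isQuasiIso_iff_acyclic_cone _).1
      (φ.fullyFaithful_inclB.isQuasiIso_resHom_indDesc R.isQuasiIso)
  -- As `b_! P` is perfect, `M` may be replaced by the cone of `b_! P → M`, and that cone by its
  -- restriction to `A`. Restriction commutes with cones by definition, which leaves the cone of the
  -- derived action map.
  rw [← perfect_cone_iff (φ.inclB.indDesc R.π) h₁, perfect_iff_of_acyclic_res_inclB h₂,
    derivedActionMap_eq]
  rfl

lemma perfect_iff {M : DGMod φ.directed} (R : HProjResolution (M.res φ.inclB)) :
    M.Perfect ↔ (M.res φ.inclB).Perfect ∧ (cone (φ.derivedActionMap M R)).Perfect :=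
  ⟨fun h => ⟨perfect_res_inclB h, (perfect_iff_perfect_cone R (perfect_res_inclB h)).1 h⟩,
    fun h => (perfect_iff_perfect_cone R h.1).2 h.2⟩

lemma RightPerfect.perfect_iff (hφ : φ.RightPerfect) (M : DGMod φ.directed) :
    M.Perfect ↔ (M.res φ.inclA).Perfect ∧ (M.res φ.inclB).Perfect := by
  let R := (M.res φ.inclB).barResolution
  rw [DGBimod.perfect_iff R, and_comm]
  refine and_congr_left fun h => ?_
  -- With `b_* M` perfect, `P ⊗_B φ` is perfect, so the cone of the derived action map is perfect
  -- exactly when its target `a_* M` is.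
  exact perfect_cone_iff _ (hφ.perfect_tensor R.hProjective (R.perfect_iff.1 h))

end DGBimod

end DG

theorem mainTheorem7 {k : Type u} [Field k] (A B : DG.DGCat.{u} k) (φ : DG.DGBimod B A)
    (M : DG.DGMod φ.directed) :
    (Nonempty (DG.DGMod.HProjResolution (M.res φ.inclB)) ∧
      ∀ R : DG.DGMod.HProjResolution (M.res φ.inclB),
        (M.Perfect ↔
          (M.res φ.inclB).Perfect ∧ (DG.DGMod.cone (φ.derivedActionMap M R)).Perfect)) ∧
    (φ.RightPerfect →
      (M.Perfect ↔ (M.res φ.inclA).Perfect ∧ (M.res φ.inclB).Perfect)) :=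
  ⟨⟨⟨(M.res φ.inclB).barResolution⟩, fun R => DG.DGBimod.perfect_iff R⟩,
    fun hφ => hφ.perfect_iff M⟩
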